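/- Let $n,m\ge 1$ be integers, and let $k$ be an even positive integer with $k>n+m+1$. Let $\mathcal M$ be a positive definite symmetric real $m\times m$ matrix which is half-integral (that is, $\mathcal M_{pp}\in\mathbb Z$ and $2\mathcal M_{pq}\in\mathbb Z$ for all $p,q$). Let $H_n$ be the Siegel upper half plane of degree $n$ (complex symmetric $n\times n$ matrices with positive definite imaginary part), and $\Gamma_n=Sp(n,\mathbb Z)$. For $\gamma=\begin{pmatrix}A&B\\ C&D\end{pmatrix}\in\Gamma_n$ and $Z\in H_n$ put $\gamma\langle Z\rangle=(AZ+B)(CZ+D)^{-1}$ and $j(\gamma,Z)=CZ+D$. Let $\Gamma_{n,0}=\{\gamma\in\Gamma_n: C=0\}$, let $\mathcal R$ be a complete system of representatives of the cosets $\Gamma_{n,0}\backslash\Gamma_n$, and let $\Lambda$ be a complete system of representatives of $\mathbb Z^{(m,n)}/(\ker\mathcal M\cap\mathbb Z^{(m,n)})$, where $\mathbb Z^{(m,n)}$ is the group of integral $m\times n$ matrices and $\ker\mathcal M=\{\lambda\in\mathbb R^{(m,n)}:\mathcal M\lambda=0\}$. Write $\sigma$ for the trace. For $Z\in H_n$ and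 $W\in\mathbb C^{(m,n)}$ let $$E^{(n)}_{k,\mathcal M}(Z,W)=\sum_{\gamma\in\mathcal R}\det j(\gamma,Z)^{-k}\,e^{-2\pi i\sigma(\mathcal M W(CZ+D)^{-1}C\,{}^tW)}\sum_{\lambda\in\Lambda}e^{2\pi i\sigma(\mathcal M(\lambda\,\gamma\langle Z\rangle\,{}^t\lambda+2\lambda\,{}^t(CZ+D)^{-1}\,{}^tW))}$$ be the Jacobi--Eisenstein series, where $\begin{pmatrix}A&B\\ C&D\end{pmatrix}=\gamma$. Let $P$ be a homogeneous complex polynomial in the entries of $W=(W_{pi})\in\mathbb C^{(m,n)}$ that is pluriharmonic with respect to $(2\mathcal M)^{-1}$, i.e. $\sum_{p,q=1}^m(2\mathcal M)_{pq}\,\dfrac{\partial^2P}{\partial W_{pi}\,\partial W_{ql}}=0$ for all $1\le i,l\le n$, and let $P(\partial_W)$ be the differential operator obtained by substituting $\partial/\partial W_{pi}$ for $W_{pi}$. Then: 1. For every $Z\in H_n$ the double series defining $E^{(n)}_{k,\mathcal M}(Z,W)$ converges absolutely for all $W$, is holomorphic in $W$, and $$P(\partial_W)E^{(n)}_{k,\mathcal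 M}(Z,W)\Big|_{W=0}=\sum_{\gamma\in\mathcal R}\sum_{\lambda\in\Lambda}\det j(\gamma,Z)^{-k}\,P\bigl(4\pi i\,\mathcal M\lambda\,{}^tj(\gamma,Z)^{-1}\bigr)\,e^{2\pi i\sigma(\mathcal M\lambda\,\gamma\langle Z\rangle\,{}^t\lambda)}.$$ 2. For all $M\in\Gamma_n$ and $Z\in H_n$, both double series below converge absolutely and $$\det j(M,Z)^k\sum_{\gamma\in\mathcal R}\sum_{\lambda\in\Lambda}\det j(\gamma,Z)^{-k}\,P\bigl(4\pi i\,\mathcal M\lambda\,{}^tj(\gamma,Z)^{-1}\bigr)\,e^{2\pi i\sigma(\mathcal M\lambda\,\gamma\langle Z\rangle\,{}^t\lambda)}$$ $$=\sum_{\gamma\in\mathcal R}\sum_{\lambda\in\Lambda}\det j(\gamma,M\langle Z\rangle)^{-k}\,P\bigl(4\pi i\,\mathcal M\lambda\,{}^tj(\gamma M,Z)^{-1}\bigr)\,e^{2\pi i\sigma(\mathcal M\lambda\,(\gamma M)\langle Z\rangle\,{}^t\lambda)}.$$ -/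

import Mathlib

namespace SiegelJacobi

noncomputable section

/-- The Siegel modular group `Γ_n = Sp(n, ℤ)`. -/
abbrev Gam (n : ℕ) : Type := Matrix.symplecticGroup (Fin n) ℤ

/-- The Siegel upper half plane `H_n`: complex symmetric matrices with positive definite
imaginary part. -/
def upperHalf (n : ℕ) : Set (Matrix (Fin n) (Fin n) ℂ) :=
  {Z | Z.IsSymm ∧ (Z.map Complex.im).PosDef}

variable {m n : ℕ}

/-- The four blocks of `γ = (A B; C D)`, as complex matrices. -/
def blockA (γ : Gam n) : Matrix (Fin n) (Fin n) ℂ := γ.1.toBlocks₁₁.map (Int.cast : ℤ → ℂ)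
def blockB (γ : Gam n) : Matrix (Fin n) (Fin n) ℂ := γ.1.toBlocks₁₂.map (Int.cast : ℤ → ℂ)
def blockC (γ : Gam n) : Matrix (Fin n) (Fin n) ℂ := γ.1.toBlocks₂₁.map (Int.cast : ℤ → ℂ)
def blockD (γ : Gam n) : Matrix (Fin n) (Fin n) ℂ := γ.1.toBlocks₂₂.map (Int.cast : ℤ → ℂ)

/-- The automorphic factor `j(γ, Z) = C Z + D`. -/
def j (γ : Gam n) (Z : Matrix (Fin n) (Fin n) ℂ) : Matrix (Fin n) (Fin n) ℂ :=
  blockC γ * Z + blockD γ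

/-- The action `γ<Z> = (A Z + B) (C Z + D)⁻¹`. -/
def act (γ : Gam n) (Z : Matrix (Fin n) (Fin n) ℂ) : Matrix (Fin n) (Fin n) ℂ :=
  (blockA γ * Z + blockB γ) * (j γ Z)⁻¹

/-- The subgroup `Γ_{n,0}` of `Γ_n` given by `C = 0`. -/
def Gam0 (n : ℕ) : Subgroup (Gam n) where
  carrier := {γ | γ.1.toBlocks₂₁ = 0}
  one_mem' := by
    ext i k
    simp [Matrix.toBlocks₂₁]
  mul_mem' := by
    intro a b ha hb
    have ha' : a.1.toBlocks₂₁ = 0 := ha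
    have hb' : b.1.toBlocks₂₁ = 0 := hb
    change (a.1 * b.1).toBlocks₂₁ = 0
    rw [← Matrix.fromBlocks_toBlocks a.1, ← Matrix.fromBlocks_toBlocks b.1,
      Matrix.fromBlocks_multiply, Matrix.toBlocks_fromBlocks₂₁, ha', hb']
    simp
  inv_mem' := by
    intro a ha
    have ha' : a.1.toBlocks₂₁ = 0 := ha
    change (a⁻¹).1.toBlocks₂₁ = 0
    rw [SymplecticGroup.coe_inv, ← Matrix.fromBlocks_toBlocks a.1, ha', Matrix.J,
      Matrix.fromBlocks_transpose, Matrix.fromBlocks_neg, Matrix.fromBlocks_multiply,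
      Matrix.fromBlocks_multiply, Matrix.toBlocks_fromBlocks₂₁]
    simp

/-- The lattice `ker(S) ∩ ℤ^(m,n)`, where `ker(S) = {l ∈ ℝ^(m,n) | S l = 0}`. -/
def kerLattice (n : ℕ) (S : Matrix (Fin m) (Fin m) ℝ) :
    AddSubgroup (Matrix (Fin m) (Fin n) ℤ) where
  carrier := {l | S * l.map (Int.cast : ℤ → ℝ) = 0}
  zero_mem' := by
    simp
  add_mem' := by
    intro a b ha hb
    have ha' : S * a.map (Int.cast : ℤ → ℝ) = 0 := ha
    have hb' : S * b.map (Int.cast : ℤ → ℝ) = 0 := hb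
    change S * (a + b).map (Int.cast : ℤ → ℝ) = 0
    rw [Matrix.map_add _ (fun x y => Int.cast_add x y), Matrix.mul_add, ha', hb', add_zero]
  neg_mem' := by
    intro a ha
    have ha' : S * a.map (Int.cast : ℤ → ℝ) = 0 := ha
    change S * (-a).map (Int.cast : ℤ → ℝ) = 0
    have h : (-a).map (Int.cast : ℤ → ℝ) = -(a.map (Int.cast : ℤ → ℝ)) := by
      ext i k
      simp
    rw [h, Matrix.mul_neg, ha', neg_zero]

/-- `S` is half-integral: integral diagonal entries, and `2 S` integral. -/
def IsHalfIntegral (S : Matrix (Fin m) (Fin m) ℝ) : Prop :=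
  (∀ p, ∃ a : ℤ, S p p = a) ∧ ∀ p q, ∃ a : ℤ, 2 * S p q = a

/-- `P` is pluriharmonic with respect to `S`: with `(t_pq) = S⁻¹`, all the operators
`Δ_{i,l} = ∑_{p,q} t_pq ∂² / ∂W_{pi} ∂W_{ql}` annihilate `P`. -/
def IsPluriharmonic (S : Matrix (Fin m) (Fin m) ℝ) (P : MvPolynomial (Fin m × Fin n) ℂ) : Prop :=
  ∀ i l : Fin n, ∑ p : Fin m, ∑ q : Fin m,
    MvPolynomial.C ((S⁻¹ p q : ℝ) : ℂ) *
      MvPolynomial.pderiv (p, i) (MvPolynomial.pderiv (q, l) P) = 0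

/-- The value `P(X)` of a polynomial in the entries of an `m × n` matrix. -/
def evalAt (P : MvPolynomial (Fin m × Fin n) ℂ) (X : Matrix (Fin m) (Fin n) ℂ) : ℂ :=
  MvPolynomial.eval (fun p => X p.1 p.2) P

/-- The partial derivative `∂f / ∂W_{pi}` of a function of an `m × n` matrix. -/
def partialW (p : Fin m × Fin n) (f : Matrix (Fin m) (Fin n) ℂ → ℂ) :
    Matrix (Fin m) (Fin n) ℂ → ℂ :=
  fun W => deriv (fun t : ℂ => f (W + Matrix.single p.1 p.2 t)) 0

/-- The iterated partial derivative `∏ (∂ / ∂W_{pi}) ^ d_{pi}` (in lexicographic order). -/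
def monomialDiff (d : (Fin m × Fin n) →₀ ℕ) (f : Matrix (Fin m) (Fin n) ℂ → ℂ) :
    Matrix (Fin m) (Fin n) ℂ → ℂ :=
  ((List.finRange m).product (List.finRange n)).foldr (fun p g => (partialW p)^[d p] g) f

/-- The differential operator `P(∂_W)`. -/
def diffOp (P : MvPolynomial (Fin m × Fin n) ℂ) (f : Matrix (Fin m) (Fin n) ℂ → ℂ) :
    Matrix (Fin m) (Fin n) ℂ → ℂ :=
  fun W => ∑ d ∈ P.support, P.coeff d * monomialDiff d f W

/-- A real or an integral matrix, as a complex matrix. -/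
def ofReal {a b : ℕ} (S : Matrix (Fin a) (Fin b) ℝ) : Matrix (Fin a) (Fin b) ℂ :=
  S.map Complex.ofReal
def ofInt {a b : ℕ} (l : Matrix (Fin a) (Fin b) ℤ) : Matrix (Fin a) (Fin b) ℂ :=
  l.map (Int.cast : ℤ → ℂ)

/-- The `(γ, l)` term of the Jacobi-Eisenstein series of weight `k` and index `S`:
`det(CZ+D)^(-k) exp(-2πi tr(S W (CZ+D)⁻¹ C ᵗW))
  exp(2πi tr(S (l γ<Z> ᵗl + 2 l ᵗ(CZ+D)⁻¹ ᵗW)))`. -/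
def eisensteinTerm (k : ℕ) (S : Matrix (Fin m) (Fin m) ℝ) (γ : Gam n)
    (l : Matrix (Fin m) (Fin n) ℤ) (Z : Matrix (Fin n) (Fin n) ℂ)
    (W : Matrix (Fin m) (Fin n) ℂ) : ℂ :=
  (j γ Z).det ^ (-(k : ℤ)) *
    Complex.exp (-(2 * Real.pi * Complex.I *
      (ofReal S * W * (j γ Z)⁻¹ * blockC γ * W.transpose).trace)) *
    Complex.exp (2 * Real.pi * Complex.I *
      (ofReal S * (ofInt l * act γ Z * (ofInt l).transpose +
        (2 : ℂ) • (ofInt l * (j γ Z)⁻¹.transpose * W.transpose))).trace)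

/-- The Jacobi-Eisenstein series of weight `k` and index `S`, summed over a system `R` of
representatives of `Γ_{n,0} \ Γ_n` and a system `L` of lattice representatives. -/
def eisenstein (k : ℕ) (S : Matrix (Fin m) (Fin m) ℝ) (R : Set (Gam n))
    (L : Set (Matrix (Fin m) (Fin n) ℤ)) (Z : Matrix (Fin n) (Fin n) ℂ)
    (W : Matrix (Fin m) (Fin n) ℂ) : ℂ :=
  ∑' γ : R, ∑' l : L, eisensteinTerm k S γ.1 l.1 Z W

/-- The term `det j(γ,Z)^(-k) P(4πi S l ᵗj(δ,Z')⁻¹) exp(2πi tr(S l δ<Z'> ᵗl))`, which occurs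
with `(δ, Z') = (γ, Z)` and with `(γ, Z, δ, Z') = (γ, g<Z>, γ g, Z)`. -/
def weightedTerm (k : ℕ) (S : Matrix (Fin m) (Fin m) ℝ) (P : MvPolynomial (Fin m × Fin n) ℂ)
    (γ : Gam n) (Z : Matrix (Fin n) (Fin n) ℂ) (δ : Gam n) (Z' : Matrix (Fin n) (Fin n) ℂ)
    (l : Matrix (Fin m) (Fin n) ℤ) : ℂ :=
  (j γ Z).det ^ (-(k : ℤ)) *
    evalAt P ((4 * Real.pi * Complex.I : ℂ) • (ofReal S * ofInt l * (j δ Z')⁻¹.transpose)) *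
    Complex.exp (2 * Real.pi * Complex.I *
      (ofReal S * ofInt l * act δ Z' * (ofInt l).transpose).trace)

end

end SiegelJacobi

/-!
The theorem rests on a majorant of the Jacobi–Eisenstein series, on a harmonicity argument for each
of its terms, and on a reindexing of the cosets.

*Convergence.* Write `Im(γ⟨Z⟩) = ᵗG G`. Since `ᵗj Im(γ⟨Z⟩) conj(j) = Im Z` for `j = j(γ, Z)`, the
matrix `G j(γ, Z)` is bounded independently of `γ`, and so are `j⁻¹ C` and `j⁻¹` in the coordinates
given by `G` (`exists_frame_bounds`). Hence the term at `(γ, l)` is bounded, locally uniformly in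
`W`, by a constant times `|det j|^(-k) exp(-c ∑ Im(γ⟨Z⟩)[l_p])`, where the `l_p` are the rows of `l`
(`exists_norm_eisensteinTerm_le`). A sum of a function of `Im(γ⟨Z⟩)[u]` over `u ∈ ℤⁿ` can be
compared with a sum over `ℤ²ⁿ` by averaging over the translations in the Lagrangian directions of
`γ`; as `γ` is an automorphism of `ℤ²ⁿ`, this gives the bound `O(|det j(γ, Z)|)`, uniformly in `γ`
(`exists_tsum_inv_one_add_quad_pow_le`). So the sum over `l` is `O(|det j|^(m-k))`, and it remains to
show that `∑ |det j(γ, Z)|^(-s)` converges for `s > n + 1` (`tsum_inv_norm_det_j_pow_ne_top`). This is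
proved by induction on `n`. Up to `Γ_{n+1,0}`, an element of `Γ_{n+1}` comes from `Γ_n`, or it is the
product of an element whose lower left block has a single nonzero row `g p` with an element `t` of
`Γ_n` (`Covers.exists_decomposition`); in the second case `|det j|` is the product of
`|g t⟨Z⟩[p] + d|` and `|det j(t, Z')|`, where `Z'` is the lower right block of `Z`. The sum over `d`
is compared with an integral, the sums over `g` and over the first entry of `p` converge, and the sum
over the other entries of `p` is bounded by the uniform estimate above, at the cost of one power of
`|det j(t, Z')|`, which is why `s` drops by one together with the degree.

*Differentiation.* By Cauchy's estimate, normally convergent series of entire functions can be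
differentiated termwise (`MatNormallySummable.hasSum_diffOp`). Each term is `c exp(φ(W))` with a
quadratic polynomial `φ`. Conjugation by `exp φ` turns `P(∂)` into a polynomial differential operator,
and by Euler's identity and induction on the degree, the difference between
`(P(∂) exp φ)(0) / exp φ(0)` and `P(grad φ(0))` comes from `∑ h_ab ∂_a ∂_b P`, where `h` is the
Hessian of `φ` (`eval_zero_twist`). The Hessian of the exponent at `γ` is a combination, with
coefficients from `j⁻¹ C`, of the operators which annihilate a pluriharmonic `P`, so that only
`P(grad φ(0))` remains (`diffOp_eisensteinTerm`).

*Invariance.* For `δ = (A B; 0 D) ∈ Γ_{n,0}`, the weighted term at `(δ γ, l)` equals the term at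
`(γ, l A)`, because `k` is even and `S` is half-integral (`weightedTerm_mul_of_mem_Gam0`). Therefore
the sum over `l` depends only on the coset `Γ_{n,0} γ`, and right translation by an element of `Γ_n`
permutes the cosets.
-/

namespace SiegelJacobi

noncomputable section

open Matrix ComplexConjugate MeasureTheory
open scoped ENNReal

variable {m n : ℕ}

/-! ### The symplectic group and its action on the upper half plane -/

lemma fromBlocks_block_mem (γ : Gam n) :
    fromBlocks (blockA γ) (blockB γ) (blockC γ) (blockD γ) ∈ symplecticGroup (Fin n) ℂ := by
  have h := SymplecticGroup.map_mem γ.2 (Int.castRingHom ℂ)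
  rw [← fromBlocks_toBlocks γ.1, fromBlocks_map] at h
  exact h

lemma transpose_blockA_mul_blockC (γ : Gam n) :
    (blockA γ)ᵀ * blockC γ = (blockC γ)ᵀ * blockA γ :=
  (SymplecticGroup.fromBlocks_mem_iff.1 (fromBlocks_block_mem γ)).1

lemma transpose_blockB_mul_blockD (γ : Gam n) :
    (blockB γ)ᵀ * blockD γ = (blockD γ)ᵀ * blockB γ :=
  (SymplecticGroup.fromBlocks_mem_iff.1 (fromBlocks_block_mem γ)).2.1

lemma transpose_blockA_mul_blockD (γ : Gam n) :
    (blockA γ)ᵀ * blockD γ = 1 + (blockC γ)ᵀ * blockB γ :=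
  sub_eq_iff_eq_add.1 (SymplecticGroup.fromBlocks_mem_iff.1 (fromBlocks_block_mem γ)).2.2

lemma toBlocks_mul (M N : Matrix (Fin n ⊕ Fin n) (Fin n ⊕ Fin n) ℤ) :
    M * N = fromBlocks
      (M.toBlocks₁₁ * N.toBlocks₁₁ + M.toBlocks₁₂ * N.toBlocks₂₁)
      (M.toBlocks₁₁ * N.toBlocks₁₂ + M.toBlocks₁₂ * N.toBlocks₂₂)
      (M.toBlocks₂₁ * N.toBlocks₁₁ + M.toBlocks₂₂ * N.toBlocks₂₁)
      (M.toBlocks₂₁ * N.toBlocks₁₂ + M.toBlocks₂₂ * N.toBlocks₂₂) := by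
  rw [← fromBlocks_multiply, fromBlocks_toBlocks, fromBlocks_toBlocks]

lemma map_intCast_mul_add {a b c : ℕ} (M M' : Matrix (Fin a) (Fin b) ℤ)
    (N N' : Matrix (Fin b) (Fin c) ℤ) :
    (M * N + M' * N').map (Int.cast : ℤ → ℂ) =
      M.map (Int.cast : ℤ → ℂ) * N.map (Int.cast : ℤ → ℂ) +
        M'.map (Int.cast : ℤ → ℂ) * N'.map (Int.cast : ℤ → ℂ) := by
  ext i k
  simp [Matrix.mul_apply]

lemma blockA_mul (γ δ : Gam n) :
    blockA (γ * δ) = blockA γ * blockA δ + blockB γ * blockC δ := by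
  simp only [blockA, blockB, blockC, Submonoid.coe_mul, toBlocks_mul, toBlocks_fromBlocks₁₁,
    map_intCast_mul_add]

lemma blockB_mul (γ δ : Gam n) :
    blockB (γ * δ) = blockA γ * blockB δ + blockB γ * blockD δ := by
  simp only [blockA, blockB, blockD, Submonoid.coe_mul, toBlocks_mul, toBlocks_fromBlocks₁₂,
    map_intCast_mul_add]

lemma blockC_mul (γ δ : Gam n) :
    blockC (γ * δ) = blockC γ * blockA δ + blockD γ * blockC δ := by
  simp only [blockA, blockD, blockC, Submonoid.coe_mul, toBlocks_mul, toBlocks_fromBlocks₂₁,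
    map_intCast_mul_add]

lemma blockD_mul (γ δ : Gam n) :
    blockD (γ * δ) = blockC γ * blockB δ + blockD γ * blockD δ := by
  simp only [blockB, blockD, blockC, Submonoid.coe_mul, toBlocks_mul, toBlocks_fromBlocks₂₂,
    map_intCast_mul_add]

/-- The real matrix of entrywise imaginary parts. -/
abbrev imPart {a b : ℕ} (Z : Matrix (Fin a) (Fin b) ℂ) : Matrix (Fin a) (Fin b) ℝ :=
  Z.map Complex.im

/-- The real matrix of entrywise real parts. -/
abbrev rePart {a b : ℕ} (Z : Matrix (Fin a) (Fin b) ℂ) : Matrix (Fin a) (Fin b) ℝ :=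
  Z.map Complex.re

/-- The entrywise complex conjugate of a matrix. -/
abbrev conjM {a b : ℕ} (Z : Matrix (Fin a) (Fin b) ℂ) : Matrix (Fin a) (Fin b) ℂ :=
  Z.map (starRingEnd ℂ)

lemma conjM_mul {a b c : ℕ} (M : Matrix (Fin a) (Fin b) ℂ) (N : Matrix (Fin b) (Fin c) ℂ) :
    conjM (M * N) = conjM M * conjM N := Matrix.map_mul

lemma conjM_add {a b : ℕ} (M N : Matrix (Fin a) (Fin b) ℂ) :
    conjM (M + N) = conjM M + conjM N := by
  ext; simp

lemma conjM_intCast {a b : ℕ} (M : Matrix (Fin a) (Fin b) ℤ) :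
    conjM (M.map (Int.cast : ℤ → ℂ)) = M.map Int.cast := by
  ext; simp

lemma conjM_ofReal {a b : ℕ} (M : Matrix (Fin a) (Fin b) ℝ) : conjM (ofReal M) = ofReal M := by
  ext; simp [ofReal]

lemma sub_conjM {a b : ℕ} (Z : Matrix (Fin a) (Fin b) ℂ) :
    Z - conjM Z = (2 * Complex.I) • ofReal (imPart Z) := by
  ext i k
  apply Complex.ext <;> simp [ofReal]; ring

lemma ofReal_mul {a b c : ℕ} (M : Matrix (Fin a) (Fin b) ℝ) (N : Matrix (Fin b) (Fin c) ℝ) :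
    ofReal (M * N) = ofReal M * ofReal N := by
  ext i k
  simp [ofReal, Matrix.mul_apply]

/-- The numerator `A Z + B` of the action. -/
def num (γ : Gam n) (Z : Matrix (Fin n) (Fin n) ℂ) : Matrix (Fin n) (Fin n) ℂ :=
  blockA γ * Z + blockB γ

lemma num_mul (γ δ : Gam n) (Z : Matrix (Fin n) (Fin n) ℂ) :
    num (γ * δ) Z = blockA γ * num δ Z + blockB γ * j δ Z := by
  simp only [num, j, blockA_mul, blockB_mul, Matrix.add_mul, Matrix.mul_add, Matrix.mul_assoc]
  abel

lemma j_mul' (γ δ : Gam n) (Z : Matrix (Fin n) (Fin n) ℂ) :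
    j (γ * δ) Z = blockC γ * num δ Z + blockD γ * j δ Z := by
  simp only [num, j, blockC_mul, blockD_mul, Matrix.add_mul, Matrix.mul_add, Matrix.mul_assoc]
  abel

lemma transpose_num_mul_j (γ : Gam n) {Z : Matrix (Fin n) (Fin n) ℂ} (hZ : Z.IsSymm) :
    (num γ Z)ᵀ * j γ Z = (j γ Z)ᵀ * num γ Z := by
  have h1 := transpose_blockA_mul_blockC γ
  have h2 := transpose_blockB_mul_blockD γ
  have h3 := transpose_blockA_mul_blockD γ
  have h4 : (blockD γ)ᵀ * blockA γ = 1 + (blockB γ)ᵀ * blockC γ := by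
    simpa using congrArg transpose h3
  simp only [num, j, transpose_add, transpose_mul, hZ.eq, Matrix.add_mul, Matrix.mul_add]
  calc _ = Z * ((blockA γ)ᵀ * blockC γ) * Z + (blockB γ)ᵀ * blockC γ * Z
        + (Z * ((blockA γ)ᵀ * blockD γ) + (blockB γ)ᵀ * blockD γ) := by
          simp only [Matrix.mul_assoc]
    _ = Z * ((blockC γ)ᵀ * blockA γ) * Z + (blockD γ)ᵀ * blockA γ * Z
        + (Z * ((blockC γ)ᵀ * blockB γ) + (blockD γ)ᵀ * blockB γ) := by
          rw [h1, h2, h3, h4]; simp only [Matrix.mul_add, Matrix.add_mul, Matrix.mul_one,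
            Matrix.one_mul]; abel
    _ = _ := by simp only [Matrix.mul_assoc]

lemma transpose_num_mul_conj_j (γ : Gam n) {Z : Matrix (Fin n) (Fin n) ℂ} (hZ : Z.IsSymm) :
    (num γ Z)ᵀ * conjM (j γ Z) - (j γ Z)ᵀ * conjM (num γ Z) = Z - conjM Z := by
  have h1 := transpose_blockA_mul_blockC γ
  have h2 := transpose_blockB_mul_blockD γ
  have h3 := transpose_blockA_mul_blockD γ
  have h4 : (blockD γ)ᵀ * blockA γ = 1 + (blockB γ)ᵀ * blockC γ := by
    simpa using congrArg transpose h3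
  have cA : conjM (blockA γ) = blockA γ := conjM_intCast _
  have cB : conjM (blockB γ) = blockB γ := conjM_intCast _
  have cC : conjM (blockC γ) = blockC γ := conjM_intCast _
  have cD : conjM (blockD γ) = blockD γ := conjM_intCast _
  simp only [num, j, transpose_add, transpose_mul, hZ.eq, conjM_add, conjM_mul, cA, cB, cC, cD]
  set Y := conjM Z
  simp only [Matrix.add_mul, Matrix.mul_add]
  calc _ = Z * ((blockA γ)ᵀ * blockC γ) * Y + (blockB γ)ᵀ * blockC γ * Y
        + (Z * ((blockA γ)ᵀ * blockD γ) + (blockB γ)ᵀ * blockD γ) -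
        (Z * ((blockC γ)ᵀ * blockA γ) * Y + (blockD γ)ᵀ * blockA γ * Y
        + (Z * ((blockC γ)ᵀ * blockB γ) + (blockD γ)ᵀ * blockB γ)) := by
          simp only [Matrix.mul_assoc]
    _ = _ := by
          rw [h1, h2, h3, h4]; simp only [Matrix.mul_add, Matrix.add_mul, Matrix.mul_one,
            Matrix.one_mul]; abel

/-- A complex vector on which the real positive definite hermitian form vanishes is zero. -/
lemma eq_zero_of_dotProduct_ofReal_mulVec {Y : Matrix (Fin n) (Fin n) ℝ} (hY : Y.PosDef)
    {x : Fin n → ℂ} (hx : x ⬝ᵥ (ofReal Y *ᵥ (star x)) = 0) : x = 0 := by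
  have key : (x ⬝ᵥ (ofReal Y *ᵥ (star x))).re =
      (fun i => (x i).re) ⬝ᵥ (Y *ᵥ fun i => (x i).re) +
      (fun i => (x i).im) ⬝ᵥ (Y *ᵥ fun i => (x i).im) := by
    simp only [dotProduct, mulVec, ofReal, map_apply, Complex.re_sum, Finset.mul_sum,
      ← Finset.sum_add_distrib]
    refine Finset.sum_congr rfl fun i _ => Finset.sum_congr rfl fun k _ => ?_
    simp
  rw [hx] at key
  have h1 : 0 ≤ (fun i => (x i).re) ⬝ᵥ (Y *ᵥ fun i => (x i).re) := by
    simpa using hY.posSemidef.dotProduct_mulVec_nonneg (fun i => (x i).re)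
  have h2 : 0 ≤ (fun i => (x i).im) ⬝ᵥ (Y *ᵥ fun i => (x i).im) := by
    simpa using hY.posSemidef.dotProduct_mulVec_nonneg (fun i => (x i).im)
  have pos : ∀ y : Fin n → ℝ, y ⬝ᵥ (Y *ᵥ y) = 0 → y = 0 := by
    intro y hy
    by_contra h
    have := hY.dotProduct_mulVec_pos h
    simp only [star_trivial] at this
    linarith
  simp only [Complex.zero_re] at key
  have e1 := pos _ (by linarith : (fun i => (x i).re) ⬝ᵥ (Y *ᵥ fun i => (x i).re) = 0)
  have e2 := pos _ (by linarith : (fun i => (x i).im) ⬝ᵥ (Y *ᵥ fun i => (x i).im) = 0)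
  funext i
  exact Complex.ext (congrFun e1 i) (congrFun e2 i)

/-- `C Z + D` is invertible on the upper half plane. -/
lemma isUnit_det_j (γ : Gam n) {Z : Matrix (Fin n) (Fin n) ℂ} (hZ : Z ∈ upperHalf n) :
    IsUnit (j γ Z).det := by
  rw [isUnit_iff_ne_zero]
  intro h0
  obtain ⟨x, hx0, hx⟩ := Matrix.exists_mulVec_eq_zero_iff.2 h0
  apply hx0
  apply eq_zero_of_dotProduct_ofReal_mulVec hZ.2
  have h := transpose_num_mul_conj_j γ hZ.1
  rw [sub_conjM] at h
  have hc : conjM (j γ Z) *ᵥ (star x) = 0 := by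
    have := congrArg star hx
    funext i
    have := congrFun this i
    simpa [mulVec, dotProduct, mul_comm] using this
  have h' := congrArg (fun M => x ⬝ᵥ (M *ᵥ star x)) h
  simp only [Matrix.sub_mulVec, ← Matrix.mulVec_mulVec, hc, Matrix.mulVec_zero, zero_sub,
    dotProduct_neg, Matrix.smul_mulVec, dotProduct_smul] at h'
  rw [Matrix.dotProduct_mulVec, Matrix.vecMul_transpose, hx, zero_dotProduct, neg_zero] at h'
  have h2 : (2 * Complex.I : ℂ) ≠ 0 := by simp
  exact (smul_eq_zero.1 h'.symm).resolve_left h2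

lemma det_j_ne_zero (γ : Gam n) {Z : Matrix (Fin n) (Fin n) ℂ} (hZ : Z ∈ upperHalf n) :
    (j γ Z).det ≠ 0 := (isUnit_det_j γ hZ).ne_zero

lemma act_mul_j (γ : Gam n) {Z : Matrix (Fin n) (Fin n) ℂ} (hZ : Z ∈ upperHalf n) :
    act γ Z * j γ Z = num γ Z := by
  rw [act, Matrix.mul_assoc, Matrix.nonsing_inv_mul _ (isUnit_det_j γ hZ), Matrix.mul_one, num]

lemma mul_right_cancel_det {M N q : Matrix (Fin n) (Fin n) ℂ} (hq : IsUnit q.det)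
    (h : M * q = N * q) : M = N := by
  have := congrArg (· * q⁻¹) h
  simpa [Matrix.mul_assoc, Matrix.mul_nonsing_inv _ hq] using this

lemma mul_left_cancel_det {M N q : Matrix (Fin n) (Fin n) ℂ} (hq : IsUnit q.det)
    (h : q * M = q * N) : M = N := by
  have := congrArg (q⁻¹ * ·) h
  simpa [← Matrix.mul_assoc, Matrix.nonsing_inv_mul _ hq] using this

lemma isSymm_act (γ : Gam n) {Z : Matrix (Fin n) (Fin n) ℂ} (hZ : Z ∈ upperHalf n) :
    (act γ Z).IsSymm := by
  have hq := isUnit_det_j γ hZ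
  have hqT : IsUnit (j γ Z)ᵀ.det := by rwa [det_transpose]
  apply mul_right_cancel_det hq
  apply mul_left_cancel_det hqT
  rw [act_mul_j γ hZ, ← transpose_num_mul_j γ hZ.1, ← Matrix.mul_assoc, ← transpose_mul,
    act_mul_j γ hZ]

/-- The transformation law of the imaginary part: `ᵗj(γ,Z) Im(γ⟨Z⟩) conj(j(γ,Z)) = Im Z`. -/
lemma transpose_j_mul_im_act (γ : Gam n) {Z : Matrix (Fin n) (Fin n) ℂ} (hZ : Z ∈ upperHalf n) :
    (j γ Z)ᵀ * ofReal (imPart (act γ Z)) * conjM (j γ Z) = ofReal (imPart Z) := by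
  have h := transpose_num_mul_conj_j γ hZ.1
  rw [← act_mul_j γ hZ, transpose_mul, (isSymm_act γ hZ).eq, conjM_mul, ← Matrix.mul_assoc,
    ← Matrix.sub_mul, ← Matrix.mul_sub, sub_conjM, sub_conjM, Matrix.mul_smul, Matrix.smul_mul] at h
  have h2 : (2 * Complex.I : ℂ) ≠ 0 := by simp
  exact smul_right_injective _ h2 h

lemma isHermitian_im_act (γ : Gam n) {Z : Matrix (Fin n) (Fin n) ℂ} (hZ : Z ∈ upperHalf n) :
    (imPart (act γ Z)).IsHermitian := by
  have h := congrArg imPart (isSymm_act γ hZ).eq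
  rw [Matrix.IsHermitian, conjTranspose_eq_transpose_of_trivial, ← transpose_map]
  exact h

lemma act_mem (γ : Gam n) {Z : Matrix (Fin n) (Fin n) ℂ} (hZ : Z ∈ upperHalf n) :
    act γ Z ∈ upperHalf n := by
  refine ⟨isSymm_act γ hZ, ?_⟩
  have hq := isUnit_det_j γ hZ
  refine Matrix.PosDef.of_dotProduct_mulVec_pos (isHermitian_im_act γ hZ) fun x hx => ?_
  -- substitute `x = conj(q) * conj(y)`, which is possible over `ℂ`
  have hqc : IsUnit (conjM (j γ Z)).det := by
    have : (conjM (j γ Z)).det = starRingEnd ℂ (j γ Z).det := ((starRingEnd ℂ).map_det _).symm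
    rw [this]
    exact hq.map _
  set y : Fin n → ℂ := (conjM (j γ Z))⁻¹ *ᵥ (fun i => (x i : ℂ)) with hy
  have hxy : conjM (j γ Z) *ᵥ y = fun i => (x i : ℂ) := by
    rw [hy, Matrix.mulVec_mulVec, Matrix.mul_nonsing_inv _ hqc, Matrix.one_mulVec]
  have hxy' : (j γ Z) *ᵥ (star y) = fun i => (x i : ℂ) := by
    have := congrArg star hxy
    funext i
    have := congrFun this i
    simpa [mulVec, dotProduct, mul_comm] using this
  have h := congrArg (fun M => (star y) ⬝ᵥ (M *ᵥ y)) (transpose_j_mul_im_act γ hZ)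
  simp only [← Matrix.mulVec_mulVec, hxy] at h
  rw [Matrix.dotProduct_mulVec, Matrix.vecMul_transpose, hxy'] at h
  have e : (fun i => (x i : ℂ)) ⬝ᵥ ofReal (imPart (act γ Z)) *ᵥ (fun i => (x i : ℂ)) =
      ((x ⬝ᵥ imPart (act γ Z) *ᵥ x : ℝ) : ℂ) := by
    simp [dotProduct, mulVec, ofReal]
  rw [e] at h
  have hs0 : 0 ≤ x ⬝ᵥ imPart (act γ Z) *ᵥ x := by
    have key : (star y ⬝ᵥ (ofReal (imPart Z) *ᵥ y)).re =
        (fun i => (y i).re) ⬝ᵥ (imPart Z *ᵥ fun i => (y i).re) +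
        (fun i => (y i).im) ⬝ᵥ (imPart Z *ᵥ fun i => (y i).im) := by
      simp only [dotProduct, mulVec, ofReal, map_apply, Complex.re_sum, Finset.mul_sum,
        ← Finset.sum_add_distrib]
      refine Finset.sum_congr rfl fun i _ => Finset.sum_congr rfl fun k _ => ?_
      simp
    rw [← h, Complex.ofReal_re] at key
    rw [key]
    have h1 := hZ.2.posSemidef.dotProduct_mulVec_nonneg (fun i => (y i).re)
    have h2 := hZ.2.posSemidef.dotProduct_mulVec_nonneg (fun i => (y i).im)
    simp only [star_trivial] at h1 h2
    exact add_nonneg h1 h2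
  simp only [star_trivial]
  refine lt_of_le_of_ne hs0 fun h0 => hx ?_
  rw [← h0] at h
  have hy0 : star y = 0 := by
    apply eq_zero_of_dotProduct_ofReal_mulVec hZ.2
    rw [star_star]
    simpa using h.symm
  rw [hy0, Matrix.mulVec_zero] at hxy'
  funext i
  have := congrFun hxy' i
  simpa using this.symm

lemma j_mul (γ δ : Gam n) {Z : Matrix (Fin n) (Fin n) ℂ} (hZ : Z ∈ upperHalf n) :
    j (γ * δ) Z = j γ (act δ Z) * j δ Z := by
  rw [j_mul', j.eq_1 γ, Matrix.add_mul, Matrix.mul_assoc, act_mul_j δ hZ]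

lemma act_mul (γ δ : Gam n) {Z : Matrix (Fin n) (Fin n) ℂ} (hZ : Z ∈ upperHalf n) :
    act (γ * δ) Z = act γ (act δ Z) := by
  apply mul_right_cancel_det (isUnit_det_j (γ * δ) hZ)
  rw [act_mul_j _ hZ, j_mul γ δ hZ, ← Matrix.mul_assoc, act_mul_j γ (act_mem δ hZ), num_mul,
    num.eq_1 γ (act δ Z), Matrix.add_mul, Matrix.mul_assoc, act_mul_j δ hZ]

lemma det_im_act (γ : Gam n) {Z : Matrix (Fin n) (Fin n) ℂ} (hZ : Z ∈ upperHalf n) :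
    ‖(j γ Z).det‖ ^ 2 * (imPart (act γ Z)).det = (imPart Z).det := by
  have h := congrArg det (transpose_j_mul_im_act γ hZ)
  have e : ∀ M : Matrix (Fin n) (Fin n) ℝ, (ofReal M).det = ((M.det : ℝ) : ℂ) :=
    fun M => (Complex.ofRealHom.map_det M).symm
  have e2 : (conjM (j γ Z)).det = starRingEnd ℂ (j γ Z).det := ((starRingEnd ℂ).map_det _).symm
  rw [det_mul, det_mul, det_transpose, e, e, e2] at h
  have h3 : ((‖(j γ Z).det‖ ^ 2 * (imPart (act γ Z)).det : ℝ) : ℂ) = ((imPart Z).det : ℂ) := by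
    rw [← h]
    push_cast
    rw [← Complex.mul_conj']
    ring
  exact_mod_cast h3

/-! ### Integral row reduction -/

/-- Every integral row vector is carried by a unimodular matrix to a multiple of the first basis
vector. -/
lemma exists_unimodular_vecMul_eq_single {N : ℕ} (x : Fin (N + 1) → ℤ) :
    ∃ U V : Matrix (Fin (N + 1)) (Fin (N + 1)) ℤ, U * V = 1 ∧
      ∃ g : ℤ, x ᵥ* U = Pi.single 0 g := by
  classical
  -- a vector of minimal `ℓ¹`-norm in the orbit has at most one nonzero entry
  let S : Set ℕ := {s | ∃ U : (Matrix (Fin (N + 1)) (Fin (N + 1)) ℤ)ˣ,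
    s = ∑ i, ((x ᵥ* U.1) i).natAbs}
  have hS : S.Nonempty := ⟨_, 1, rfl⟩
  obtain ⟨U, hU⟩ := Nat.sInf_mem hS
  set y := x ᵥ* U.1 with hy
  have hmin : ∀ U' : (Matrix (Fin (N + 1)) (Fin (N + 1)) ℤ)ˣ,
      ∑ i, (y i).natAbs ≤ ∑ i, ((y ᵥ* U'.1) i).natAbs := by
    intro U'
    rw [← hU]
    exact Nat.sInf_le ⟨U * U', by rw [hy, Matrix.vecMul_vecMul]; rfl⟩
  have htv : ∀ i k : Fin (N + 1), i ≠ k → ∀ c : ℤ,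
      ∃ U' : (Matrix (Fin (N + 1)) (Fin (N + 1)) ℤ)ˣ, ∀ z : Fin (N + 1) → ℤ,
        z ᵥ* U'.1 = z + Pi.single i (c * z k) := by
    intro i k hik c
    refine ⟨⟨transvection k i c, transvection k i (-c), ?_, ?_⟩, ?_⟩
    · rw [transvection_mul_transvection_same _ _ (Ne.symm hik), add_neg_cancel, transvection_zero]
    · rw [transvection_mul_transvection_same _ _ (Ne.symm hik), neg_add_cancel, transvection_zero]
    · intro z
      funext l
      simp only [transvection, Matrix.vecMul_add, Matrix.vecMul_one, Pi.add_apply]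
      congr 1
      by_cases h : l = i
      · subst h; simp [vecMul, dotProduct, Matrix.single_apply, mul_comm]
      · simp [vecMul, dotProduct, h, Ne.symm h]
  -- otherwise a division step makes the larger of two nonzero entries smaller
  have hle : ∀ i k : Fin (N + 1), i ≠ k → y k ≠ 0 → ¬ (y k).natAbs ≤ (y i).natAbs := by
    intro i k hik hk hle
    obtain ⟨c, hc⟩ : ∃ c : ℤ, (y i + c * y k).natAbs < (y i).natAbs := by
      by_cases h : 0 ≤ y i * y k
      · refine ⟨-1, ?_⟩
        rcases le_total 0 (y i) with h1 | h1 <;> rcases le_total 0 (y k) with h2 | h2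
        · omega
        · have : y i = 0 ∨ y k = 0 := mul_eq_zero.1 (le_antisymm (mul_nonpos_of_nonneg_of_nonpos h1 h2) h)
          omega
        · have : y i = 0 ∨ y k = 0 := mul_eq_zero.1 (le_antisymm (mul_nonpos_of_nonpos_of_nonneg h1 h2) h)
          omega
        · omega
      · refine ⟨1, ?_⟩
        rcases le_total 0 (y i) with h1 | h1 <;> rcases le_total 0 (y k) with h2 | h2
        · exact absurd (mul_nonneg h1 h2) h
        · omega
        · omega
        · exact absurd (mul_nonneg_of_nonpos_of_nonpos h1 h2) h
    obtain ⟨U', hU'⟩ := htv i k hik c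
    have := hmin U'
    refine absurd this (not_le.2 ?_)
    apply Finset.sum_lt_sum
    · intro l _
      rw [hU']
      by_cases h : l = i
      · subst h; simpa using hc.le
      · simp [h]
    · exact ⟨i, Finset.mem_univ _, by rw [hU']; simpa using hc⟩
  have hone : ∀ i k : Fin (N + 1), i ≠ k → y i = 0 ∨ y k = 0 := by
    intro i k hik
    by_contra! h
    rcases le_total (y k).natAbs (y i).natAbs with h' | h'
    · exact hle i k hik h.2 h'
    · exact hle k i hik.symm h.1 h'
  -- the nonzero entry is moved to the first place by two transvections
  have hfin : ∃ W : (Matrix (Fin (N + 1)) (Fin (N + 1)) ℤ)ˣ, ∃ g, y ᵥ* W.1 = Pi.single 0 g := by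
    by_cases hex : ∃ i, i ≠ 0 ∧ y i ≠ 0
    · obtain ⟨i, hi, hyi⟩ := hex
      have hy1 : y = Pi.single i (y i) := by
        funext l
        by_cases h : l = i
        · subst h; simp
        · simpa [h] using (hone l i h).resolve_right hyi
      obtain ⟨W₁, hW₁⟩ := htv 0 i hi.symm 1
      obtain ⟨W₂, hW₂⟩ := htv i 0 hi (-1)
      refine ⟨W₁ * W₂, y i, ?_⟩
      rw [Units.val_mul, ← Matrix.vecMul_vecMul, hW₂, hW₁]
      have h0 : y 0 = 0 := (hone 0 i hi.symm).resolve_right hyi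
      funext l
      by_cases h : l = i
      · subst h; simp [hi, h0]
      · by_cases h' : l = 0
        · subst h'; simp [h, h0]
        · have : y l = 0 := (hone l i h).resolve_right hyi
          simp [h, h', this]
    · push Not at hex
      refine ⟨1, y 0, ?_⟩
      funext l
      by_cases h : l = 0
      · subst h; simp
      · simp [h, hex l h]
  obtain ⟨W, g, hg⟩ := hfin
  refine ⟨(U * W).1, (U * W)⁻¹.1, Units.mul_inv _, g, ?_⟩
  rw [Units.val_mul, ← Matrix.vecMul_vecMul, ← hy, hg]

/-! ### Elements of the symplectic group -/

/-- The element `diag(U, ᵗV)` of `Γ_n` attached to a unimodular matrix `U` with inverse `V`. -/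
def levi (U V : Matrix (Fin n) (Fin n) ℤ) (h : U * V = 1) : Gam n :=
  ⟨fromBlocks U 0 0 Vᵀ, SymplecticGroup.fromBlocks_mem_iff.2
    ⟨by simp, by simp, by
      rw [← transpose_mul, mul_eq_one_comm.1 h]; simp⟩⟩

lemma levi_mem_Gam0 (U V : Matrix (Fin n) (Fin n) ℤ) (h : U * V = 1) : levi U V h ∈ Gam0 n :=
  toBlocks_fromBlocks₂₁ _ _ _ _

lemma coe_inv_eq_fromBlocks (γ : Gam n) :
    (γ⁻¹).1 = fromBlocks γ.1.toBlocks₂₂ᵀ (-γ.1.toBlocks₁₂ᵀ) (-γ.1.toBlocks₂₁ᵀ) γ.1.toBlocks₁₁ᵀ := by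
  rw [SymplecticGroup.coe_inv]
  conv_lhs => rw [← fromBlocks_toBlocks γ.1]
  rw [Matrix.J, Matrix.fromBlocks_transpose, Matrix.fromBlocks_neg, Matrix.fromBlocks_multiply,
      Matrix.fromBlocks_multiply]
  simp

/-- The lower left block of `γ δ⁻¹` is the symplectic pairing of the lower rows of `γ` and `δ`. -/
lemma toBlocks₂₁_mul_inv (γ δ : Gam n) : (γ * δ⁻¹).1.toBlocks₂₁ =
    γ.1.toBlocks₂₁ * δ.1.toBlocks₂₂ᵀ - γ.1.toBlocks₂₂ * δ.1.toBlocks₂₁ᵀ := by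
  rw [Submonoid.coe_mul, toBlocks_mul, coe_inv_eq_fromBlocks]
  simp [sub_eq_add_neg]

lemma mul_inv_mem_Gam0_iff (γ δ : Gam n) : γ * δ⁻¹ ∈ Gam0 n ↔
    γ.1.toBlocks₂₁ * δ.1.toBlocks₂₂ᵀ = γ.1.toBlocks₂₂ * δ.1.toBlocks₂₁ᵀ := by
  rw [← sub_eq_zero, ← toBlocks₂₁_mul_inv]
  rfl

/-- The block diagonal matrix `diag(a, M)`. -/
def emb {R : Type*} [Zero R] {a b : ℕ} (x : R) (M : Matrix (Fin a) (Fin b) R) :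
    Matrix (Fin (a + 1)) (Fin (b + 1)) R :=
  Matrix.of (Fin.cons (Fin.cons x 0) fun i => Fin.cons 0 (M i))

section emb
variable {R : Type*} [CommRing R] {a b c : ℕ}

@[simp] lemma emb_zero_zero (x : R) (M : Matrix (Fin a) (Fin b) R) : emb x M 0 0 = x := rfl
@[simp] lemma emb_zero_succ (x : R) (M : Matrix (Fin a) (Fin b) R) (k : Fin b) :
    emb x M 0 k.succ = 0 := rfl
@[simp] lemma emb_succ_zero (x : R) (M : Matrix (Fin a) (Fin b) R) (i : Fin a) :
    emb x M i.succ 0 = 0 := rfl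
@[simp] lemma emb_succ_succ (x : R) (M : Matrix (Fin a) (Fin b) R) (i : Fin a) (k : Fin b) :
    emb x M i.succ k.succ = M i k := rfl

lemma emb_mul (x y : R) (M : Matrix (Fin a) (Fin b) R) (N : Matrix (Fin b) (Fin c) R) :
    emb x M * emb y N = emb (x * y) (M * N) := by
  ext i k
  refine Fin.cases ?_ (fun i => ?_) i <;> refine Fin.cases ?_ (fun k => ?_) k <;>
    simp [Matrix.mul_apply, Fin.sum_univ_succ]

lemma emb_transpose (x : R) (M : Matrix (Fin a) (Fin b) R) : (emb x M)ᵀ = emb x Mᵀ := by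
  ext i k
  refine Fin.cases ?_ (fun i => ?_) i <;> refine Fin.cases ?_ (fun k => ?_) k <;> simp

lemma emb_sub (x y : R) (M N : Matrix (Fin a) (Fin b) R) :
    emb x M - emb y N = emb (x - y) (M - N) := by
  ext i k
  refine Fin.cases ?_ (fun i => ?_) i <;> refine Fin.cases ?_ (fun k => ?_) k <;> simp

lemma emb_one : emb (1 : R) (1 : Matrix (Fin a) (Fin a) R) = 1 := by
  ext i k
  refine Fin.cases ?_ (fun i => ?_) i <;> refine Fin.cases ?_ (fun k => ?_) k <;>
    simp [Matrix.one_apply, Fin.succ_ne_zero, eq_comm]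

end emb

/-- The embedding `Γ_n → Γ_{n+1}` which fixes the first hyperbolic plane. -/
def incl (γ : Gam n) : Gam (n + 1) :=
  ⟨fromBlocks (emb 1 γ.1.toBlocks₁₁) (emb 0 γ.1.toBlocks₁₂) (emb 0 γ.1.toBlocks₂₁)
    (emb 1 γ.1.toBlocks₂₂), by
    have h := γ.2
    rw [← fromBlocks_toBlocks γ.1, SymplecticGroup.fromBlocks_mem_iff] at h
    rw [SymplecticGroup.fromBlocks_mem_iff]
    simp only [emb_transpose, emb_mul, emb_sub, h.1, h.2.1, h.2.2]
    simp [emb_one]⟩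

/-- The element of `Γ_n` that acts by an element of `SL₂(ℤ)` on each hyperbolic plane. -/
def diagSL (a b c d : Fin n → ℤ) (h : ∀ i, a i * d i - b i * c i = 1) : Gam n :=
  ⟨fromBlocks (diagonal a) (diagonal b) (diagonal c) (diagonal d),
    SymplecticGroup.fromBlocks_mem_iff.2 (by
      simp only [diagonal_transpose, diagonal_mul_diagonal, diagonal_sub]
      refine ⟨by simp [mul_comm], by simp [mul_comm], ?_⟩
      rw [← diagonal_one]
      congr 1
      funext i
      rw [← h i]; ring)⟩

lemma exists_SL_vecMul (x y : ℤ) : ∃ a b c d : ℤ, a * d - b * c = 1 ∧ x * a + y * c = 0 := by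
  by_cases hg : x = 0 ∧ y = 0
  · exact ⟨1, 0, 0, 1, by simp, by simp [hg]⟩
  · have h0 : 0 < Int.gcd x y := Nat.pos_of_ne_zero (by rwa [Ne, Int.gcd_eq_zero_iff])
    obtain ⟨g, x', y', -, hco, hx, hy⟩ := Int.exists_gcd_one' h0
    obtain ⟨u, v, huv⟩ := Int.isCoprime_iff_gcd_eq_one.2 hco
    exact ⟨y', u, -x', v, by linarith, by rw [hx, hy]; ring⟩

/-- `Γ_n` acts transitively on the integral row vectors of given content. -/
lemma exists_vecMul_eq_single (v : Fin (n + 1) ⊕ Fin (n + 1) → ℤ) :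
    ∃ (σ : Gam (n + 1)) (g : ℤ), v ᵥ* σ.1 = Sum.elim (0 : Fin (n + 1) → ℤ) (Pi.single 0 g) := by
  choose a b c d h1 h2 using fun i => exists_SL_vecMul (v (Sum.inl i)) (v (Sum.inr i))
  set w : Fin (n + 1) → ℤ := fun i => v (Sum.inl i) * b i + v (Sum.inr i) * d i with hw
  have e1 : v ᵥ* (diagSL a b c d h1).1 = Sum.elim (0 : Fin (n + 1) → ℤ) w := by
    rw [← Sum.elim_comp_inl_inr v, diagSL, Matrix.vecMul_fromBlocks]
    congr 1
    · funext i
      simp only [Pi.add_apply, Matrix.vecMul_diagonal]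
      exact h2 i
    · funext i
      simp only [Pi.add_apply, Matrix.vecMul_diagonal]
      rfl
  obtain ⟨U, V, hUV, g, hg⟩ := exists_unimodular_vecMul_eq_single w
  refine ⟨diagSL a b c d h1 * levi Vᵀ Uᵀ (by rw [← transpose_mul, hUV, transpose_one]), g, ?_⟩
  rw [Submonoid.coe_mul, ← Matrix.vecMul_vecMul, e1, levi, Matrix.vecMul_fromBlocks]
  simp [hg]

/-! ### Isotropic families of integral vectors -/

lemma mul_J_mul_transpose_apply {K : Type*} [Fintype K] (X : Matrix K (Fin n ⊕ Fin n) ℤ) (k l : K) :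
    (X * Matrix.J (Fin n) ℤ * Xᵀ) k l =
      ∑ c, X k (Sum.inr c) * X l (Sum.inl c) - ∑ c, X k (Sum.inl c) * X l (Sum.inr c) := by
  rw [Matrix.mul_apply, Fintype.sum_sum_type]
  simp [Matrix.mul_apply, Fintype.sum_sum_type, Matrix.J, Matrix.one_apply, sub_eq_add_neg]

lemma toBlocks_mul_inv_apply {K : Type*} [Fintype K] (X : Matrix K (Fin n ⊕ Fin n) ℤ) (γ : Gam n)
    (k : K) (c : Fin n) : (X * (γ⁻¹).1) k (Sum.inl c) =
      ∑ l, X k (Sum.inl l) * γ.1.toBlocks₂₂ c l - ∑ l, X k (Sum.inr l) * γ.1.toBlocks₂₁ c l := by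
  rw [coe_inv_eq_fromBlocks, Matrix.mul_apply, Fintype.sum_sum_type]
  simp [sub_eq_add_neg]

/-- Every isotropic family of integral row vectors is carried by an element of `Γ_n` into the
standard Lagrangian subspace. -/
theorem exists_isotropic_mul_inv_eq_zero {K : Type*} [Fintype K] :
    ∀ {n : ℕ} (X : Matrix K (Fin n ⊕ Fin n) ℤ), X * Matrix.J (Fin n) ℤ * Xᵀ = 0 →
      ∃ γ : Gam n, ∀ k c, (X * (γ⁻¹).1) k (Sum.inl c) = 0
  | 0, X, _ => ⟨1, fun k c => c.elim0⟩
  | n + 1, X, hX => by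
    by_cases h0 : ∀ k, X k = 0
    · refine ⟨1, fun k c => ?_⟩
      have : X = 0 := funext h0
      simp [this]
    push Not at h0
    obtain ⟨i, hi⟩ := h0
    obtain ⟨σ, g, hσ⟩ := exists_vecMul_eq_single (X i)
    set X₁ := X * σ.1 with hX₁
    have hiso : X₁ * Matrix.J (Fin (n + 1)) ℤ * X₁ᵀ = 0 := by
      have := SymplecticGroup.mem_iff.1 σ.2
      calc _ = X * (σ.1 * Matrix.J (Fin (n + 1)) ℤ * σ.1ᵀ) * Xᵀ := by
            rw [hX₁, transpose_mul]; simp only [Matrix.mul_assoc]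
        _ = 0 := by rw [this, hX]
    have hrow : X₁ i = Sum.elim (0 : Fin (n + 1) → ℤ) (Pi.single 0 g) := by
      rw [← hσ]; rfl
    have hg : g ≠ 0 := by
      rintro rfl
      apply hi
      have : X i ᵥ* σ.1 ᵥ* (σ⁻¹).1 = 0 := by
        rw [hσ]
        have : (Sum.elim (0 : Fin (n + 1) → ℤ) (Pi.single 0 0) : Fin (n + 1) ⊕ Fin (n + 1) → ℤ) = 0 := by
          funext s; cases s <;> simp
        rw [this, Matrix.zero_vecMul]
      rwa [Matrix.vecMul_vecMul, ← Submonoid.coe_mul, mul_inv_cancel, Submonoid.coe_one,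
        Matrix.vecMul_one] at this
    -- the row `i` is now a multiple of a basis vector, and all rows are orthogonal to it
    have hcol : ∀ k, X₁ k (Sum.inl 0) = 0 := by
      intro k
      have := congrFun (congrFun hiso k) i
      rw [mul_J_mul_transpose_apply, hrow] at this
      simpa [Pi.single_apply, hg] using this
    let X₂ : Matrix K (Fin n ⊕ Fin n) ℤ := Matrix.of fun k =>
      Sum.elim (fun c => X₁ k (Sum.inl c.succ)) (fun c => X₁ k (Sum.inr c.succ))
    have hX₂ : X₂ * Matrix.J (Fin n) ℤ * X₂ᵀ = 0 := by
      ext k l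
      have := congrFun (congrFun hiso k) l
      rw [mul_J_mul_transpose_apply, Fin.sum_univ_succ, Fin.sum_univ_succ, hcol, hcol] at this
      rw [mul_J_mul_transpose_apply]
      simpa [X₂] using this
    obtain ⟨γ, hγ⟩ := exists_isotropic_mul_inv_eq_zero X₂ hX₂
    refine ⟨incl γ * σ⁻¹, fun k c => ?_⟩
    have e : X * ((incl γ * σ⁻¹)⁻¹).1 = X₁ * ((incl γ)⁻¹).1 := by
      rw [_root_.mul_inv_rev, inv_inv, Submonoid.coe_mul, ← Matrix.mul_assoc]
    rw [e, toBlocks_mul_inv_apply]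
    refine Fin.cases ?_ (fun c => ?_) c
    · simp [Fin.sum_univ_succ, incl, hcol]
    · have := hγ k c
      rw [toBlocks_mul_inv_apply] at this
      simpa [Fin.sum_univ_succ, incl, X₂] using this

/-- A set of elements of `Γ_n` which meets every coset of `Γ_{n,0} \ Γ_n`. -/
def Covers (T : Set (Gam n)) : Prop := ∀ γ : Gam n, ∃ t ∈ T, γ * t⁻¹ ∈ Gam0 n

lemma Covers.exists_isotropic {T : Set (Gam n)} (hT : Covers T) {K : Type*} [Fintype K]
    (X : Matrix K (Fin n ⊕ Fin n) ℤ) (hX : X * Matrix.J (Fin n) ℤ * Xᵀ = 0) :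
    ∃ t ∈ T, ∀ k c, (X * (t⁻¹).1) k (Sum.inl c) = 0 := by
  obtain ⟨γ, hγ⟩ := exists_isotropic_mul_inv_eq_zero X hX
  obtain ⟨t, ht, h⟩ := hT γ
  refine ⟨t, ht, fun k c => ?_⟩
  have e : X * (t⁻¹).1 = X * (γ⁻¹).1 * (γ * t⁻¹).1 := by
    rw [Matrix.mul_assoc, ← Submonoid.coe_mul, inv_mul_cancel_left]
  have h' : ∀ a, (γ * t⁻¹).1 (Sum.inr a) (Sum.inl c) = 0 := fun a =>
    congrFun (congrFun (show (γ * t⁻¹).1.toBlocks₂₁ = 0 from h) a) c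
  rw [e, Matrix.mul_apply, Fintype.sum_sum_type]
  simp [hγ, h']

/-! ### Decomposition of the cosets of the parabolic subgroup -/

lemma det_blockD_eq_intCast (δ : Gam n) : (blockD δ).det = ((δ.1.toBlocks₂₂.det : ℤ) : ℂ) :=
  ((Int.castRingHom ℂ).map_det δ.1.toBlocks₂₂).symm

lemma transpose_toBlocks₁₁_mul_toBlocks₂₂ {δ : Gam n} (hδ : δ ∈ Gam0 n) :
    δ.1.toBlocks₁₁ᵀ * δ.1.toBlocks₂₂ = 1 := by
  have h := δ.2
  rw [← fromBlocks_toBlocks δ.1, SymplecticGroup.fromBlocks_mem_iff] at h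
  have h3 := h.2.2
  rw [show δ.1.toBlocks₂₁ = 0 from hδ] at h3
  simpa using h3

lemma isUnit_det_of_mem_Gam0 {δ : Gam n} (hδ : δ ∈ Gam0 n) : IsUnit δ.1.toBlocks₂₂.det := by
  have := congrArg det (transpose_toBlocks₁₁_mul_toBlocks₂₂ hδ)
  rw [det_mul, det_one] at this
  exact IsUnit.of_mul_eq_one_right _ this

lemma j_of_mem_Gam0 {δ : Gam n} (hδ : δ ∈ Gam0 n) (Z : Matrix (Fin n) (Fin n) ℂ) :
    j δ Z = blockD δ := by
  have : blockC δ = 0 := by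
    rw [blockC, show δ.1.toBlocks₂₁ = 0 from hδ]
    ext; simp
  rw [j, this, Matrix.zero_mul, zero_add]

lemma det_j_eq_one_or_of_mem_Gam0 {δ : Gam n} (hδ : δ ∈ Gam0 n) (Z : Matrix (Fin n) (Fin n) ℂ) :
    (j δ Z).det = 1 ∨ (j δ Z).det = -1 := by
  rw [j_of_mem_Gam0 hδ, det_blockD_eq_intCast]
  rcases Int.isUnit_iff.1 (isUnit_det_of_mem_Gam0 hδ) with h | h <;> simp [h]

lemma norm_det_j_of_mem_Gam0 {δ : Gam n} (hδ : δ ∈ Gam0 n) (Z : Matrix (Fin n) (Fin n) ℂ) :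
    ‖(j δ Z).det‖ = 1 := by
  rcases det_j_eq_one_or_of_mem_Gam0 hδ Z with h | h <;> simp [h]

/-- The lower right block of a matrix of size `n + 1`. -/
abbrev lower {R : Type*} (Z : Matrix (Fin (n + 1)) (Fin (n + 1)) R) : Matrix (Fin n) (Fin n) R :=
  Z.submatrix Fin.succ Fin.succ

lemma lower_mem {Z : Matrix (Fin (n + 1)) (Fin (n + 1)) ℂ} (hZ : Z ∈ upperHalf (n + 1)) :
    lower Z ∈ upperHalf n :=
  ⟨hZ.1.submatrix _, hZ.2.submatrix (Fin.succ_injective _)⟩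

@[simp] lemma j_incl_zero_zero (γ : Gam n) (Z : Matrix (Fin (n + 1)) (Fin (n + 1)) ℂ) :
    j (incl γ) Z 0 0 = 1 := by
  simp [j, incl, blockC, blockD, Matrix.mul_apply, Fin.sum_univ_succ]

@[simp] lemma j_incl_zero_succ (γ : Gam n) (Z : Matrix (Fin (n + 1)) (Fin (n + 1)) ℂ)
    (k : Fin n) : j (incl γ) Z 0 k.succ = 0 := by
  simp [j, incl, blockC, blockD, Matrix.mul_apply, Fin.sum_univ_succ]

@[simp] lemma j_incl_succ_succ (γ : Gam n) (Z : Matrix (Fin (n + 1)) (Fin (n + 1)) ℂ)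
    (i k : Fin n) : j (incl γ) Z i.succ k.succ = j γ (lower Z) i k := by
  simp [j, incl, blockC, blockD, Matrix.mul_apply, Fin.sum_univ_succ]

@[simp] lemma num_incl_succ_succ (γ : Gam n) (Z : Matrix (Fin (n + 1)) (Fin (n + 1)) ℂ)
    (i k : Fin n) : num (incl γ) Z i.succ k.succ = num γ (lower Z) i k := by
  simp [num, incl, blockA, blockB, Matrix.mul_apply, Fin.sum_univ_succ]

lemma det_j_incl (γ : Gam n) (Z : Matrix (Fin (n + 1)) (Fin (n + 1)) ℂ) :
    (j (incl γ) Z).det = (j γ (lower Z)).det := by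
  rw [det_succ_row_zero, Fin.sum_univ_succ]
  simp only [j_incl_zero_zero, j_incl_zero_succ]
  simp only [Fin.val_zero, pow_zero, one_mul, mul_zero, zero_mul, Finset.sum_const_zero, add_zero]
  congr 1
  ext i k
  simp

lemma lower_act_incl (γ : Gam n) {Z : Matrix (Fin (n + 1)) (Fin (n + 1)) ℂ}
    (hZ : Z ∈ upperHalf (n + 1)) : lower (act (incl γ) Z) = act γ (lower Z) := by
  apply mul_right_cancel_det (isUnit_det_j γ (lower_mem hZ))
  rw [act_mul_j γ (lower_mem hZ)]
  ext i k
  have h := congrFun (congrFun (act_mul_j (incl γ) hZ) i.succ) k.succ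
  rw [num_incl_succ_succ, Matrix.mul_apply, Fin.sum_univ_succ] at h
  rw [← h, Matrix.mul_apply]
  simp

/-- If the lower left block of `γ` has only one nonzero row `g p`, where `p` is primitive,
then `det j(γ, Z)` is up to sign `g Z[p] + d`, where `d` is the product of `p` with the first
row of the lower right block. -/
lemma exists_det_j_of_rank_one (γ : Gam (n + 1))
    (hC : ∀ i : Fin n, ∀ k, γ.1.toBlocks₂₁ i.succ k = 0) (h0 : γ.1.toBlocks₂₁ 0 0 ≠ 0) :
    ∃ (g d : ℤ) (p : Fin (n + 1) → ℤ), g ≠ 0 ∧ p 0 ≠ 0 ∧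
      (∀ k, γ.1.toBlocks₂₁ 0 k = g * p k) ∧ γ.1.toBlocks₂₂ 0 ⬝ᵥ p = d ∧
      ∀ Z, ‖(j γ Z).det‖ =
        ‖(g : ℂ) * ((fun i => (p i : ℂ)) ⬝ᵥ Z *ᵥ (fun i => (p i : ℂ))) + d‖ := by
  obtain ⟨V, W, hVW, g, hg⟩ := exists_unimodular_vecMul_eq_single (γ.1.toBlocks₂₁ 0)
  have hWV : W * V = 1 := mul_eq_one_comm.1 hVW
  set c := γ.1.toBlocks₂₁ 0 with hc
  set p := W 0 with hp
  have hcp : ∀ k, c k = g * p k := by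
    intro k
    have : c = c ᵥ* V ᵥ* W := by rw [Matrix.vecMul_vecMul, hVW, Matrix.vecMul_one]
    rw [this, hg]
    simp [hp]
  have hg0 : g ≠ 0 := by
    rintro rfl; exact h0 (by rw [hcp]; simp)
  have hp0 : p 0 ≠ 0 := by
    intro h; exact h0 (by rw [hcp, h]; simp)
  have hmem := SymplecticGroup.transpose_mem γ.2
  rw [← fromBlocks_toBlocks γ.1, fromBlocks_transpose, SymplecticGroup.fromBlocks_mem_iff] at hmem
  simp only [transpose_transpose] at hmem
  set A := γ.1.toBlocks₁₁
  set B := γ.1.toBlocks₁₂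
  set C := γ.1.toBlocks₂₁ with hCdef
  set D := γ.1.toBlocks₂₂
  obtain ⟨-, hCD, hAD⟩ := hmem
  have hDp : ∀ i : Fin n, D i.succ ⬝ᵥ p = 0 := by
    intro i
    have h := congrFun (congrFun hCD 0) i.succ
    simp only [Matrix.mul_apply, transpose_apply, hC, mul_zero, Finset.sum_const_zero] at h
    have h' : g * (D i.succ ⬝ᵥ p) = 0 := by
      rw [← h, dotProduct, Finset.mul_sum]
      refine Finset.sum_congr rfl fun k _ => ?_
      change _ = c k * _
      rw [hcp]; ring
    exact (mul_eq_zero.1 h').resolve_left hg0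
  -- the lower right block of `D ᵗW` is unimodular
  have hDW : ∀ i : Fin n, (D * Wᵀ) i.succ 0 = 0 := fun i => hDp i
  have hunit : IsUnit (lower (D * Wᵀ)).det := by
    have e : (A * V) * (D * Wᵀ)ᵀ = A * Dᵀ := by
      rw [transpose_mul, transpose_transpose, Matrix.mul_assoc, ← Matrix.mul_assoc V, hVW,
        Matrix.one_mul]
    have e2 : lower (A * V) * (lower (D * Wᵀ))ᵀ = 1 := by
      ext i k
      have h1 := congrFun (congrFun e i.succ) k.succ
      rw [Matrix.mul_apply, Fin.sum_univ_succ, transpose_apply, hDW, mul_zero, zero_add] at h1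
      have h2 := congrFun (congrFun hAD i.succ) k.succ
      rw [Matrix.sub_apply] at h2
      have h3 : (B * Cᵀ) i.succ k.succ = 0 := by
        simp [Matrix.mul_apply, hC]
      rw [h3, sub_zero] at h2
      rw [Matrix.mul_apply]
      simp only [submatrix_apply, transpose_apply]
      refine h1.trans (h2.trans ?_)
      simp [Matrix.one_apply]
    have := congrArg det e2
    rw [det_mul, det_transpose, det_one] at this
    exact IsUnit.of_mul_eq_one_right _ this
  refine ⟨g, D 0 ⬝ᵥ p, p, hg0, hp0, hcp, rfl, fun Z => ?_⟩
  set WC : Matrix (Fin (n + 1)) (Fin (n + 1)) ℂ := W.map (Int.cast : ℤ → ℂ) with hWC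
  have hWdet : ‖WCᵀ.det‖ = 1 := by
    have h1 : WC.det = ((W.det : ℤ) : ℂ) := ((Int.castRingHom ℂ).map_det W).symm
    have h2 := congrArg det hWV
    rw [det_mul, det_one] at h2
    rw [det_transpose, h1]
    rcases Int.isUnit_iff.1 (IsUnit.of_mul_eq_one _ h2) with h | h <;> simp [h]
  have hentry : ∀ i, (j γ Z * WCᵀ) i 0 = (fun k => ((C i k : ℤ) : ℂ)) ⬝ᵥ (Z *ᵥ fun k => (p k : ℂ)) +
      ((D i ⬝ᵥ p : ℤ) : ℂ) := by
    intro i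
    have : (j γ Z * WCᵀ) i 0 = (j γ Z *ᵥ fun k => (p k : ℂ)) i := by
      simp [Matrix.mul_apply, mulVec, dotProduct, hWC, hp]
    rw [this, j, Matrix.add_mulVec, Pi.add_apply, ← Matrix.mulVec_mulVec]
    congr 1
    simp [mulVec, dotProduct, blockD, D]
  have hlow : ∀ i k : Fin n, (j γ Z * WCᵀ) i.succ k.succ = (((D * Wᵀ) i.succ k.succ : ℤ) : ℂ) := by
    intro i k
    have h1 : ∀ l, j γ Z i.succ l = ((D i.succ l : ℤ) : ℂ) := by
      intro l
      rw [j, Matrix.add_apply, Matrix.mul_apply]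
      have : ∀ a, blockC γ i.succ a = 0 := fun a => by
        simp only [blockC, map_apply]
        rw [show γ.1.toBlocks₂₁ i.succ a = 0 from hC i a]; simp
      simp only [this, zero_mul, Finset.sum_const_zero, zero_add]
      rfl
    simp [Matrix.mul_apply, h1, hWC]
  -- below its first row, `j(γ, Z) ᵗW` agrees with `D ᵗW`, whose first column vanishes there
  have hdet : (j γ Z * WCᵀ).det = (j γ Z * WCᵀ) 0 0 * (((lower (D * Wᵀ)).det : ℤ) : ℂ) := by
    rw [det_succ_column_zero, Fin.sum_univ_succ]
    have : ∀ i : Fin n, (j γ Z * WCᵀ) i.succ 0 = 0 := by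
      intro i
      rw [hentry, hDp]
      have : (fun k => ((C i.succ k : ℤ) : ℂ)) = 0 := by funext k; simp [hC]
      rw [this]; simp
    simp only [this, mul_zero, zero_mul, Finset.sum_const_zero, add_zero, Fin.val_zero, pow_zero,
      one_mul]
    congr 1
    rw [show (((lower (D * Wᵀ)).det : ℤ) : ℂ) = ((lower (D * Wᵀ)).map (Int.castRingHom ℂ)).det from
      (Int.castRingHom ℂ).map_det _]
    congr 1
    ext i k
    simpa using hlow i k
  have hnorm : ‖(j γ Z).det‖ = ‖(j γ Z * WCᵀ).det‖ := by
    rw [det_mul, norm_mul, hWdet, mul_one]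
  have hu : ‖(((lower (D * Wᵀ)).det : ℤ) : ℂ)‖ = 1 := by
    rcases Int.isUnit_iff.1 hunit with h | h <;> simp [h]
  rw [hnorm, hdet, norm_mul, hu, mul_one, hentry]
  congr 2
  have : (fun k => ((C 0 k : ℤ) : ℂ)) = (g : ℂ) • fun k => (p k : ℂ) := by
    funext k
    have := hcp k
    simp only [Pi.smul_apply, smul_eq_mul]
    rw [show C 0 k = g * p k from this]
    push_cast; rfl
  rw [this, smul_dotProduct, smul_eq_mul]

/-- The lower rows of a symplectic matrix form an isotropic family, also after restriction to
the complement of the first hyperbolic plane, if the first coordinates vanish. -/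
lemma isotropic_of_col_zero {K : Type*} [Fintype K] (γ : Gam (n + 1)) (f : K → Fin (n + 1))
    (h : ∀ k, γ.1.toBlocks₂₁ (f k) 0 = 0) :
    let X : Matrix K (Fin n ⊕ Fin n) ℤ := Matrix.of fun k =>
      Sum.elim (fun c => γ.1.toBlocks₂₁ (f k) c.succ) (fun c => γ.1.toBlocks₂₂ (f k) c.succ)
    X * Matrix.J (Fin n) ℤ * Xᵀ = 0 := by
  intro X
  have hmem := SymplecticGroup.transpose_mem γ.2
  rw [← fromBlocks_toBlocks γ.1, fromBlocks_transpose, SymplecticGroup.fromBlocks_mem_iff] at hmem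
  simp only [transpose_transpose] at hmem
  ext k l
  have := congrFun (congrFun hmem.2.1 (f k)) (f l)
  simp only [Matrix.mul_apply, transpose_apply, Fin.sum_univ_succ, h, zero_mul, mul_zero,
    zero_add] at this
  rw [mul_J_mul_transpose_apply]
  simp only [X, of_apply, Sum.elim_inl, Sum.elim_inr, Matrix.zero_apply]
  rw [this, sub_self]

/-- If the set `T` covers `Γ_{n,0} \ Γ_n`, then every element of `Γ_{n+1}` is, up to the left action
of `Γ_{n+1,0}`, either in the image of `T`, or the product of an element whose lower left block
has one nonzero row with an element of the image of `T`. -/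
theorem Covers.exists_decomposition {T : Set (Gam n)} (hT : Covers T) (γ : Gam (n + 1)) :
    ∃ t ∈ T, γ * (incl t)⁻¹ ∈ Gam0 (n + 1) ∨ ∃ δ ∈ Gam0 (n + 1), ∃ γ' : Gam (n + 1),
      γ = δ * γ' * incl t ∧ (∀ i : Fin n, ∀ k, γ'.1.toBlocks₂₁ i.succ k = 0) ∧
        γ'.1.toBlocks₂₁ 0 0 ≠ 0 := by
  by_cases h0 : ∀ i, γ.1.toBlocks₂₁ i 0 = 0
  · obtain ⟨t, ht, h⟩ := hT.exists_isotropic _ (isotropic_of_col_zero γ id h0)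
    refine ⟨t, ht, Or.inl ?_⟩
    rw [mul_inv_mem_Gam0_iff]
    ext i c
    have h0' : γ.1.toBlocks₂₁ i 0 = 0 := h0 i
    refine Fin.cases ?_ (fun c => ?_) c
    · simp [Matrix.mul_apply, Fin.sum_univ_succ, incl, h0']
    · have := h i c
      rw [toBlocks_mul_inv_apply, sub_eq_zero] at this
      simpa [Matrix.mul_apply, Fin.sum_univ_succ, incl] using this
  · push Not at h0
    obtain ⟨i₀, hi₀⟩ := h0
    -- the first column of the lower left block is moved into its first entry; the other rows
    -- then form an isotropic family orthogonal to the first hyperbolic plane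
    obtain ⟨U, V, hUV, g, hg⟩ :=
      exists_unimodular_vecMul_eq_single (fun i => γ.1.toBlocks₂₁ i 0)
    set δ : Gam (n + 1) := levi V U (mul_eq_one_comm.1 hUV) with hδ
    set γ₁ : Gam (n + 1) := δ * γ with hγ₁
    have hC : γ₁.1.toBlocks₂₁ = Uᵀ * γ.1.toBlocks₂₁ := by
      rw [hγ₁, Submonoid.coe_mul, toBlocks_mul, toBlocks_fromBlocks₂₁]
      simp [hδ, levi]
    have hcol : ∀ i, γ₁.1.toBlocks₂₁ i 0 = (Pi.single 0 g : Fin (n + 1) → ℤ) i := by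
      intro i
      rw [hC, ← hg]
      simp [Matrix.mul_apply, vecMul, dotProduct, mul_comm]
    have hg0 : g ≠ 0 := by
      rintro rfl
      apply hi₀
      have : (fun i => γ.1.toBlocks₂₁ i 0) = 0 := by
        have h1 : (fun i => γ.1.toBlocks₂₁ i 0) ᵥ* U ᵥ* V = 0 := by rw [hg]; simp
        rwa [Matrix.vecMul_vecMul, hUV, Matrix.vecMul_one] at h1
      exact congrFun this i₀
    obtain ⟨t, ht, h⟩ := hT.exists_isotropic _ (isotropic_of_col_zero γ₁ Fin.succ
      (fun k => by rw [hcol]; simp))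
    refine ⟨t, ht, Or.inr ⟨δ⁻¹, inv_mem (levi_mem_Gam0 _ _ _), γ₁ * (incl t)⁻¹, ?_, ?_, ?_⟩⟩
    · rw [hγ₁]; group
    · intro i k
      rw [toBlocks₂₁_mul_inv, Matrix.sub_apply]
      refine Fin.cases ?_ (fun k => ?_) k
      · simp [Matrix.mul_apply, Fin.sum_univ_succ, incl, hcol]
      · have := h i k
        rw [toBlocks_mul_inv_apply] at this
        simpa [Matrix.mul_apply, Fin.sum_univ_succ, incl] using this
    · rw [toBlocks₂₁_mul_inv, Matrix.sub_apply]
      simpa [Matrix.mul_apply, Fin.sum_univ_succ, incl, hcol] using hg0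

/-- The data `(g p, d)` of `exists_det_j_of_rank_one` determine the coset. -/
lemma mul_inv_mem_Gam0_of_rank_one {γ δ : Gam (n + 1)}
    (hγ : ∀ i : Fin n, ∀ k, γ.1.toBlocks₂₁ i.succ k = 0)
    (hδ : ∀ i : Fin n, ∀ k, δ.1.toBlocks₂₁ i.succ k = 0) {g d : ℤ} {p : Fin (n + 1) → ℤ}
    (hg : g ≠ 0)
    (hγ0 : ∀ k, γ.1.toBlocks₂₁ 0 k = g * p k) (hδ0 : ∀ k, δ.1.toBlocks₂₁ 0 k = g * p k)
    (hγd : γ.1.toBlocks₂₂ 0 ⬝ᵥ p = d) (hδd : δ.1.toBlocks₂₂ 0 ⬝ᵥ p = d) :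
    γ * δ⁻¹ ∈ Gam0 (n + 1) := by
  have orth : ∀ {γ : Gam (n + 1)}, (∀ i : Fin n, ∀ k, γ.1.toBlocks₂₁ i.succ k = 0) →
      (∀ k, γ.1.toBlocks₂₁ 0 k = g * p k) → ∀ i : Fin n, γ.1.toBlocks₂₂ i.succ ⬝ᵥ p = 0 := by
    intro γ h1 h2 i
    have hmem := SymplecticGroup.transpose_mem γ.2
    rw [← fromBlocks_toBlocks γ.1, fromBlocks_transpose, SymplecticGroup.fromBlocks_mem_iff] at hmem
    simp only [transpose_transpose] at hmem
    have h := congrFun (congrFun hmem.2.1 0) i.succ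
    simp only [Matrix.mul_apply, transpose_apply, h1, mul_zero, Finset.sum_const_zero, h2] at h
    have h' : g * (γ.1.toBlocks₂₂ i.succ ⬝ᵥ p) = 0 := by
      rw [← h, dotProduct, Finset.mul_sum]
      exact Finset.sum_congr rfl fun k _ => by ring
    exact (mul_eq_zero.1 h').resolve_left hg
  have e : ∀ v : Fin (n + 1) → ℤ, ∑ k, g * p k * v k = g * (v ⬝ᵥ p) := by
    intro v
    rw [dotProduct, Finset.mul_sum]
    exact Finset.sum_congr rfl fun k _ => by ring
  have e' : ∀ v : Fin (n + 1) → ℤ, ∑ k, v k * (g * p k) = g * (v ⬝ᵥ p) := by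
    intro v
    rw [dotProduct, Finset.mul_sum]
    exact Finset.sum_congr rfl fun k _ => by ring
  rw [mul_inv_mem_Gam0_iff]
  ext i k
  rw [Matrix.mul_apply, Matrix.mul_apply]
  simp only [transpose_apply]
  refine Fin.cases ?_ (fun i => ?_) i <;> refine Fin.cases ?_ (fun k => ?_) k
  · simp only [hγ0, hδ0, e, e', hγd, hδd]
  · simp only [hγ0, hδ, e, orth hδ hδ0]; simp
  · simp only [hδ0, hγ, e', orth hγ hγ0]; simp
  · simp only [hγ, hδ]; simp

/-! ### Comparison of lattice sums with integrals -/

/-- A sum is bounded by the integral of a function which dominates its terms on disjoint sets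
of measure one. -/
lemma tsum_le_lintegral_of_disjoint {ι E : Type*} [Countable ι] [MeasurableSpace E] {μ : Measure E}
    (U : ι → Set E) (hU : ∀ i, MeasurableSet (U i)) (hd : Pairwise (Function.onFun Disjoint U))
    (hμ : ∀ i, μ (U i) = 1) (c : ι → ℝ≥0∞) (f : E → ℝ≥0∞) (h : ∀ i, ∀ x ∈ U i, c i ≤ f x) :
    ∑' i, c i ≤ ∫⁻ x, f x ∂μ := by
  calc ∑' i, c i = ∑' i, ∫⁻ _ in U i, c i ∂μ := by simp [hμ]
    _ ≤ ∑' i, ∫⁻ x in U i, f x ∂μ :=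
        ENNReal.tsum_le_tsum fun i => setLIntegral_mono' (hU i) (h i)
    _ = ∫⁻ x in ⋃ i, U i, f x ∂μ := (lintegral_iUnion hU hd f).symm
    _ ≤ ∫⁻ x, f x ∂μ := setLIntegral_le_lintegral _ _

/-- The half-open unit cube. -/
def unitCube (ι : Type*) : Set (ι → ℝ) := Set.pi Set.univ fun _ => Set.Ico 0 1

lemma measurableSet_unitCube (ι : Type*) [Countable ι] : MeasurableSet (unitCube ι) :=
  MeasurableSet.univ_pi fun _ => measurableSet_Ico

lemma volume_unitCube (ι : Type*) [Fintype ι] : volume (unitCube ι) = 1 := by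
  rw [unitCube, volume_pi_pi]
  simp

lemma sub_floor_mem_unitCube {ι : Type*} (x : ι → ℝ) : (fun i => x i - ⌊x i⌋) ∈ unitCube ι :=
  fun _ _ => ⟨Int.fract_nonneg _, Int.fract_lt_one _⟩

lemma norm_le_one_of_mem_unitCube {ι : Type*} [Fintype ι] {x : ι → ℝ} (hx : x ∈ unitCube ι) :
    ‖x‖ ≤ 1 := by
  rw [pi_norm_le_iff_of_nonneg zero_le_one]
  intro i
  have := hx i trivial
  rw [Real.norm_eq_abs, abs_le]
  exact ⟨by linarith [this.1], this.2.le⟩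

/-- The sum of `(1 + ‖v‖) ^ (-r)` over the translates of the integral lattice, for `r` greater than
the rank, is bounded uniformly in the translation. -/
lemma exists_tsum_inv_one_add_norm_pow_le (ι : Type*) [Fintype ι] {r : ℕ}
    (hr : Fintype.card ι < r) : ∃ C : ℝ≥0∞, C ≠ ∞ ∧ ∀ s : ι → ℝ,
      ∑' v : ι → ℤ, ENNReal.ofReal (((1 + ‖(fun i => (v i : ℝ)) + s‖) ^ r)⁻¹) ≤ C := by
  refine ⟨∫⁻ x : ι → ℝ, ENNReal.ofReal (2 ^ r) * ENNReal.ofReal (((1 + ‖x‖) ^ r)⁻¹), ?_, ?_⟩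
  · rw [lintegral_const_mul' _ _ ENNReal.ofReal_ne_top]
    apply ENNReal.mul_ne_top ENNReal.ofReal_ne_top
    have h := finite_integral_one_add_norm (E := ι → ℝ) (μ := volume) (r := r)
      (by rw [Module.finrank_fintype_fun_eq_card]; exact_mod_cast hr)
    refine ne_of_lt (lt_of_eq_of_lt ?_ h)
    congr 1
    funext x
    rw [Real.rpow_neg (by positivity), Real.rpow_natCast]
  · intro s
    apply tsum_le_lintegral_of_disjoint
      (fun v : ι → ℤ => (fun x => x - ((fun i => (v i : ℝ)) + s)) ⁻¹' unitCube ι)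
    · exact fun v => (measurable_id.sub_const _) (measurableSet_unitCube ι)
    · intro v w hvw
      refine Set.disjoint_left.2 fun x hx hy => hvw ?_
      funext i
      have h1 := hx i trivial
      have h2 := hy i trivial
      simp only [Pi.sub_apply, Pi.add_apply, Set.mem_Ico] at h1 h2
      have a1 : (v i : ℝ) < w i + 1 := by linarith
      have a2 : (w i : ℝ) < v i + 1 := by linarith
      have b1 : v i < w i + 1 := by exact_mod_cast a1
      have b2 : w i < v i + 1 := by exact_mod_cast a2
      omega
    · intro v
      simp only [sub_eq_add_neg]
      rw [measure_preimage_add_right, volume_unitCube]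
    · intro v x hx
      rw [← ENNReal.ofReal_mul (by positivity)]
      apply ENNReal.ofReal_le_ofReal
      have h1 := norm_le_one_of_mem_unitCube hx
      have h2 : 1 + ‖x‖ ≤ 2 * (1 + ‖(fun i => (v i : ℝ)) + s‖) := by
        have := norm_add_le (x - ((fun i => (v i : ℝ)) + s)) ((fun i => (v i : ℝ)) + s)
        rw [sub_add_cancel] at this
        have := norm_nonneg ((fun i => (v i : ℝ)) + s)
        linarith
      have h3 : (1 + ‖x‖) ^ r ≤ 2 ^ r * (1 + ‖(fun i => (v i : ℝ)) + s‖) ^ r := by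
        rw [← mul_pow]
        exact pow_le_pow_left₀ (by positivity) h2 r
      rw [← div_eq_mul_inv, inv_eq_one_div, div_le_div_iff₀ (by positivity) (by positivity),
        one_mul]
      exact h3

/-- The sum over the integers of `1 / ((a + d) ^ 2 + b ^ 2)` is `O(1 / b)` for `b` bounded
from below. -/
lemma exists_tsum_inv_sq_add_sq_le {b₀ : ℝ} (hb₀ : 0 < b₀) : ∃ C : ℝ, 0 ≤ C ∧ ∀ a b : ℝ, b₀ ≤ b →
    ∑' d : ℤ, ENNReal.ofReal (((a + d) ^ 2 + b ^ 2)⁻¹) ≤ ENNReal.ofReal (C * b⁻¹) := by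
  set K : ℝ := 2 + 2 / b₀ ^ 2 with hK
  have hK0 : 0 < K := by positivity
  refine ⟨K * Real.pi, by positivity, fun a b hb => ?_⟩
  have hb0 : 0 < b := hb₀.trans_le hb
  have hint : Integrable fun x : ℝ => K * (b⁻¹ ^ 2 * (1 + (x / b) ^ 2)⁻¹) :=
    ((integrable_inv_one_add_sq.comp_div hb0.ne').const_mul _).const_mul _
  have hval : ∫ x : ℝ, K * (b⁻¹ ^ 2 * (1 + (x / b) ^ 2)⁻¹) = K * Real.pi * b⁻¹ := by
    rw [integral_const_mul, integral_const_mul,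
      Measure.integral_comp_div (fun x : ℝ => (1 + x ^ 2)⁻¹), integral_univ_inv_one_add_sq,
      abs_of_pos hb0, smul_eq_mul]
    field_simp
  rw [← hval, ofReal_integral_eq_lintegral_ofReal hint
    (Filter.Eventually.of_forall fun x => by positivity)]
  apply tsum_le_lintegral_of_disjoint (fun d : ℤ => Set.Ico (a + d) (a + d + 1))
  · exact fun d => measurableSet_Ico
  · intro v w hvw
    refine Set.disjoint_left.2 fun x hx hy => hvw ?_
    have a1 : (v : ℝ) < w + 1 := by linarith [hx.1, hy.2]
    have a2 : (w : ℝ) < v + 1 := by linarith [hy.1, hx.2]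
    have b1 : v < w + 1 := by exact_mod_cast a1
    have b2 : w < v + 1 := by exact_mod_cast a2
    omega
  · intro d; simp
  · intro d x hx
    apply ENNReal.ofReal_le_ofReal
    have e : K * (b⁻¹ ^ 2 * (1 + (x / b) ^ 2)⁻¹) = K / (x ^ 2 + b ^ 2) := by
      field_simp
      ring
    rw [e, inv_eq_one_div, div_le_div_iff₀ (by positivity) (by positivity), one_mul]
    have h1 : x ^ 2 ≤ 2 * (a + d) ^ 2 + 2 := by
      have h2 : 0 ≤ x - (a + d) := by linarith [hx.1]
      have h3 : x - (a + d) ≤ 1 := by linarith [hx.2]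
      nlinarith [sq_nonneg (x - 2 * (a + d))]
    have h4 : 2 ≤ 2 / b₀ ^ 2 * b ^ 2 := by
      rw [div_mul_eq_mul_div, le_div_iff₀ (by positivity)]
      nlinarith
    have h5 : 0 ≤ 2 / b₀ ^ 2 * (a + d) ^ 2 := by positivity
    rw [hK]
    nlinarith [sq_nonneg b]

/-- Integrals over the whole space are sums of integrals over the unit cube. -/
lemma lintegral_le_tsum_unitCube {ι : Type*} [Fintype ι] (f : (ι → ℝ) → ℝ≥0∞) :
    ∫⁻ x, f x ≤ ∑' t : ι → ℤ, ∫⁻ b in unitCube ι, f ((fun i => (t i : ℝ)) + b) := by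
  have hcov : (⋃ t : ι → ℤ, (fun x => (fun i => -(t i : ℝ)) + x) ⁻¹' unitCube ι) = Set.univ := by
    refine Set.eq_univ_of_forall fun x => Set.mem_iUnion.2 ⟨fun i => ⌊x i⌋, ?_⟩
    have := sub_floor_mem_unitCube x
    have e : (fun i => x i - (⌊x i⌋ : ℝ)) = (fun i => -(⌊x i⌋ : ℝ)) + x := by
      funext i; simp [sub_eq_neg_add]
    rwa [e] at this
  calc ∫⁻ x, f x = ∫⁻ x in ⋃ t : ι → ℤ, (fun x => (fun i => -(t i : ℝ)) + x) ⁻¹' unitCube ι, f x := by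
        rw [hcov, setLIntegral_univ]
    _ ≤ ∑' t : ι → ℤ, ∫⁻ x in (fun x => (fun i => -(t i : ℝ)) + x) ⁻¹' unitCube ι, f x :=
        lintegral_iUnion_le _ _
    _ = _ := by
        congr 1
        funext t
        have hm := measurePreserving_add_left (volume : Measure (ι → ℝ)) (fun i => -(t i : ℝ))
        rw [← hm.setLIntegral_comp_preimage_emb
          (MeasurableEquiv.addLeft (fun i => -(t i : ℝ))).measurableEmbedding
          (fun b => f ((fun i => (t i : ℝ)) + b))]
        congr 1
        funext x
        congr 1
        funext i
        simp

/-! ### Lattice sums for the imaginary parts in an orbit -/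

open scoped MatrixOrder in
/-- Positive definite real matrices are of the form `ᵗG G`. -/
lemma exists_eq_transpose_mul_self {Y : Matrix (Fin n) (Fin n) ℝ} (hY : Y.PosDef) :
    ∃ G : Matrix (Fin n) (Fin n) ℝ, Y = Gᵀ * G := by
  obtain ⟨G, hG⟩ := CStarAlgebra.nonneg_iff_eq_star_mul_self.mp hY.posSemidef.nonneg
  exact ⟨G, by rw [hG, star_eq_conjTranspose, conjTranspose_eq_transpose_of_trivial]⟩

/-- A frame at `γ⟨Z⟩`: a real matrix `G` with `Im(γ⟨Z⟩) = ᵗG G`. The point of the definition is that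
the matrix `G j(γ, Z)` is bounded independently of `γ`. -/
def IsFrame (γ : Gam n) (Z : Matrix (Fin n) (Fin n) ℂ) (G : Matrix (Fin n) (Fin n) ℝ) : Prop :=
  imPart (act γ Z) = Gᵀ * G

lemma exists_isFrame (γ : Gam n) {Z : Matrix (Fin n) (Fin n) ℂ} (hZ : Z ∈ upperHalf n) :
    ∃ G, IsFrame γ Z G := exists_eq_transpose_mul_self (act_mem γ hZ).2

lemma ofReal_transpose {a b : ℕ} (M : Matrix (Fin a) (Fin b) ℝ) : ofReal Mᵀ = (ofReal M)ᵀ := rfl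

lemma IsFrame.transpose_mul_conjM {γ : Gam n} {Z : Matrix (Fin n) (Fin n) ℂ}
    {G : Matrix (Fin n) (Fin n) ℝ} (hG : IsFrame γ Z G) (hZ : Z ∈ upperHalf n) :
    (ofReal G * j γ Z)ᵀ * conjM (ofReal G * j γ Z) = ofReal (imPart Z) := by
  rw [← transpose_j_mul_im_act γ hZ, hG, ofReal_mul, ofReal_transpose, transpose_mul, conjM_mul,
    conjM_ofReal]
  simp only [Matrix.mul_assoc]

lemma IsFrame.abs_det_mul {γ : Gam n} {Z : Matrix (Fin n) (Fin n) ℂ}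
    {G : Matrix (Fin n) (Fin n) ℝ} (hG : IsFrame γ Z G) (hZ : Z ∈ upperHalf n) :
    |G.det| * ‖(j γ Z).det‖ = √(imPart Z).det := by
  have h := det_im_act γ hZ
  rw [hG, det_mul, det_transpose] at h
  rw [← h, ← sq, ← mul_pow, Real.sqrt_sq_eq_abs, abs_mul, abs_norm, mul_comm]

lemma IsFrame.norm_apply_sq_le {γ : Gam n} {Z : Matrix (Fin n) (Fin n) ℂ}
    {G : Matrix (Fin n) (Fin n) ℝ} (hG : IsFrame γ Z G) (hZ : Z ∈ upperHalf n) (i k : Fin n) :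
    ‖(ofReal G * j γ Z) i k‖ ^ 2 ≤ imPart Z k k := by
  have h := congrFun (congrFun (hG.transpose_mul_conjM hZ) k) k
  have e : ((ofReal G * j γ Z)ᵀ * conjM (ofReal G * j γ Z)) k k =
      ((∑ l, ‖(ofReal G * j γ Z) l k‖ ^ 2 : ℝ) : ℂ) := by
    rw [Matrix.mul_apply]
    push_cast
    exact Finset.sum_congr rfl fun l _ => Complex.mul_conj' _
  rw [e] at h
  have h' : ∑ l, ‖(ofReal G * j γ Z) l k‖ ^ 2 = imPart Z k k := by
    simp only [ofReal, map_apply] at h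
    exact_mod_cast h
  rw [← h']
  exact Finset.single_le_sum (f := fun l => ‖(ofReal G * j γ Z) l k‖ ^ 2)
    (fun l _ => sq_nonneg _) (Finset.mem_univ i)

/-- The value `Y[u] = ᵗu Y u` of a quadratic form. -/
def quad (Y : Matrix (Fin n) (Fin n) ℝ) (u : Fin n → ℝ) : ℝ := u ⬝ᵥ Y *ᵥ u

lemma quad_transpose_mul_self (G : Matrix (Fin n) (Fin n) ℝ) (u : Fin n → ℝ) :
    quad (Gᵀ * G) u = ∑ i, (G *ᵥ u) i ^ 2 := by
  rw [quad, ← Matrix.mulVec_mulVec, Matrix.dotProduct_mulVec, Matrix.vecMul_transpose]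
  simp [dotProduct, sq]

lemma quad_nonneg {Y : Matrix (Fin n) (Fin n) ℝ} (hY : Y.PosDef) (u : Fin n → ℝ) :
    0 ≤ quad Y u := by
  simpa [quad] using hY.posSemidef.dotProduct_mulVec_nonneg u

/-- The vector `c Z + d` attached to a real vector `(c, d)`. -/
def cplx (Z : Matrix (Fin n) (Fin n) ℂ) : (Fin n ⊕ Fin n → ℝ) →ₗ[ℝ] (Fin n → ℂ) where
  toFun v := (fun i => (v (Sum.inl i) : ℂ)) ᵥ* Z + fun i => (v (Sum.inr i) : ℂ)
  map_add' v w := by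
    funext k
    simp only [vecMul, dotProduct, Pi.add_apply, Complex.ofReal_add, add_mul,
      Finset.sum_add_distrib]
    ring
  map_smul' r v := by
    funext k
    simp [vecMul, dotProduct, Finset.mul_sum, mul_assoc]

lemma ker_cplx {Z : Matrix (Fin n) (Fin n) ℂ} (hZ : Z ∈ upperHalf n) :
    LinearMap.ker (cplx Z) = ⊥ := by
  rw [LinearMap.ker_eq_bot']
  intro v hv
  have h1 : (fun i => v (Sum.inl i)) ᵥ* imPart Z = 0 := by
    funext k
    have := congrArg Complex.im (congrFun hv k)
    simpa [cplx, vecMul, dotProduct] using this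
  have h2 : (fun i => v (Sum.inl i)) = 0 := by
    by_contra h
    have := hZ.2.dotProduct_mulVec_pos h
    rw [star_trivial, Matrix.dotProduct_mulVec, h1, zero_dotProduct] at this
    exact lt_irrefl _ this
  have h3 : ∀ i, v (Sum.inl i) = 0 := fun i => congrFun h2 i
  funext s
  rcases s with i | i
  · exact h3 i
  · have := congrFun hv i
    simpa [cplx, vecMul, dotProduct, h3] using this

/-- A symplectic matrix with real entries. -/
abbrev realM (γ : Gam n) : Matrix (Fin n ⊕ Fin n) (Fin n ⊕ Fin n) ℝ := γ.1.map (Int.cast : ℤ → ℝ)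

lemma cplx_vecMul (γ : Gam n) {Z : Matrix (Fin n) (Fin n) ℂ} (hZ : Z ∈ upperHalf n)
    (u b : Fin n → ℝ) : cplx Z (Sum.elim u b ᵥ* realM γ) =
      ((fun i => (u i : ℂ)) ᵥ* act γ Z + fun i => (b i : ℂ)) ᵥ* j γ Z := by
  rw [Matrix.add_vecMul, Matrix.vecMul_vecMul, act_mul_j γ hZ]
  have h1 : (fun i => ((Sum.elim u b ᵥ* realM γ) (Sum.inl i) : ℂ)) =
      (fun i => (u i : ℂ)) ᵥ* blockA γ + (fun i => (b i : ℂ)) ᵥ* blockC γ := by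
    funext k
    simp [vecMul, dotProduct, Fintype.sum_sum_type, blockA, blockC, toBlocks₁₁, toBlocks₂₁]
  have h2 : (fun i => ((Sum.elim u b ᵥ* realM γ) (Sum.inr i) : ℂ)) =
      (fun i => (u i : ℂ)) ᵥ* blockB γ + (fun i => (b i : ℂ)) ᵥ* blockD γ := by
    funext k
    simp [vecMul, dotProduct, Fintype.sum_sum_type, blockB, blockD, toBlocks₁₂, toBlocks₂₂]
  change (fun i => ((Sum.elim u b ᵥ* realM γ) (Sum.inl i) : ℂ)) ᵥ* Z +
    (fun i => ((Sum.elim u b ᵥ* realM γ) (Sum.inr i) : ℂ)) = _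
  rw [h1, h2, num, j, Matrix.add_vecMul, Matrix.vecMul_add, Matrix.vecMul_add,
    Matrix.vecMul_vecMul, Matrix.vecMul_vecMul]
  abel

/-- The vector `(u, b) γ` is bounded by the frame coordinates of `u` if `b` lies in a suitable
cell of the frame. -/
lemma exists_norm_vecMul_sq_le {Z : Matrix (Fin n) (Fin n) ℂ} (hZ : Z ∈ upperHalf n) :
    ∃ C : ℝ, 0 < C ∧ ∀ (γ : Gam n) (G : Matrix (Fin n) (Fin n) ℝ), IsFrame γ Z G →
      ∀ (u e : Fin n → ℝ), ‖e‖ ≤ 1 →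
        (1 + ‖Sum.elim u (-(u ᵥ* rePart (act γ Z)) + e ᵥ* G) ᵥ* realM γ‖) ^ 2 ≤
          C * (1 + quad (imPart (act γ Z)) u) := by
  obtain ⟨κ, hκ0, hκ⟩ := (cplx Z).exists_antilipschitzWith (ker_cplx hZ)
  set B : ℝ := ∑ k, √(imPart Z k k) with hB
  have hB0 : 0 ≤ B := Finset.sum_nonneg fun k _ => Real.sqrt_nonneg _
  set M : ℝ := κ * (n * B) with hM
  have hM0 : 0 ≤ M := by positivity
  refine ⟨2 * (1 + M) ^ 2, by positivity, fun γ G hG u e he => ?_⟩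
  set v := Sum.elim u (-(u ᵥ* rePart (act γ Z)) + e ᵥ* G) ᵥ* realM γ with hv
  set w := G *ᵥ u with hw
  have hquad : quad (imPart (act γ Z)) u = ∑ i, w i ^ 2 := by
    rw [hG, quad_transpose_mul_self]
  have hK : ∀ i k, ‖(ofReal G * j γ Z) i k‖ ≤ B := by
    intro i k
    refine (Real.le_sqrt_of_sq_le (hG.norm_apply_sq_le hZ i k)).trans ?_
    exact Finset.single_le_sum (f := fun k => √(imPart Z k k)) (fun l _ => Real.sqrt_nonneg _)
      (Finset.mem_univ k)
  -- in frame coordinates the vector becomes `e + i w`, since `b` cancels the real part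
  have hz : cplx Z v = (fun i => (e i : ℂ) + Complex.I * w i) ᵥ* (ofReal G * j γ Z) := by
    rw [hv, cplx_vecMul γ hZ, ← Matrix.vecMul_vecMul]
    congr 1
    funext k
    have h1 : w ᵥ* G = u ᵥ* imPart (act γ Z) := by
      rw [hG, ← Matrix.vecMul_vecMul, Matrix.vecMul_transpose]
    have h2 : ∑ i, w i * G i k = ∑ i, u i * (act γ Z i k).im := by
      simpa [vecMul, dotProduct] using congrFun h1 k
    apply Complex.ext
    · simp [vecMul, dotProduct, ofReal]
    · simpa [vecMul, dotProduct, ofReal] using h2.symm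
  have hnz : ‖cplx Z v‖ ≤ n * B * (1 + ‖w‖) := by
    rw [hz, pi_norm_le_iff_of_nonneg (by positivity)]
    intro k
    rw [vecMul, dotProduct]
    refine (norm_sum_le _ _).trans ?_
    have : ∀ i ∈ Finset.univ, ‖((e i : ℂ) + Complex.I * w i) * (ofReal G * j γ Z) i k‖ ≤
        (1 + ‖w‖) * B := by
      intro i _
      rw [norm_mul]
      refine mul_le_mul ?_ (hK i k) (norm_nonneg _) (by positivity)
      refine (norm_add_le _ _).trans (add_le_add ?_ ?_)
      · rw [Complex.norm_real]; exact (norm_le_pi_norm e i).trans he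
      · rw [norm_mul, Complex.norm_I, one_mul, Complex.norm_real]; exact norm_le_pi_norm w i
    refine (Finset.sum_le_card_nsmul _ _ _ this).trans (le_of_eq ?_)
    simp; ring
  have hnv : ‖v‖ ≤ M * (1 + ‖w‖) := by
    have := hκ.le_mul_dist v 0
    rw [map_zero, dist_zero_right, dist_zero_right] at this
    calc ‖v‖ ≤ κ * ‖cplx Z v‖ := this
      _ ≤ κ * (n * B * (1 + ‖w‖)) := by gcongr
      _ = _ := by rw [hM]; ring
  have hw2 : ‖w‖ ^ 2 ≤ ∑ i, w i ^ 2 := by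
    have : ‖w‖ ≤ √(∑ i, w i ^ 2) := by
      rw [pi_norm_le_iff_of_nonneg (Real.sqrt_nonneg _)]
      intro i
      rw [Real.norm_eq_abs]
      apply Real.abs_le_sqrt
      exact Finset.single_le_sum (f := fun i => w i ^ 2) (fun l _ => sq_nonneg _)
        (Finset.mem_univ i)
    calc ‖w‖ ^ 2 ≤ √(∑ i, w i ^ 2) ^ 2 := by gcongr
      _ = _ := Real.sq_sqrt (Finset.sum_nonneg fun i _ => sq_nonneg _)
  have h1 : 1 + ‖v‖ ≤ (1 + M) * (1 + ‖w‖) := by nlinarith [norm_nonneg w]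
  calc (1 + ‖v‖) ^ 2 ≤ ((1 + M) * (1 + ‖w‖)) ^ 2 := by gcongr
    _ = (1 + M) ^ 2 * (1 + ‖w‖) ^ 2 := mul_pow _ _ _
    _ ≤ (1 + M) ^ 2 * (2 * (1 + ‖w‖ ^ 2)) := by
        gcongr; nlinarith [sq_nonneg (1 - ‖w‖)]
    _ ≤ (1 + M) ^ 2 * (2 * (1 + quad (imPart (act γ Z)) u)) := by rw [hquad]; gcongr
    _ = _ := by ring

/-- The change of variables `x ↦ x G` in an integral. -/
lemma lintegral_comp_vecMul (G : Matrix (Fin n) (Fin n) ℝ) (hG : G.det ≠ 0)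
    {f : (Fin n → ℝ) → ℝ≥0∞} (hf : Measurable f) (b : Fin n → ℝ) :
    ENNReal.ofReal |G.det| * ∫⁻ e, f (b + e ᵥ* G) = ∫⁻ x, f x := by
  have h := Real.map_matrix_volume_pi_eq_smul_volume_pi (M := Gᵀ) (by rwa [det_transpose])
  have hm : Measurable (toLin' Gᵀ) := (LinearMap.continuous_of_finiteDimensional _).measurable
  have e1 : ∫⁻ e, f (b + e ᵥ* G) = ∫⁻ y, f (b + y) ∂(Measure.map (toLin' Gᵀ) volume) := by
    rw [lintegral_map (f := fun y => f (b + y)) (hf.comp (measurable_const_add b)) hm]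
    simp [Matrix.mulVec_transpose]
  rw [e1, h, lintegral_smul_measure, smul_eq_mul, ← mul_assoc, ← ENNReal.ofReal_mul (abs_nonneg _),
    det_transpose, ← abs_mul, mul_inv_cancel₀ hG, abs_one, ENNReal.ofReal_one, one_mul,
    lintegral_add_left_eq_self (fun y => f y)]

/-- Uniform bound for the lattice sums of the forms `Im(γ⟨Z⟩)`: the sum of
`(1 + Im(γ⟨Z⟩)[u + κ]) ^ (-τ)` over integral `u` is at most a constant times `|det j(γ, Z)|`. It
follows by averaging a sum over `ℤ²ⁿ` over translations in the directions of the Lagrangian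
subspace of `γ`. -/
theorem exists_tsum_inv_one_add_quad_pow_le {Z : Matrix (Fin n) (Fin n) ℂ} (hZ : Z ∈ upperHalf n)
    {τ : ℕ} (hτ : n < τ) : ∃ C : ℝ≥0∞, C ≠ ∞ ∧ ∀ (γ : Gam n) (κ : Fin n → ℝ),
      ∑' u : Fin n → ℤ, ENNReal.ofReal
        (((1 + quad (imPart (act γ Z)) ((fun i => (u i : ℝ)) + κ)) ^ τ)⁻¹) ≤
          C * ENNReal.ofReal ‖(j γ Z).det‖ := by
  obtain ⟨C₁, hC₁, hvec⟩ := exists_norm_vecMul_sq_le hZ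
  obtain ⟨C₂, hC₂, hsum⟩ := exists_tsum_inv_one_add_norm_pow_le (Fin n ⊕ Fin n) (r := 2 * τ)
    (by simp; omega)
  have hdet : 0 < (imPart Z).det := hZ.2.det_pos
  set s := √(imPart Z).det with hs
  have hs0 : 0 < s := Real.sqrt_pos.2 hdet
  refine ⟨ENNReal.ofReal (C₁ ^ τ) * C₂ * ENNReal.ofReal s⁻¹,
    ENNReal.mul_ne_top (ENNReal.mul_ne_top ENNReal.ofReal_ne_top hC₂) ENNReal.ofReal_ne_top,
    fun γ κ => ?_⟩
  obtain ⟨G, hG⟩ := exists_isFrame γ hZ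
  have hGs := hG.abs_det_mul hZ
  have hj : 0 < ‖(j γ Z).det‖ := norm_pos_iff.2 (det_j_ne_zero γ hZ)
  have hG0 : G.det ≠ 0 := by
    intro h
    rw [h, abs_zero, zero_mul] at hGs
    exact hs0.ne hGs
  set h : (Fin n ⊕ Fin n → ℝ) → ℝ≥0∞ := fun v => ENNReal.ofReal (((1 + ‖v‖) ^ (2 * τ))⁻¹) with hh
  have hhm : Measurable h := by
    apply ENNReal.measurable_ofReal.comp
    fun_prop
  have hlin : ∀ a : Fin n → ℝ, Measurable fun b : Fin n → ℝ => Sum.elim a b ᵥ* realM γ := by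
    intro a
    apply Continuous.measurable
    refine Continuous.matrix_vecMul ?_ continuous_const
    refine continuous_pi fun s => ?_
    rcases s with i | i
    · exact continuous_const
    · exact continuous_apply i
  -- each term is an average of `h` over a cell
  have hcell : ∀ u : Fin n → ℝ, ENNReal.ofReal |G.det| * ENNReal.ofReal
        (((1 + quad (imPart (act γ Z)) u) ^ τ)⁻¹) ≤
      ENNReal.ofReal (C₁ ^ τ) * ∫⁻ b, h (Sum.elim u b ᵥ* realM γ) := by
    intro u
    rw [← lintegral_comp_vecMul G hG0 (f := fun b => h (Sum.elim u b ᵥ* realM γ))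
      (hhm.comp (hlin u)) (-(u ᵥ* rePart (act γ Z))),
      mul_left_comm]
    gcongr
    calc ENNReal.ofReal (((1 + quad (imPart (act γ Z)) u) ^ τ)⁻¹)
        = ∫⁻ _ in unitCube (Fin n), ENNReal.ofReal (((1 + quad (imPart (act γ Z)) u) ^ τ)⁻¹) := by
          simp [volume_unitCube]
      _ ≤ ∫⁻ e in unitCube (Fin n), ENNReal.ofReal (C₁ ^ τ) *
          h (Sum.elim u (-(u ᵥ* rePart (act γ Z)) + e ᵥ* G) ᵥ* realM γ) := by
          refine setLIntegral_mono' (measurableSet_unitCube _) fun e he => ?_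
          rw [hh, ← ENNReal.ofReal_mul (by positivity)]
          apply ENNReal.ofReal_le_ofReal
          have h1 := hvec γ G hG u e (norm_le_one_of_mem_unitCube he)
          have hq := quad_nonneg (act_mem γ hZ).2 u
          rw [← div_eq_mul_inv, inv_eq_one_div, div_le_div_iff₀ (by positivity) (by positivity),
            one_mul, pow_mul, ← mul_pow]
          gcongr
      _ ≤ ∫⁻ e, ENNReal.ofReal (C₁ ^ τ) *
          h (Sum.elim u (-(u ᵥ* rePart (act γ Z)) + e ᵥ* G) ᵥ* realM γ) :=
          setLIntegral_le_lintegral _ _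
      _ = _ := lintegral_const_mul' _ _ ENNReal.ofReal_ne_top
  have hsum' : ∀ s, ∑' v : Fin n ⊕ Fin n → ℤ, h ((fun i => (v i : ℝ)) + s) ≤ C₂ := hsum
  clear_value h
  -- the integrals over the Lagrangian directions are cut into unit cubes, and the sum over
  -- `(u, t) ∈ ℤ²ⁿ` is transported by the automorphism `γ` of `ℤ²ⁿ`
  have hunfold : ∑' u : Fin n → ℤ,
      ∫⁻ b, h (Sum.elim ((fun i => (u i : ℝ)) + κ) b ᵥ* realM γ) ≤ C₂ := by
    calc ∑' u : Fin n → ℤ, ∫⁻ b, h (Sum.elim ((fun i => (u i : ℝ)) + κ) b ᵥ* realM γ)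
        ≤ ∑' u : Fin n → ℤ, ∑' t : Fin n → ℤ, ∫⁻ b in unitCube (Fin n),
            h (Sum.elim ((fun i => (u i : ℝ)) + κ) ((fun i => (t i : ℝ)) + b) ᵥ* realM γ) :=
          ENNReal.tsum_le_tsum fun u => lintegral_le_tsum_unitCube _
      _ = ∑' x : (Fin n → ℤ) × (Fin n → ℤ), ∫⁻ b in unitCube (Fin n),
            h (Sum.elim ((fun i => (x.1 i : ℝ)) + κ) ((fun i => (x.2 i : ℝ)) + b) ᵥ* realM γ) :=
          by rw [ENNReal.tsum_prod']
      _ = ∫⁻ b in unitCube (Fin n), ∑' x : (Fin n → ℤ) × (Fin n → ℤ),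
            h (Sum.elim ((fun i => (x.1 i : ℝ)) + κ) ((fun i => (x.2 i : ℝ)) + b) ᵥ* realM γ) := by
          rw [lintegral_tsum]
          intro x
          exact (hhm.comp ((hlin _).comp (measurable_const_add _))).aemeasurable
      _ ≤ ∫⁻ b in unitCube (Fin n), C₂ := by
          refine lintegral_mono fun b => ?_
          refine le_trans ?_ (hsum' (Sum.elim κ b ᵥ* realM γ))
          have hinj : Function.Injective fun x : (Fin n → ℤ) × (Fin n → ℤ) =>
              Sum.elim x.1 x.2 ᵥ* γ.1 := by
            intro x y hxy
            have := congrArg (· ᵥ* (γ⁻¹).1) hxy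
            simp only [Matrix.vecMul_vecMul, ← Submonoid.coe_mul, mul_inv_cancel,
              Submonoid.coe_one, Matrix.vecMul_one] at this
            exact Prod.ext (by simpa using congrArg (· ∘ Sum.inl) this)
              (by simpa using congrArg (· ∘ Sum.inr) this)
          refine le_trans (le_of_eq ?_) (ENNReal.tsum_comp_le_tsum_of_injective hinj fun v =>
            h ((fun i => (v i : ℝ)) + Sum.elim κ b ᵥ* realM γ))
          refine tsum_congr fun x => ?_
          congr 1
          have e : (fun i => (((Sum.elim x.1 x.2 ᵥ* γ.1) i : ℤ) : ℝ)) =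
              (Sum.elim (fun i => (x.1 i : ℝ)) (fun i => (x.2 i : ℝ))) ᵥ* realM γ := by
            funext k
            simp [vecMul, dotProduct, Fintype.sum_sum_type]
          rw [e, ← Matrix.add_vecMul]
          congr 1
          funext s
          rcases s with i | i <;> simp
      _ = C₂ := by simp [volume_unitCube]
  have htotal : ENNReal.ofReal |G.det| * ∑' u : Fin n → ℤ, ENNReal.ofReal
        (((1 + quad (imPart (act γ Z)) ((fun i => (u i : ℝ)) + κ)) ^ τ)⁻¹) ≤
      ENNReal.ofReal (C₁ ^ τ) * C₂ := by
    rw [← ENNReal.tsum_mul_left]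
    calc _ ≤ ∑' u : Fin n → ℤ, ENNReal.ofReal (C₁ ^ τ) *
        ∫⁻ b, h (Sum.elim ((fun i => (u i : ℝ)) + κ) b ᵥ* realM γ) :=
          ENNReal.tsum_le_tsum fun u => hcell _
      _ ≤ _ := by rw [ENNReal.tsum_mul_left]; gcongr
  have hGval : 1 = ENNReal.ofReal s⁻¹ * ENNReal.ofReal ‖(j γ Z).det‖ * ENNReal.ofReal |G.det| := by
    rw [← ENNReal.ofReal_mul (by positivity), ← ENNReal.ofReal_mul (by positivity), mul_assoc,
      mul_comm ‖(j γ Z).det‖, hGs, inv_mul_cancel₀ hs0.ne', ENNReal.ofReal_one]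
  calc ∑' u : Fin n → ℤ, ENNReal.ofReal
        (((1 + quad (imPart (act γ Z)) ((fun i => (u i : ℝ)) + κ)) ^ τ)⁻¹)
      = ENNReal.ofReal s⁻¹ * ENNReal.ofReal ‖(j γ Z).det‖ * (ENNReal.ofReal |G.det| *
        ∑' u : Fin n → ℤ, ENNReal.ofReal
        (((1 + quad (imPart (act γ Z)) ((fun i => (u i : ℝ)) + κ)) ^ τ)⁻¹)) := by
          rw [← mul_assoc, ← hGval, one_mul]
    _ ≤ ENNReal.ofReal s⁻¹ * ENNReal.ofReal ‖(j γ Z).det‖ * (ENNReal.ofReal (C₁ ^ τ) * C₂) := by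
          gcongr
    _ = _ := by ring

/-! ### Convergence of the Siegel Eisenstein series -/

/-- A set of elements of `Γ_n` which meets every coset of `Γ_{n,0} \ Γ_n` at most once. -/
def Separated (R : Set (Gam n)) : Prop := ∀ γ ∈ R, ∀ γ' ∈ R, γ * γ'⁻¹ ∈ Gam0 n → γ = γ'

lemma isComplement_Gam0_iff {R : Set (Gam n)} :
    Subgroup.IsComplement (Gam0 n : Set (Gam n)) R ↔ Covers R ∧ Separated R := by
  rw [Subgroup.isComplement_iff_existsUnique_mul_inv_mem]
  constructor
  · refine fun h => ⟨fun γ => ?_, fun γ hγ γ' hγ' hh => ?_⟩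
    · obtain ⟨t, ht, -⟩ := h γ
      exact ⟨t.1, t.2, ht⟩
    · have := (h γ).unique (y₁ := ⟨γ, hγ⟩) (y₂ := ⟨γ', hγ'⟩)
        (by simp) hh
      exact congrArg Subtype.val this
  · rintro ⟨h1, h2⟩ γ
    obtain ⟨t, ht, htγ⟩ := h1 γ
    refine ⟨⟨t, ht⟩, htγ, fun y hy => Subtype.ext (h2 _ y.2 _ ht ?_)⟩
    have : y.1 * t⁻¹ = (γ * y.1⁻¹)⁻¹ * (γ * t⁻¹) := by group
    rw [this]
    exact mul_mem (inv_mem hy) htγ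

lemma exists_covers_separated (n : ℕ) : ∃ T : Set (Gam n), Covers T ∧ Separated T := by
  obtain ⟨T, hT, -⟩ := Subgroup.exists_isComplement_right (Gam0 n) 1
  exact ⟨T, isComplement_Gam0_iff.1 hT⟩

/-- Completing the square with respect to the first variable. -/
lemma exists_quad_eq {M : Matrix (Fin (n + 1)) (Fin (n + 1)) ℝ} (hM : M.PosDef) :
    ∃ κ : Fin n → ℝ, ∀ p : Fin (n + 1) → ℝ, quad M p =
      quad (lower M) (Fin.tail p + p 0 • κ) + M.det / (lower M).det * p 0 ^ 2 := by
  have hl : (lower M).PosDef := hM.submatrix (Fin.succ_injective _)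
  have hsymm : ∀ i k, M i k = M k i := fun i k => by
    have := congrFun (congrFun hM.isHermitian k) i
    simpa using this
  set κ : Fin n → ℝ := (lower M)⁻¹ *ᵥ (fun i => M i.succ 0) with hκ
  have hκ' : ∀ i : Fin n, ∑ k, M i.succ k.succ * κ k = M i.succ 0 := by
    intro i
    have : lower M *ᵥ κ = fun i => M i.succ 0 := by
      rw [hκ, Matrix.mulVec_mulVec, Matrix.mul_nonsing_inv _ hl.det_pos.ne'.isUnit,
        Matrix.one_mulVec]
    exact congrFun this i
  set β : ℝ := M 0 0 - ∑ k, M 0 k.succ * κ k with hβ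
  -- the vector `x = (1, -κ)` is mapped to a multiple of the first basis vector
  set x : Fin (n + 1) → ℝ := Fin.cons 1 (-κ) with hx
  have hMx : M *ᵥ x = Pi.single 0 β := by
    funext i
    rw [mulVec, dotProduct, Fin.sum_univ_succ]
    refine Fin.cases ?_ (fun i => ?_) i
    · simp [hx, hβ, sub_eq_add_neg]
    · simp [hx, hκ']
  have hdet : M.det = β * (lower M).det := by
    have h1 : M.adjugate *ᵥ (M *ᵥ x) = M.det • x := by
      rw [Matrix.mulVec_mulVec, Matrix.adjugate_mul, Matrix.smul_mulVec, Matrix.one_mulVec]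
    have h2 := congrFun h1 0
    rw [hMx, Matrix.mulVec_single] at h2
    simp only [hx, Pi.smul_apply, Fin.cons_zero, smul_eq_mul, mul_one] at h2
    have h3 : M.adjugate 0 0 = (lower M).det := by
      rw [adjugate_fin_succ_eq_det_submatrix]
      simp [Fin.succAbove_zero, lower]
    rw [← h2]
    simp [h3, mul_comm]
  refine ⟨κ, fun p => ?_⟩
  rw [hdet, mul_div_cancel_right₀ _ hl.det_pos.ne']
  have hp : p = Fin.cons 0 (Fin.tail p + p 0 • κ) + p 0 • x := by
    funext i
    refine Fin.cases ?_ (fun i => ?_) i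
    · simp [hx]
    · simp [hx, Fin.tail]
  set t := Fin.tail p + p 0 • κ
  set w : Fin (n + 1) → ℝ := Fin.cons 0 t with hw
  have hMT : Mᵀ = M := Matrix.ext fun i k => hsymm k i
  have e1 : quad M p = quad M w + 2 * p 0 * (w ⬝ᵥ M *ᵥ x) + p 0 ^ 2 * (x ⬝ᵥ M *ᵥ x) := by
    have hs : x ⬝ᵥ M *ᵥ w = w ⬝ᵥ M *ᵥ x := by
      rw [Matrix.dotProduct_mulVec, ← Matrix.mulVec_transpose, hMT, dotProduct_comm]
    rw [quad]
    conv_lhs => rw [hp]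
    simp only [Matrix.mulVec_add, Matrix.mulVec_smul, add_dotProduct, dotProduct_add,
      smul_dotProduct, dotProduct_smul, smul_eq_mul, hs, quad]
    ring
  have e2 : quad M w = quad (lower M) t := by
    simp [quad, hw, dotProduct, mulVec, Fin.sum_univ_succ]
  have e3 : w ⬝ᵥ M *ᵥ x = 0 := by rw [hMx]; simp [hw]
  have e4 : x ⬝ᵥ M *ᵥ x = β := by rw [hMx]; simp [hx]
  rw [e1, e2, e3, e4]
  ring

/-- The value `Z[p]` of a symmetric complex matrix at an integral vector. -/
def valueAt (Z : Matrix (Fin n) (Fin n) ℂ) (p : Fin n → ℤ) : ℂ :=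
  (fun i => (p i : ℂ)) ⬝ᵥ Z *ᵥ (fun i => (p i : ℂ))

lemma im_valueAt (Z : Matrix (Fin n) (Fin n) ℂ) (p : Fin n → ℤ) :
    (valueAt Z p).im = quad (imPart Z) fun i => (p i : ℝ) := by
  simp [valueAt, quad, dotProduct, mulVec]

lemma tsum_int_inv_sq_ne_top : ∑' g : ℤ, ENNReal.ofReal (((g : ℝ) ^ 2)⁻¹) ≠ ∞ := by
  have h : Summable fun g : ℤ => ((g : ℝ) ^ 2)⁻¹ := by
    simpa using (Real.summable_one_div_int_pow (p := 2)).2 one_lt_two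
  rw [← ENNReal.ofReal_tsum_of_nonneg (fun g => by positivity) h]
  exact ENNReal.ofReal_ne_top

/-- The sum of `|g z + d| ^ (-s-3)` over the integers `d` is `O(g⁻² Im(z) ^ (-s-2))`, for `Im z`
bounded from below. -/
lemma exists_tsum_inv_norm_pow_le {b₀ : ℝ} (hb₀ : 0 < b₀) (s : ℕ) : ∃ C : ℝ, 0 ≤ C ∧
    ∀ (g : ℤ) (z : ℂ), g ≠ 0 → b₀ ≤ z.im →
      ∑' d : ℤ, ENNReal.ofReal ((‖(g : ℂ) * z + d‖ ^ (s + 3))⁻¹) ≤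
        ENNReal.ofReal (C * (((g : ℝ) ^ 2)⁻¹ * (z.im ^ (s + 2))⁻¹)) := by
  obtain ⟨C, hC0, hC⟩ := exists_tsum_inv_sq_add_sq_le hb₀
  refine ⟨C, hC0, fun g z hg hz => ?_⟩
  have hg1 : (1 : ℝ) ≤ |(g : ℝ)| := by
    rw [← Int.cast_abs]; exact_mod_cast Int.one_le_abs hg
  have hz0 : 0 < z.im := hb₀.trans_le hz
  set b := |(g : ℝ)| * z.im with hb
  have hbz : z.im ≤ b := by nlinarith
  have hb0 : 0 < b := hz0.trans_le hbz
  have hsq : ∀ d : ℤ, ‖(g : ℂ) * z + d‖ ^ 2 = (g * z.re + d) ^ 2 + b ^ 2 := by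
    intro d
    rw [Complex.sq_norm, Complex.normSq_apply, hb, mul_pow, sq_abs]
    simp; ring
  have hle : ∀ d : ℤ, b ≤ ‖(g : ℂ) * z + d‖ := by
    intro d
    apply le_of_sq_le_sq _ (norm_nonneg _)
    rw [hsq]; nlinarith [sq_nonneg (g * z.re + d)]
  calc ∑' d : ℤ, ENNReal.ofReal ((‖(g : ℂ) * z + d‖ ^ (s + 3))⁻¹)
      ≤ ∑' d : ℤ, ENNReal.ofReal ((b ^ (s + 1))⁻¹) *
          ENNReal.ofReal (((g * z.re + d) ^ 2 + b ^ 2)⁻¹) := by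
        refine ENNReal.tsum_le_tsum fun d => ?_
        rw [← ENNReal.ofReal_mul (by positivity)]
        apply ENNReal.ofReal_le_ofReal
        rw [← hsq, ← mul_inv, show s + 3 = s + 1 + 2 by ring, pow_add]
        have := hle d
        have h0 : 0 < ‖(g : ℂ) * z + d‖ := hb0.trans_le this
        gcongr
    _ ≤ ENNReal.ofReal ((b ^ (s + 1))⁻¹) * ENNReal.ofReal (C * b⁻¹) := by
        rw [ENNReal.tsum_mul_left]
        gcongr
        exact hC _ _ (hz.trans hbz)
    _ = ENNReal.ofReal (C * (b ^ (s + 2))⁻¹) := by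
        rw [← ENNReal.ofReal_mul (by positivity), pow_succ b (s + 1), mul_inv]
        congr 1; ring
    _ ≤ _ := by
        apply ENNReal.ofReal_le_ofReal
        gcongr
        rw [← mul_inv, hb, mul_pow]
        have h1 : (g : ℝ) ^ 2 ≤ |(g : ℝ)| ^ (s + 2) := by
          rw [← sq_abs]
          exact pow_le_pow_right₀ hg1 (by omega)
        have h2 : 0 < (g : ℝ) ^ 2 := by positivity
        gcongr

/-- The coefficient of the first variable, after completing the square, is the same for all
`t ∈ Γ_n`. -/
lemma det_im_act_incl (t : Gam n) {Z : Matrix (Fin (n + 1)) (Fin (n + 1)) ℂ}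
    (hZ : Z ∈ upperHalf (n + 1)) :
    (imPart (act (incl t) Z)).det / (lower (imPart (act (incl t) Z))).det =
      (imPart Z).det / (imPart (lower Z)).det := by
  have h1 := det_im_act (incl t) hZ
  have h2 := det_im_act t (lower_mem hZ)
  rw [← lower_act_incl t hZ] at h2
  have e : lower (imPart (act (incl t) Z)) = imPart (lower (act (incl t) Z)) := rfl
  have h0 := det_j_ne_zero t (lower_mem hZ)
  rw [det_j_incl] at h1
  rw [e, ← h1, ← h2, mul_div_mul_left _ _ (by positivity)]

/-- The sum over all cosets with a given component in `Γ_{n,0} \ Γ_n` is bounded by a multiple of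
the automorphic factor of that component. -/
lemma exists_tsum_fibre_le {Z : Matrix (Fin (n + 1)) (Fin (n + 1)) ℂ}
    (hZ : Z ∈ upperHalf (n + 1)) {s : ℕ} (hs : n ≤ s) : ∃ C : ℝ≥0∞, C ≠ ∞ ∧ ∀ t : Gam n,
      ∑' g : ℤ, ∑' p : Fin (n + 1) → ℤ, ∑' d : ℤ,
        (if g ≠ 0 ∧ p 0 ≠ 0 then
          ENNReal.ofReal ((‖(g : ℂ) * valueAt (act (incl t) Z) p + d‖ ^ (s + 3))⁻¹) else 0) ≤
        C * ENNReal.ofReal ‖(j t (lower Z)).det‖ := by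
  have hl := lower_mem hZ
  set β : ℝ := (imPart Z).det / (imPart (lower Z)).det with hβ
  have hβ0 : 0 < β := div_pos hZ.2.det_pos hl.2.det_pos
  obtain ⟨C₁, hC₁0, hC₁⟩ := exists_tsum_inv_norm_pow_le hβ0 s
  obtain ⟨C₂, hC₂, hC₂'⟩ := exists_tsum_inv_one_add_quad_pow_le hl (Nat.lt_succ_of_le hs)
  set c : ℝ := (1 + β⁻¹) ^ (s + 1) with hc
  have hc0 : 0 < c := by positivity
  set ζ₂ := ∑' g : ℤ, ENNReal.ofReal (((g : ℝ) ^ 2)⁻¹) with hζ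
  refine ⟨ENNReal.ofReal (C₁ * β⁻¹ * c) * ζ₂ * ζ₂ * C₂, ?_, fun t => ?_⟩
  · exact ENNReal.mul_ne_top (ENNReal.mul_ne_top (ENNReal.mul_ne_top ENNReal.ofReal_ne_top
      tsum_int_inv_sq_ne_top) tsum_int_inv_sq_ne_top) hC₂
  have hM := (act_mem (incl t) hZ).2
  obtain ⟨κ, hκ⟩ := exists_quad_eq hM
  rw [det_im_act_incl t hZ, ← hβ] at hκ
  have hlow : lower (imPart (act (incl t) Z)) = imPart (act t (lower Z)) := by
    rw [← lower_act_incl t hZ]; rfl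
  rw [hlow] at hκ
  set Y' := imPart (act t (lower Z)) with hY'
  have hY'pos : Y'.PosDef := (act_mem t hl).2
  let q : (Fin n → ℤ) → ℤ → ℝ := fun p' p₀ => quad Y' ((fun i => (p' i : ℝ)) + (p₀ : ℝ) • κ)
  have hq0 : ∀ p' p₀, 0 ≤ q p' p₀ := fun p' p₀ => quad_nonneg hY'pos _
  have him : ∀ p : Fin (n + 1) → ℤ, (valueAt (act (incl t) Z) p).im =
      q (Fin.tail p) (p 0) + β * (p 0 : ℝ) ^ 2 := by
    intro p
    rw [im_valueAt, hκ]
    rfl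
  -- the sum over `d`, followed by an estimate of the imaginary part from below
  have key : ∀ (g : ℤ) (p : Fin (n + 1) → ℤ), ∑' d : ℤ,
        (if g ≠ 0 ∧ p 0 ≠ 0 then
          ENNReal.ofReal ((‖(g : ℂ) * valueAt (act (incl t) Z) p + d‖ ^ (s + 3))⁻¹) else 0) ≤
      ENNReal.ofReal (((g : ℝ) ^ 2)⁻¹) * (ENNReal.ofReal (((p 0 : ℝ) ^ 2)⁻¹) *
        (ENNReal.ofReal (C₁ * β⁻¹ * c) *
          ENNReal.ofReal (((1 + q (Fin.tail p) (p 0)) ^ (s + 1))⁻¹))) := by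
    intro g p
    split_ifs with h
    · have hp1 : (1 : ℝ) ≤ (p 0 : ℝ) ^ 2 := by
        have : (1 : ℤ) ≤ p 0 ^ 2 := by have := sq_pos_of_ne_zero h.2; omega
        exact_mod_cast this
      have hy := him p
      set y := (valueAt (act (incl t) Z) p).im
      have hqp := hq0 (Fin.tail p) (p 0)
      have hyβ : β ≤ y := by rw [hy]; nlinarith
      refine (hC₁ g _ h.1 hyβ).trans ?_
      rw [← ENNReal.ofReal_mul (by positivity), ← ENNReal.ofReal_mul (by positivity),
        ← ENNReal.ofReal_mul (by positivity)]
      apply ENNReal.ofReal_le_ofReal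
      have hy0 : 0 < y := hβ0.trans_le hyβ
      have e1 : (y ^ (s + 2))⁻¹ ≤ (β * (p 0 : ℝ) ^ 2)⁻¹ * (c * ((1 + q (Fin.tail p) (p 0)) ^ (s + 1))⁻¹) := by
        rw [pow_succ, mul_inv, mul_comm]
        have a1 : β * (p 0 : ℝ) ^ 2 ≤ y := by rw [hy]; linarith
        have a2 : 1 + q (Fin.tail p) (p 0) ≤ (1 + β⁻¹) * y := by
          have : 1 ≤ β⁻¹ * y := by
            rw [inv_mul_eq_div, le_div_iff₀ hβ0]; linarith
          have : q (Fin.tail p) (p 0) ≤ y := by rw [hy]; nlinarith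
          linarith
        have a3 : (1 + q (Fin.tail p) (p 0)) ^ (s + 1) ≤ c * y ^ (s + 1) := by
          rw [hc, ← mul_pow]; gcongr
        have a4 : 0 < β * (p 0 : ℝ) ^ 2 := by positivity
        have a5 : (y ^ (s + 1))⁻¹ ≤ c * ((1 + q (Fin.tail p) (p 0)) ^ (s + 1))⁻¹ := by
          rw [← div_eq_mul_inv, inv_eq_one_div, div_le_div_iff₀ (by positivity) (by positivity),
            one_mul]
          exact a3
        gcongr
      calc C₁ * (((g : ℝ) ^ 2)⁻¹ * (y ^ (s + 2))⁻¹)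
          ≤ C₁ * (((g : ℝ) ^ 2)⁻¹ *
            ((β * (p 0 : ℝ) ^ 2)⁻¹ * (c * ((1 + q (Fin.tail p) (p 0)) ^ (s + 1))⁻¹))) := by gcongr
        _ = _ := by rw [mul_inv]; ring
    · simp
  have hsum : ∀ p₀ : ℤ, ∑' p' : Fin n → ℤ, ENNReal.ofReal (((1 + q p' p₀) ^ (s + 1))⁻¹) ≤
      C₂ * ENNReal.ofReal ‖(j t (lower Z)).det‖ := fun p₀ => hC₂' t _
  calc _ ≤ ∑' g : ℤ, ∑' p : Fin (n + 1) → ℤ, ENNReal.ofReal (((g : ℝ) ^ 2)⁻¹) *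
        (ENNReal.ofReal (((p 0 : ℝ) ^ 2)⁻¹) * (ENNReal.ofReal (C₁ * β⁻¹ * c) *
          ENNReal.ofReal (((1 + q (Fin.tail p) (p 0)) ^ (s + 1))⁻¹))) :=
        ENNReal.tsum_le_tsum fun g => ENNReal.tsum_le_tsum fun p => key g p
    _ = ζ₂ * ∑' p : Fin (n + 1) → ℤ,
        (ENNReal.ofReal (((p 0 : ℝ) ^ 2)⁻¹) * (ENNReal.ofReal (C₁ * β⁻¹ * c) *
          ENNReal.ofReal (((1 + q (Fin.tail p) (p 0)) ^ (s + 1))⁻¹))) := by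
        simp_rw [ENNReal.tsum_mul_left]
        rw [ENNReal.tsum_mul_right]
    _ = ζ₂ * ∑' p₀ : ℤ, ∑' p' : Fin n → ℤ,
        (ENNReal.ofReal (((p₀ : ℝ) ^ 2)⁻¹) * (ENNReal.ofReal (C₁ * β⁻¹ * c) *
          ENNReal.ofReal (((1 + q p' p₀) ^ (s + 1))⁻¹))) := by
        rw [← (Fin.consEquiv fun _ => ℤ).tsum_eq, ENNReal.tsum_prod']
        rfl
    _ ≤ ζ₂ * ∑' p₀ : ℤ, (ENNReal.ofReal (((p₀ : ℝ) ^ 2)⁻¹) * (ENNReal.ofReal (C₁ * β⁻¹ * c) *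
          (C₂ * ENNReal.ofReal ‖(j t (lower Z)).det‖))) := by
        simp_rw [ENNReal.tsum_mul_left]
        gcongr
        exact hsum _
    _ = _ := by
        rw [ENNReal.tsum_mul_right, ← hζ]
        ring

/-- The Siegel Eisenstein series of degree `n` and weight `s > n + 1` converges absolutely. The
proof is by induction on the degree: the cosets are distributed over those of degree `n - 1`, and
the sum over each fibre costs one power of the automorphic factor. -/
theorem tsum_inv_norm_det_j_pow_ne_top : ∀ {n s : ℕ}, n + 1 < s →
    ∀ {Z : Matrix (Fin n) (Fin n) ℂ}, Z ∈ upperHalf n → ∀ {R : Set (Gam n)}, Separated R →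
      ∑' γ : R, ENNReal.ofReal ((‖(j γ.1 Z).det‖ ^ s)⁻¹) ≠ ∞
  | 0, s, _, Z, _, R, _ => by
    have : Subsingleton (Gam 0) := ⟨fun a b => Subtype.ext (Subsingleton.elim _ _)⟩
    have : Fintype R := Fintype.ofFinite R
    rw [tsum_fintype]
    exact ENNReal.sum_ne_top.2 fun _ _ => ENNReal.ofReal_ne_top
  | n + 1, s, hs, Z, hZ, R, hR => by
    obtain ⟨s, rfl⟩ : ∃ r, s = r + 3 := ⟨s - 3, by omega⟩
    obtain ⟨T, hT, hTs⟩ := exists_covers_separated n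
    have hl := lower_mem hZ
    obtain ⟨C, hC, hfib⟩ := exists_tsum_fibre_le hZ (s := s) (by omega)
    set a : Gam n → ℝ := fun t => ‖(j t (lower Z)).det‖ with ha
    have ha0 : ∀ t, 0 < a t := fun t => norm_pos_iff.2 (det_j_ne_zero t hl)
    -- `R₁` consists of the cosets which come from degree `n`, and `R₂` of the others
    let R₁ : Set (Gam (n + 1)) := {γ | γ ∈ R ∧ ∃ t : T, γ * (incl t.1)⁻¹ ∈ Gam0 (n + 1)}
    let R₂ : Set (Gam (n + 1)) := {γ | γ ∈ R ∧ ∃ t : T, ∃ δ ∈ Gam0 (n + 1),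
      ∃ γ' : Gam (n + 1), γ = δ * γ' * incl t.1 ∧
        (∀ i : Fin n, ∀ k, γ'.1.toBlocks₂₁ i.succ k = 0) ∧ γ'.1.toBlocks₂₁ 0 0 ≠ 0}
    have hR12 : R ⊆ R₁ ∪ R₂ := by
      intro γ hγ
      obtain ⟨t, ht, h | h⟩ := hT.exists_decomposition γ
      · exact Or.inl ⟨hγ, ⟨t, ht⟩, h⟩
      · exact Or.inr ⟨hγ, ⟨t, ht⟩, h⟩
    have h1 : ∑' γ : R₁, ENNReal.ofReal ((‖(j γ.1 Z).det‖ ^ (s + 3))⁻¹) ≠ ∞ := by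
      have ih := tsum_inv_norm_det_j_pow_ne_top (s := s + 3) (by omega) hl hTs
      choose f hf using fun γ : R₁ => γ.2.2
      have hinj : Function.Injective f := by
        intro x y hxy
        apply Subtype.ext
        apply hR _ x.2.1 _ y.2.1
        have e : x.1 * y.1⁻¹ = (x.1 * (incl (f x).1)⁻¹) * (y.1 * (incl (f y).1)⁻¹)⁻¹ := by
          rw [hxy]; group
        rw [e]
        exact mul_mem (hf x) (inv_mem (hf y))
      have hval : ∀ γ : R₁, ‖(j γ.1 Z).det‖ = a (f γ) := by
        intro γ
        have e : γ.1 = (γ.1 * (incl (f γ).1)⁻¹) * incl (f γ).1 := by group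
        rw [e, j_mul _ _ hZ, det_mul, norm_mul, norm_det_j_of_mem_Gam0 (hf γ), one_mul, det_j_incl]
      simp_rw [hval]
      exact ne_top_of_le_ne_top ih (ENNReal.tsum_comp_le_tsum_of_injective hinj
        fun t : T => ENNReal.ofReal ((a t ^ (s + 3))⁻¹))
    have h2 : ∑' γ : R₂, ENNReal.ofReal ((‖(j γ.1 Z).det‖ ^ (s + 3))⁻¹) ≠ ∞ := by
      have ih := tsum_inv_norm_det_j_pow_ne_top (s := s + 2) (by omega) hl hTs
      choose f δ hδ γ' heq hrow h00 using fun γ : R₂ => γ.2.2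
      choose g d p hg hp hgp hd hdet using fun γ : R₂ =>
        exists_det_j_of_rank_one (γ' γ) (hrow γ) (h00 γ)
      let F : R₂ → T × ℤ × (Fin (n + 1) → ℤ) × ℤ := fun γ => (f γ, g γ, p γ, d γ)
      have hinj : Function.Injective F := by
        intro x y hxy
        simp only [F, Prod.mk.injEq] at hxy
        obtain ⟨h1, h2, h3, h4⟩ := hxy
        apply Subtype.ext
        apply hR _ x.2.1 _ y.2.1
        have e : x.1 * y.1⁻¹ = δ x * (γ' x * (γ' y)⁻¹) * (δ y)⁻¹ := by
          rw [heq x, heq y, h1]; group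
        rw [e]
        refine mul_mem (mul_mem (hδ x) ?_) (inv_mem (hδ y))
        exact mul_inv_mem_Gam0_of_rank_one (hrow x) (hrow y) (hg x) (hgp x)
          (by rw [h2, h3]; exact hgp y) (hd x) (by rw [h3, h4]; exact hd y)
      let W : T → ℤ → (Fin (n + 1) → ℤ) → ℤ → ℝ≥0∞ := fun t g p d =>
        if g ≠ 0 ∧ p 0 ≠ 0 then
          ENNReal.ofReal ((‖(g : ℂ) * valueAt (act (incl t.1) Z) p + d‖ ^ (s + 3))⁻¹) else 0
      have hval : ∀ γ : R₂, ENNReal.ofReal ((‖(j γ.1 Z).det‖ ^ (s + 3))⁻¹) =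
          ENNReal.ofReal ((a (F γ).1 ^ (s + 3))⁻¹) *
            W (F γ).1 (F γ).2.1 (F γ).2.2.1 (F γ).2.2.2 := by
        intro γ
        have e : ‖(j γ.1 Z).det‖ = ‖(g γ : ℂ) * valueAt (act (incl (f γ).1) Z) (p γ) + d γ‖ *
            a (f γ) := by
          rw [heq γ, j_mul _ _ hZ, j_mul _ _ (act_mem _ hZ), det_mul, det_mul, norm_mul, norm_mul,
            norm_det_j_of_mem_Gam0 (hδ γ), one_mul, det_j_incl, hdet]
          rfl
        simp only [F, W]
        rw [if_pos ⟨hg γ, hp γ⟩, ← ENNReal.ofReal_mul (by positivity), e, mul_pow, mul_inv,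
          mul_comm]
      simp_rw [hval]
      refine ne_top_of_le_ne_top ?_ (ENNReal.tsum_comp_le_tsum_of_injective hinj fun x =>
        ENNReal.ofReal ((a x.1 ^ (s + 3))⁻¹) * W x.1 x.2.1 x.2.2.1 x.2.2.2)
      simp_rw [ENNReal.tsum_prod', ENNReal.tsum_mul_left]
      refine ne_top_of_le_ne_top (ENNReal.mul_ne_top hC ih) ?_
      rw [← ENNReal.tsum_mul_left]
      refine ENNReal.tsum_le_tsum fun t => ?_
      calc _ ≤ ENNReal.ofReal ((a t ^ (s + 3))⁻¹) * (C * ENNReal.ofReal (a t)) := by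
            gcongr
            exact hfib t.1
        _ = C * (ENNReal.ofReal ((a t ^ (s + 3))⁻¹) * ENNReal.ofReal (a t)) := by ring
        _ = C * ENNReal.ofReal ((a t ^ (s + 2))⁻¹) := by
            rw [← ENNReal.ofReal_mul (by have := ha0 t; positivity), pow_succ (a t) (s + 2),
              mul_inv, mul_assoc, inv_mul_cancel₀ (ha0 t).ne', mul_one]
    have hle : ∑' γ : R, ENNReal.ofReal ((‖(j γ.1 Z).det‖ ^ (s + 3))⁻¹) ≤
        ∑' γ : R₁, ENNReal.ofReal ((‖(j γ.1 Z).det‖ ^ (s + 3))⁻¹) +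
          ∑' γ : R₂, ENNReal.ofReal ((‖(j γ.1 Z).det‖ ^ (s + 3))⁻¹) :=
      (ENNReal.tsum_mono_subtype (fun γ : Gam (n + 1) =>
        ENNReal.ofReal ((‖(j γ Z).det‖ ^ (s + 3))⁻¹)) hR12).trans
        (ENNReal.tsum_union_le (fun γ : Gam (n + 1) =>
          ENNReal.ofReal ((‖(j γ Z).det‖ ^ (s + 3))⁻¹)) R₁ R₂)
    exact ne_top_of_le_ne_top (ENNReal.add_ne_top.2 ⟨h1, h2⟩) hle

/-! ### Majorants for the Jacobi–Eisenstein series -/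

/-- All entries of the matrix are bounded by `r`. -/
def EntryLE {a b : ℕ} (M : Matrix (Fin a) (Fin b) ℂ) (r : ℝ) : Prop := ∀ i k, ‖M i k‖ ≤ r

lemma EntryLE.mul {a b c : ℕ} {M : Matrix (Fin a) (Fin b) ℂ} {N : Matrix (Fin b) (Fin c) ℂ}
    {r s : ℝ} (hr : 0 ≤ r) (hM : EntryLE M r) (hN : EntryLE N s) : EntryLE (M * N) (b * r * s) := by
  intro i k
  rw [Matrix.mul_apply]
  have : ∀ l ∈ Finset.univ, ‖M i l * N l k‖ ≤ r * s := fun l _ => by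
    rw [norm_mul]
    exact mul_le_mul (hM i l) (hN l k) (norm_nonneg _) hr
  refine (norm_sum_le _ _).trans ((Finset.sum_le_card_nsmul _ _ _ this).trans (le_of_eq ?_))
  simp; ring

lemma EntryLE.trace {a : ℕ} {M : Matrix (Fin a) (Fin a) ℂ} {r : ℝ} (hM : EntryLE M r) :
    ‖M.trace‖ ≤ a * r := by
  rw [Matrix.trace]
  refine (norm_sum_le _ _).trans ((Finset.sum_le_card_nsmul _ _ r fun i _ => hM i i).trans
    (le_of_eq ?_))
  simp

lemma EntryLE.transpose {a b : ℕ} {M : Matrix (Fin a) (Fin b) ℂ} {r : ℝ} (hM : EntryLE M r) :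
    EntryLE Mᵀ r := fun i k => hM k i

lemma EntryLE.conjM {a b : ℕ} {M : Matrix (Fin a) (Fin b) ℂ} {r : ℝ} (hM : EntryLE M r) :
    EntryLE (conjM M) r := fun i k => by simpa using hM i k

lemma EntryLE.sub {a b : ℕ} {M N : Matrix (Fin a) (Fin b) ℂ} {r s : ℝ} (hM : EntryLE M r)
    (hN : EntryLE N s) : EntryLE (M - N) (r + s) := fun i k =>
  (norm_sub_le _ _).trans (add_le_add (hM i k) (hN i k))

lemma exists_entryLE {a b : ℕ} (M : Matrix (Fin a) (Fin b) ℂ) : ∃ r, 0 ≤ r ∧ EntryLE M r := by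
  refine ⟨∑ i, ∑ k, ‖M i k‖, by positivity, fun i k => ?_⟩
  exact (Finset.single_le_sum (f := fun k => ‖M i k‖) (fun _ _ => norm_nonneg _)
    (Finset.mem_univ k)).trans (Finset.single_le_sum (f := fun i => ∑ k, ‖M i k‖)
      (fun _ _ => Finset.sum_nonneg fun _ _ => norm_nonneg _) (Finset.mem_univ i))

/-- In frame coordinates, `j(γ, Z)⁻¹` and `j(γ, Z)⁻¹ C` are bounded independently of `γ`. -/
lemma exists_frame_bounds {Z : Matrix (Fin n) (Fin n) ℂ} (hZ : Z ∈ upperHalf n) :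
    ∃ B : ℝ, 0 ≤ B ∧ ∀ (γ : Gam n) (G : Matrix (Fin n) (Fin n) ℝ), IsFrame γ Z G →
      EntryLE ((j γ Z)⁻¹ * blockC γ) B ∧
      ∃ N : Matrix (Fin n) (Fin n) ℂ, (j γ Z)⁻¹ = N * ofReal G ∧ EntryLE N B := by
  set Y := imPart Z with hY
  set b : ℝ := ∑ k, √(Y k k) with hb
  have hb0 : 0 ≤ b := Finset.sum_nonneg fun k _ => Real.sqrt_nonneg _
  obtain ⟨y, hy0, hy⟩ := exists_entryLE (ofReal Y⁻¹)
  have hYY : ofReal Y * ofReal Y⁻¹ = 1 := by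
    rw [← ofReal_mul, Matrix.mul_nonsing_inv _ hZ.2.det_pos.ne'.isUnit]
    ext i k; by_cases h : i = k <;> simp [ofReal, Matrix.one_apply, h]
  have h2I : (2 * Complex.I : ℂ) ≠ 0 := by simp
  refine ⟨n * b * y + n * (n * b * y) * (n * (b + b) * y), by positivity, fun γ G hG => ?_⟩
  set K := ofReal G * j γ Z with hK
  have hKb : EntryLE K b := fun i k =>
    (Real.le_sqrt_of_sq_le (hG.norm_apply_sq_le hZ i k)).trans
      (Finset.single_le_sum (f := fun k => √(Y k k)) (fun l _ => Real.sqrt_nonneg _)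
        (Finset.mem_univ k))
  set N := (conjM K * ofReal Y⁻¹)ᵀ with hN
  have hNb : EntryLE N (n * b * y) := (hKb.conjM.mul hb0 hy).transpose
  have hNK : N * K = 1 := by
    have : Kᵀ * (conjM K * ofReal Y⁻¹) = 1 := by
      rw [← Matrix.mul_assoc, hG.transpose_mul_conjM hZ, hYY]
    have := congrArg transpose this
    rwa [transpose_mul, transpose_transpose, transpose_one] at this
  have hinv : (j γ Z)⁻¹ = N * ofReal G :=
    Matrix.inv_eq_left_inv (by rw [Matrix.mul_assoc, ← hK, hNK])
  have hGC : ofReal G * blockC γ = (2 * Complex.I)⁻¹ • ((K - conjM K) * ofReal Y⁻¹) := by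
    have e : j γ Z - conjM (j γ Z) = (2 * Complex.I) • (blockC γ * ofReal Y) := by
      have cC : conjM (blockC γ) = blockC γ := conjM_intCast _
      have cD : conjM (blockD γ) = blockD γ := conjM_intCast _
      rw [j, conjM_add, conjM_mul, cC, cD, add_sub_add_right_eq_sub, ← Matrix.mul_sub, sub_conjM,
        Matrix.mul_smul]
    have e2 : K - conjM K = (2 * Complex.I) • (ofReal G * blockC γ * ofReal Y) := by
      rw [hK, conjM_mul, conjM_ofReal, ← Matrix.mul_sub, e, Matrix.mul_smul, Matrix.mul_assoc]
    rw [e2, Matrix.smul_mul, smul_smul, inv_mul_cancel₀ h2I, one_smul, Matrix.mul_assoc, hYY,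
      Matrix.mul_one]
  have hGCb : EntryLE (ofReal G * blockC γ) (n * (b + b) * y) := by
    have h := (hKb.sub hKb.conjM).mul (by positivity) hy
    intro i k
    rw [hGC, Matrix.smul_apply, norm_smul, norm_inv]
    refine le_trans ?_ (h i k)
    refine mul_le_of_le_one_left (norm_nonneg _) ?_
    rw [norm_mul, Complex.norm_I]
    norm_num
  have h0 : 0 ≤ n * (n * b * y) * (n * (b + b) * y) := by positivity
  have h1 : 0 ≤ n * b * y := by positivity
  refine ⟨?_, N, hinv, fun i k => (hNb i k).trans (by linarith)⟩
  rw [hinv, Matrix.mul_assoc]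
  exact fun i k => ((hNb.mul h1 hGCb) i k).trans (by linarith)

/-- A positive definite quadratic form is bounded from below by a multiple of the standard one. -/
lemma exists_mul_sum_sq_le_quad {S : Matrix (Fin m) (Fin m) ℝ} (hS : S.PosDef) :
    ∃ ε : ℝ, 0 < ε ∧ ∀ x : Fin m → ℝ, ε * ∑ i, x i ^ 2 ≤ quad S x := by
  obtain ⟨H, hH⟩ := exists_eq_transpose_mul_self hS
  have hker : LinearMap.ker (Matrix.mulVecLin H) = ⊥ := by
    rw [LinearMap.ker_eq_bot']
    intro x hx
    by_contra h
    have := hS.dotProduct_mulVec_pos h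
    rw [hH, ← Matrix.mulVec_mulVec] at this
    rw [Matrix.mulVecLin_apply] at hx
    rw [hx] at this
    simp at this
  obtain ⟨κ, hκ0, hκ⟩ := (Matrix.mulVecLin H).exists_antilipschitzWith hker
  have hκ0' : (0 : ℝ) < κ := hκ0
  have key : ∀ x : Fin m → ℝ, ∑ i, x i ^ 2 ≤ (m * κ ^ 2 + 1) * quad S x := by
    intro x
    have h1 := hκ.le_mul_dist x 0
    rw [map_zero, dist_zero_right, dist_zero_right, Matrix.mulVecLin_apply] at h1
    have h2 : ‖H *ᵥ x‖ ^ 2 ≤ quad S x := by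
      rw [hH, quad_transpose_mul_self]
      have : ‖H *ᵥ x‖ ≤ √(∑ i, (H *ᵥ x) i ^ 2) := by
        rw [pi_norm_le_iff_of_nonneg (Real.sqrt_nonneg _)]
        intro i
        rw [Real.norm_eq_abs]
        apply Real.abs_le_sqrt
        exact Finset.single_le_sum (f := fun i => (H *ᵥ x) i ^ 2) (fun l _ => sq_nonneg _)
          (Finset.mem_univ i)
      calc _ ≤ √(∑ i, (H *ᵥ x) i ^ 2) ^ 2 := by gcongr
        _ = _ := Real.sq_sqrt (Finset.sum_nonneg fun i _ => sq_nonneg _)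
    calc ∑ i, x i ^ 2 ≤ ∑ _i : Fin m, (κ * ‖H *ᵥ x‖) ^ 2 := by
          refine Finset.sum_le_sum fun i _ => ?_
          rw [← sq_abs]
          have := (norm_le_pi_norm x i).trans h1
          rw [Real.norm_eq_abs] at this
          gcongr
      _ = m * κ ^ 2 * ‖H *ᵥ x‖ ^ 2 := by simp; ring
      _ ≤ m * κ ^ 2 * quad S x := by gcongr
      _ ≤ _ := by
          have := quad_nonneg hS x
          linarith
  have hpos : (0 : ℝ) < m * κ ^ 2 + 1 := by positivity
  exact ⟨(m * κ ^ 2 + 1)⁻¹, by positivity, fun x => by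
    rw [inv_mul_le_iff₀ hpos]; exact key x⟩

/-- The value of the quadratic form `Im(γ⟨Z⟩)` on the rows of an integral matrix. -/
def rowQuad (γ : Gam n) (Z : Matrix (Fin n) (Fin n) ℂ) (l : Matrix (Fin m) (Fin n) ℤ) : ℝ :=
  ∑ p, quad (imPart (act γ Z)) fun i => (l p i : ℝ)

lemma IsFrame.rowQuad_eq {γ : Gam n} {Z : Matrix (Fin n) (Fin n) ℂ}
    {G : Matrix (Fin n) (Fin n) ℝ} (hG : IsFrame γ Z G) (l : Matrix (Fin m) (Fin n) ℤ) :
    rowQuad γ Z l = ∑ p, ∑ i, (l.map (Int.cast : ℤ → ℝ) * Gᵀ) p i ^ 2 := by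
  rw [rowQuad]
  refine Finset.sum_congr rfl fun p _ => ?_
  rw [hG, quad_transpose_mul_self]
  refine Finset.sum_congr rfl fun i _ => ?_
  simp [Matrix.mul_apply, mulVec, dotProduct, mul_comm]

lemma trace_mul_mul_transpose {S : Matrix (Fin m) (Fin m) ℝ} (X : Matrix (Fin m) (Fin n) ℝ) :
    (S * X * Xᵀ).trace = ∑ i, quad S fun p => X p i := by
  simp only [Matrix.trace, diag_apply, Matrix.mul_apply, quad, dotProduct, mulVec, transpose_apply]
  rw [Finset.sum_comm]
  refine Finset.sum_congr rfl fun i _ => Finset.sum_congr rfl fun p _ => ?_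
  rw [mul_comm]

lemma ofReal_intCast (l : Matrix (Fin m) (Fin n) ℤ) : ofInt l = ofReal (l.map Int.cast) := by
  ext; simp [ofInt, ofReal]

lemma im_trace_act (S : Matrix (Fin m) (Fin m) ℝ) (l : Matrix (Fin m) (Fin n) ℤ)
    (X : Matrix (Fin n) (Fin n) ℂ) : (ofReal S * (ofInt l * X * (ofInt l)ᵀ)).trace.im =
      (S * (l.map (Int.cast : ℤ → ℝ) * imPart X * (l.map (Int.cast : ℤ → ℝ))ᵀ)).trace := by
  simp [Matrix.trace, Matrix.mul_apply, ofReal, ofInt, Finset.mul_sum, Finset.sum_mul]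

/-- A bound for the terms of the Jacobi–Eisenstein series, locally uniform in `W`. -/
theorem exists_norm_eisensteinTerm_le (k : ℕ) {S : Matrix (Fin m) (Fin m) ℝ} (hS : S.PosDef)
    {Z : Matrix (Fin n) (Fin n) ℂ} (hZ : Z ∈ upperHalf n) : ∃ c A : ℝ, 0 < c ∧
      ∀ (γ : Gam n) (l : Matrix (Fin m) (Fin n) ℤ) (W : Matrix (Fin m) (Fin n) ℂ) (r : ℝ),
        0 ≤ r → EntryLE W r → ‖eisensteinTerm k S γ l Z W‖ ≤
          Real.exp (A * r ^ 2) * ((‖(j γ Z).det‖ ^ k)⁻¹ * Real.exp (-(c * rowQuad γ Z l))) := by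
  obtain ⟨B, hB0, hB⟩ := exists_frame_bounds hZ
  obtain ⟨ε, hε0, hε⟩ := exists_mul_sum_sq_le_quad hS
  obtain ⟨σ, hσ0, hσ⟩ := exists_entryLE (ofReal S)
  have hπ := Real.pi_pos
  -- the exponents are at most `A₁ r²` and `- 2 π ε F² + A₂ r F`, where `F² = rowQuad γ Z l`
  set A₁ : ℝ := 2 * Real.pi * (m * (n * (n * (m * σ * 1) * B) * 1)) with hA₁
  set A₂ : ℝ := 4 * Real.pi * (m * (n * (n * (m * σ * 1) * B) * 1)) with hA₂
  refine ⟨Real.pi * ε, A₁ + A₂ ^ 2 / (4 * (Real.pi * ε)), by positivity,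
    fun γ l W r hr hW => ?_⟩
  obtain ⟨G, hG⟩ := exists_isFrame γ hZ
  obtain ⟨hV, N, hN, hNb⟩ := hB γ G hG
  set F : ℝ := √(rowQuad γ Z l) with hF
  have hrq0 : 0 ≤ rowQuad γ Z l := by
    rw [hG.rowQuad_eq]
    exact Finset.sum_nonneg fun p _ => Finset.sum_nonneg fun i _ => sq_nonneg _
  have hF0 : 0 ≤ F := Real.sqrt_nonneg _
  have hF2 : F ^ 2 = rowQuad γ Z l := Real.sq_sqrt hrq0
  set X := l.map (Int.cast : ℤ → ℝ) * Gᵀ with hX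
  have hXF : EntryLE (ofReal X) F := by
    intro p i
    have : ‖ofReal X p i‖ = |X p i| := by simp [ofReal]
    rw [this]
    apply Real.abs_le_sqrt
    rw [hG.rowQuad_eq]
    exact (Finset.single_le_sum (f := fun i => X p i ^ 2) (fun _ _ => sq_nonneg _)
      (Finset.mem_univ i)).trans (Finset.single_le_sum (f := fun p => ∑ i, X p i ^ 2)
        (fun _ _ => Finset.sum_nonneg fun _ _ => sq_nonneg _) (Finset.mem_univ p))
  have hre : ∀ z : ℂ, (2 * Real.pi * Complex.I * z).re = -(2 * Real.pi * z.im) := by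
    intro z; simp
  have hi : ∀ z : ℂ, |(2 * Real.pi * Complex.I * z).re| ≤ 2 * Real.pi * ‖z‖ := by
    intro z
    rw [hre, abs_neg, abs_mul, abs_of_pos (by positivity)]
    gcongr
    exact Complex.abs_im_le_norm z
  have b1 : ‖(ofReal S * W * (j γ Z)⁻¹ * blockC γ * W.transpose).trace‖ ≤
      m * (n * (n * (m * σ * r) * B) * r) := by
    rw [Matrix.mul_assoc (ofReal S * W)]
    exact (((hσ.mul hσ0 hW).mul (by positivity) hV).mul (by positivity) hW.transpose).trace
  have b2 : ‖(ofReal S * (ofInt l * (j γ Z)⁻¹.transpose * W.transpose)).trace‖ ≤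
      m * (n * (n * (m * σ * F) * B) * r) := by
    have e : ofReal S * (ofInt l * (j γ Z)⁻¹.transpose * W.transpose) =
        ofReal S * ofReal X * Nᵀ * W.transpose := by
      rw [hN, transpose_mul, hX, ofReal_mul, ofReal_transpose, ofReal_intCast]
      simp only [Matrix.mul_assoc]
    rw [e]
    exact (((hσ.mul hσ0 hXF).mul (by positivity) hNb.transpose).mul (by positivity)
      hW.transpose).trace
  have b3 : ε * F ^ 2 ≤ (ofReal S * (ofInt l * act γ Z * (ofInt l).transpose)).trace.im := by
    rw [im_trace_act, hG, hF2, hG.rowQuad_eq]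
    have e : S * (l.map (Int.cast : ℤ → ℝ) * (Gᵀ * G) * (l.map (Int.cast : ℤ → ℝ))ᵀ) =
        S * X * Xᵀ := by
      rw [hX, transpose_mul, transpose_transpose]
      simp only [Matrix.mul_assoc]
    rw [e, trace_mul_mul_transpose, Finset.sum_comm, Finset.mul_sum]
    exact Finset.sum_le_sum fun i _ => hε _
  have c1 : ‖Complex.exp (-(2 * Real.pi * Complex.I *
      (ofReal S * W * (j γ Z)⁻¹ * blockC γ * W.transpose).trace))‖ ≤ Real.exp (A₁ * r ^ 2) := by
    rw [Complex.norm_exp, Complex.neg_re]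
    apply Real.exp_le_exp.2
    refine (neg_le_abs _).trans ((hi _).trans ?_)
    calc _ ≤ 2 * Real.pi * (m * (n * (n * (m * σ * r) * B) * r)) := by gcongr
      _ = _ := by rw [hA₁]; ring
  have c2 : ‖Complex.exp (2 * Real.pi * Complex.I *
      (ofReal S * (ofInt l * act γ Z * (ofInt l).transpose +
        (2 : ℂ) • (ofInt l * (j γ Z)⁻¹.transpose * W.transpose))).trace)‖ ≤
      Real.exp (-(2 * Real.pi * (ε * F ^ 2)) + A₂ * r * F) := by
    rw [Complex.norm_exp, Matrix.mul_add, Matrix.trace_add, mul_add, Complex.add_re,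
      Matrix.mul_smul, Matrix.trace_smul]
    apply Real.exp_le_exp.2
    refine add_le_add ?_ ?_
    · rw [hre]
      apply neg_le_neg
      gcongr
    · refine (le_abs_self _).trans ((hi _).trans ?_)
      rw [norm_smul]
      calc _ ≤ 2 * Real.pi * (‖(2 : ℂ)‖ * (m * (n * (n * (m * σ * F) * B) * r))) := by gcongr
        _ = _ := by rw [hA₂]; simp; ring
  rw [eisensteinTerm, norm_mul, norm_mul, norm_zpow, _root_.zpow_neg, zpow_natCast]
  calc _ ≤ (‖(j γ Z).det‖ ^ k)⁻¹ * Real.exp (A₁ * r ^ 2) *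
        Real.exp (-(2 * Real.pi * (ε * F ^ 2)) + A₂ * r * F) := by gcongr
    _ = (‖(j γ Z).det‖ ^ k)⁻¹ *
        Real.exp (A₁ * r ^ 2 + (-(2 * Real.pi * (ε * F ^ 2)) + A₂ * r * F)) := by
        rw [mul_assoc, ← Real.exp_add]
    _ ≤ (‖(j γ Z).det‖ ^ k)⁻¹ * Real.exp ((A₁ + A₂ ^ 2 / (4 * (Real.pi * ε))) * r ^ 2 +
          -(Real.pi * ε * F ^ 2)) := by
        refine mul_le_mul_of_nonneg_left (Real.exp_le_exp.2 ?_) (by positivity)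
        -- `A₂ r F ≤ π ε F² + A₂² r² / (4 π ε)`
        have hpe : 0 < Real.pi * ε := by positivity
        have : A₂ * r * F ≤ Real.pi * ε * F ^ 2 + A₂ ^ 2 / (4 * (Real.pi * ε)) * r ^ 2 := by
          have h : 0 ≤ (2 * (Real.pi * ε) * F - A₂ * r) ^ 2 / (4 * (Real.pi * ε)) := by positivity
          have e : (2 * (Real.pi * ε) * F - A₂ * r) ^ 2 / (4 * (Real.pi * ε)) =
              Real.pi * ε * F ^ 2 + A₂ ^ 2 / (4 * (Real.pi * ε)) * r ^ 2 - A₂ * r * F := by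
            field_simp
            ring
          linarith
        linarith
    _ = _ := by rw [Real.exp_add, hF2]; ring

lemma tsum_pi_prod_eq_pow {α : Type*} (f : α → ℝ≥0∞) : ∀ m : ℕ,
    ∑' l : Fin m → α, ∏ p, f (l p) = (∑' a, f a) ^ m
  | 0 => by simp
  | m + 1 => by
    rw [← (Fin.consEquiv fun _ => α).tsum_eq, ENNReal.tsum_prod']
    simp only [Fin.consEquiv_apply, Fin.prod_univ_succ, Fin.cons_zero, Fin.cons_succ]
    simp_rw [ENNReal.tsum_mul_left, tsum_pi_prod_eq_pow f m, ENNReal.tsum_mul_right]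
    rw [pow_succ']

/-- The theta series attached to the form `Im(γ⟨Z⟩)` is bounded by a multiple of
`|det j(γ, Z)| ^ m`. -/
lemma exists_tsum_exp_rowQuad_le {Z : Matrix (Fin n) (Fin n) ℂ} (hZ : Z ∈ upperHalf n) (m : ℕ)
    {c : ℝ} (hc : 0 < c) : ∃ C : ℝ≥0∞, C ≠ ∞ ∧ ∀ γ : Gam n,
      ∑' l : Matrix (Fin m) (Fin n) ℤ, ENNReal.ofReal (Real.exp (-(c * rowQuad γ Z l))) ≤
        C * ENNReal.ofReal (‖(j γ Z).det‖ ^ m) := by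
  obtain ⟨C, hC, hC'⟩ := exists_tsum_inv_one_add_quad_pow_le hZ (Nat.lt_succ_self n)
  set τ := n.succ
  set D : ℝ := Real.exp c * (τ.factorial / c ^ τ) with hD
  have hD0 : 0 ≤ D := by positivity
  refine ⟨(ENNReal.ofReal D * C) ^ m,
    ENNReal.pow_ne_top (ENNReal.mul_ne_top ENNReal.ofReal_ne_top hC), fun γ => ?_⟩
  have hexp : ∀ x : ℝ, 0 ≤ x → Real.exp (-(c * x)) ≤ D * ((1 + x) ^ τ)⁻¹ := by
    intro x hx
    have h1 := Real.pow_div_factorial_le_exp (c * (1 + x)) (by positivity) τ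
    have e : Real.exp (-(c * x)) = Real.exp c * (Real.exp (c * (1 + x)))⁻¹ := by
      rw [← Real.exp_neg, ← Real.exp_add]; congr 1; ring
    rw [e, hD, mul_assoc]
    gcongr
    rw [mul_pow] at h1
    calc (Real.exp (c * (1 + x)))⁻¹ ≤ (c ^ τ * (1 + x) ^ τ / τ.factorial)⁻¹ := by gcongr
      _ = _ := by field_simp
  set f : (Fin n → ℤ) → ℝ≥0∞ := fun u =>
    ENNReal.ofReal (Real.exp (-(c * quad (imPart (act γ Z)) fun i => (u i : ℝ)))) with hf
  have hprod : ∀ l : Matrix (Fin m) (Fin n) ℤ,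
      ENNReal.ofReal (Real.exp (-(c * rowQuad γ Z l))) = ∏ p, f (l p) := by
    intro l
    rw [hf, ← ENNReal.ofReal_prod_of_nonneg (fun _ _ => (Real.exp_pos _).le), ← Real.exp_sum,
      rowQuad, Finset.mul_sum, Finset.sum_neg_distrib]
  have hfs : ∑' u, f u ≤ ENNReal.ofReal D * C * ENNReal.ofReal ‖(j γ Z).det‖ := by
    calc ∑' u, f u ≤ ∑' u : Fin n → ℤ, ENNReal.ofReal D * ENNReal.ofReal
          (((1 + quad (imPart (act γ Z)) ((fun i => (u i : ℝ)) + 0)) ^ τ)⁻¹) := by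
          refine ENNReal.tsum_le_tsum fun u => ?_
          rw [← ENNReal.ofReal_mul hD0, add_zero]
          exact ENNReal.ofReal_le_ofReal (hexp _ (quad_nonneg (act_mem γ hZ).2 _))
      _ ≤ _ := by
          rw [ENNReal.tsum_mul_left, mul_assoc]
          gcongr
          exact hC' γ 0
  simp_rw [hprod]
  calc _ = (∑' u, f u) ^ m := tsum_pi_prod_eq_pow f m
    _ ≤ (ENNReal.ofReal D * C * ENNReal.ofReal ‖(j γ Z).det‖) ^ m := by gcongr
    _ = _ := by rw [mul_pow, ENNReal.ofReal_pow (norm_nonneg _)]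

/-- The majorant of the Jacobi–Eisenstein series is summable. -/
theorem summable_majorant {k : ℕ} (hk : n + m + 1 < k) {Z : Matrix (Fin n) (Fin n) ℂ}
    (hZ : Z ∈ upperHalf n) {R : Set (Gam n)} (hR : Separated R)
    (L : Set (Matrix (Fin m) (Fin n) ℤ)) {c : ℝ} (hc : 0 < c) :
    Summable fun x : R × L =>
      (‖(j x.1.1 Z).det‖ ^ k)⁻¹ * Real.exp (-(c * rowQuad x.1.1 Z x.2.1)) := by
  obtain ⟨C, hC, hC'⟩ := exists_tsum_exp_rowQuad_le hZ m hc
  have hE := tsum_inv_norm_det_j_pow_ne_top (s := k - m) (by omega) hZ hR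
  have hpos : ∀ γ : Gam n, 0 < ‖(j γ Z).det‖ := fun γ => norm_pos_iff.2 (det_j_ne_zero γ hZ)
  have hne : ∑' x : R × L, ENNReal.ofReal
      ((‖(j x.1.1 Z).det‖ ^ k)⁻¹ * Real.exp (-(c * rowQuad x.1.1 Z x.2.1))) ≠ ∞ := by
    refine ne_top_of_le_ne_top (ENNReal.mul_ne_top hC hE) ?_
    rw [ENNReal.tsum_prod', ← ENNReal.tsum_mul_left]
    refine ENNReal.tsum_le_tsum fun γ => ?_
    have h0 := hpos γ.1
    calc ∑' l : L, ENNReal.ofReal ((‖(j γ.1 Z).det‖ ^ k)⁻¹ * Real.exp (-(c * rowQuad γ.1 Z l.1)))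
        = ENNReal.ofReal ((‖(j γ.1 Z).det‖ ^ k)⁻¹) *
          ∑' l : L, ENNReal.ofReal (Real.exp (-(c * rowQuad γ.1 Z l.1))) := by
          rw [← ENNReal.tsum_mul_left]
          exact tsum_congr fun l => ENNReal.ofReal_mul (by positivity)
      _ ≤ ENNReal.ofReal ((‖(j γ.1 Z).det‖ ^ k)⁻¹) *
          (C * ENNReal.ofReal (‖(j γ.1 Z).det‖ ^ m)) := by
          gcongr
          exact (ENNReal.tsum_comp_le_tsum_of_injective Subtype.val_injective
            fun l => ENNReal.ofReal (Real.exp (-(c * rowQuad γ.1 Z l)))).trans (hC' γ.1)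
      _ = C * (ENNReal.ofReal ((‖(j γ.1 Z).det‖ ^ k)⁻¹) *
          ENNReal.ofReal (‖(j γ.1 Z).det‖ ^ m)) := by ring
      _ = _ := by
          rw [← ENNReal.ofReal_mul (by positivity)]
          congr 2
          rw [show k = (k - m) + m by omega, pow_add, mul_inv, mul_assoc,
            inv_mul_cancel₀ (by positivity), mul_one]
          simp
  have := ENNReal.summable_toReal hne
  refine this.congr fun x => ?_
  have := hpos x.1.1
  rw [ENNReal.toReal_ofReal (by positivity)]

/-! ### Termwise differentiation of series of entire functions -/

section Families

variable {E : Type*} [NormedAddCommGroup E] [NormedSpace ℂ E]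

/-- A family of entire functions on a complex normed space which is normally summable on bounded
sets. -/
structure NormallySummable {α : Type*} (f : α → E → ℂ) : Prop where
  contDiff : ∀ i, ContDiff ℂ (⊤ : ℕ∞) (f i)
  bound : ∀ K : ℝ, ∃ u : α → ℝ, Summable u ∧ ∀ i w, ‖w‖ ≤ K → ‖f i w‖ ≤ u i

/-- Cauchy's estimate for the derivative of an entire function. -/
lemma norm_fderiv_le_of_norm_le {f : E → ℂ} (hf : Differentiable ℂ f)
    {w : E} {M K : ℝ} (hM : 0 ≤ M) (hw : ‖w‖ ≤ K)
    (h : ∀ v, ‖v‖ ≤ K + 1 → ‖f v‖ ≤ M) : ‖fderiv ℂ f w‖ ≤ M := by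
  refine ContinuousLinearMap.opNorm_le_bound _ hM fun v => ?_
  by_cases hv : v = 0
  · simp [hv]
  have hv0 : 0 < ‖v‖ := norm_pos_iff.2 hv
  have hl : ∀ s : ℂ, HasDerivAt (fun t : ℂ => w + t • v) v s := fun s => by
    simpa using ((hasDerivAt_id s).smul_const v).const_add w
  have hg : ∀ s : ℂ, HasDerivAt (fun t : ℂ => f (w + t • v)) (fderiv ℂ f (w + s • v) v) s :=
    fun s => (hf _).hasFDerivAt.comp_hasDerivAt s (hl s)
  have hd : Differentiable ℂ fun t : ℂ => f (w + t • v) := fun s => (hg s).differentiableAt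
  have := Complex.norm_deriv_le_of_forall_mem_sphere_norm_le (c := (0 : ℂ)) (R := ‖v‖⁻¹) (C := M)
    (by positivity) hd.diffContOnCl (fun z hz => h _ (by
      have hz' : ‖z‖ = ‖v‖⁻¹ := by simpa using hz
      refine (norm_add_le _ _).trans (add_le_add hw ?_)
      rw [norm_smul, hz', inv_mul_cancel₀ hv0.ne']))
  rw [(hg 0).deriv, zero_smul, add_zero, div_inv_eq_mul] at this
  exact this

namespace NormallySummable

variable {α : Type*} {f : α → E → ℂ}

lemma differentiable (hf : NormallySummable f) (i : α) : Differentiable ℂ (f i) :=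
  (hf.contDiff i).differentiable (by simp)

lemma summable (hf : NormallySummable f) (w : E) : Summable fun i => f i w := by
  obtain ⟨u, hu, h⟩ := hf.bound ‖w‖
  exact Summable.of_norm_bounded hu fun i => h i w le_rfl

lemma exists_fderiv_bound (hf : NormallySummable f) (K : ℝ) : ∃ u : α → ℝ, Summable u ∧
    ∀ i w, ‖w‖ ≤ K → ‖fderiv ℂ (f i) w‖ ≤ u i := by
  obtain ⟨u, hu, h⟩ := hf.bound (K + 1)
  refine ⟨u, hu, fun i w hw => norm_fderiv_le_of_norm_le (hf.differentiable i)
    ((norm_nonneg _).trans (h i w (hw.trans (by linarith)))) hw (h i)⟩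

lemma hasFDerivAt_tsum (hf : NormallySummable f) (w : E) :
    HasFDerivAt (fun w => ∑' i, f i w) (∑' i, fderiv ℂ (f i) w) w := by
  obtain ⟨u, hu, h⟩ := hf.exists_fderiv_bound (‖w‖ + 1)
  have : IsPreconnected (Metric.ball (0 : E) (‖w‖ + 1)) := by
    let _ := NormedSpace.restrictScalars ℝ ℂ E
    exact (convex_ball _ _).isPreconnected
  refine hasFDerivAt_tsum_of_isPreconnected (s := Metric.ball 0 (‖w‖ + 1)) hu Metric.isOpen_ball
    this (fun i V _ => ((hf.differentiable i) V).hasFDerivAt)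
    (fun i V hV => h i V ?_) (x₀ := w) ?_ (hf.summable w) ?_
  · rw [mem_ball_zero_iff] at hV; exact hV.le
  · rw [mem_ball_zero_iff]; linarith
  · rw [mem_ball_zero_iff]; linarith

lemma fderiv_apply (hf : NormallySummable f) (v : E) :
    (NormallySummable fun i w => fderiv ℂ (f i) w v) := by
  constructor
  · intro i
    exact ((hf.contDiff i).fderiv_right (by simp)).clm_apply contDiff_const
  · intro K
    obtain ⟨u, hu, h⟩ := hf.exists_fderiv_bound K
    exact ⟨fun i => u i * ‖v‖, hu.mul_right _, fun i w hw =>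
      (ContinuousLinearMap.le_opNorm _ _).trans
        (mul_le_mul_of_nonneg_right (h i w hw) (norm_nonneg _))⟩

lemma fderiv_tsum_apply (hf : NormallySummable f) (v w : E) :
    fderiv ℂ (fun w => ∑' i, f i w) w v = ∑' i, fderiv ℂ (f i) w v := by
  rw [(hf.hasFDerivAt_tsum w).fderiv]
  obtain ⟨u, hu, hb⟩ := hf.exists_fderiv_bound ‖w‖
  have hs : Summable fun i => fderiv ℂ (f i) w :=
    Summable.of_norm_bounded hu fun i => hb i w le_rfl
  exact (ContinuousLinearMap.apply ℂ ℂ v).map_tsum hs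

end NormallySummable

end Families

lemma partialW_eq_fderiv {f : Matrix (Fin m) (Fin n) ℂ → ℂ} (p : Fin m × Fin n)
    {w : Fin m → Fin n → ℂ} (hf : DifferentiableAt ℂ (fun w : Fin m → Fin n → ℂ => f (of w)) w) :
    partialW p f (of w) = fderiv ℂ (fun w : Fin m → Fin n → ℂ => f (of w)) w
      (Pi.single p.1 (Pi.single p.2 1)) := by
  have hl : HasDerivAt (fun t : ℂ => w + t • (Pi.single p.1 (Pi.single p.2 1) : Fin m → Fin n → ℂ))
      (Pi.single p.1 (Pi.single p.2 1) : Fin m → Fin n → ℂ) 0 := by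
    have := ((hasDerivAt_id (0 : ℂ)).smul_const
      (Pi.single p.1 (Pi.single p.2 1) : Fin m → Fin n → ℂ)).const_add w
    rwa [one_smul] at this
  have h0 : w + (0 : ℂ) • (Pi.single p.1 (Pi.single p.2 1) : Fin m → Fin n → ℂ) = w := by
    rw [zero_smul, add_zero]
  have hf' := hf.hasFDerivAt
  rw [← h0] at hf'
  have key := (hf'.comp_hasDerivAt (0 : ℂ) hl).deriv
  rw [h0] at key
  rw [← key, partialW]
  congr 1
  funext t
  simp only [Function.comp]
  congr 1
  ext a b
  simp only [Matrix.add_apply, of_apply, Pi.add_apply, Pi.smul_apply, Matrix.single_apply,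
    smul_eq_mul]
  by_cases h1 : p.1 = a
  · subst h1
    by_cases h2 : p.2 = b
    · subst h2
      simp
    · rw [Pi.single_eq_same, Pi.single_eq_of_ne' h2]
      simp [h2]
  · rw [Pi.single_eq_of_ne' h1]
    simp [h1]

/-- Normal summability for a family of functions of an `m × n` matrix, read through the normed
space of functions `Fin m → Fin n → ℂ`. -/
abbrev MatNormallySummable {α : Type*} (f : α → Matrix (Fin m) (Fin n) ℂ → ℂ) : Prop :=
  NormallySummable fun i (w : Fin m → Fin n → ℂ) => f i (of w)

namespace MatNormallySummable

variable {α : Type*} {f : α → Matrix (Fin m) (Fin n) ℂ → ℂ}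

lemma partialW (hf : MatNormallySummable f) (p : Fin m × Fin n) :
    MatNormallySummable fun i => SiegelJacobi.partialW p (f i) := by
  have := hf.fderiv_apply (Pi.single p.1 (Pi.single p.2 1))
  have e : (fun i (w : Fin m → Fin n → ℂ) => SiegelJacobi.partialW p (f i) (of w)) =
      fun i w => fderiv ℂ (fun w : Fin m → Fin n → ℂ => f i (of w)) w
        (Pi.single p.1 (Pi.single p.2 1)) := by
    funext i w
    exact partialW_eq_fderiv p (hf.differentiable i w)
  rw [MatNormallySummable, e]
  exact this

lemma partialW_tsum (hf : MatNormallySummable f) (p : Fin m × Fin n) :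
    SiegelJacobi.partialW p (fun W => ∑' i, f i W) =
      fun W => ∑' i, SiegelJacobi.partialW p (f i) W := by
  have h : ∀ w : Fin m → Fin n → ℂ, SiegelJacobi.partialW p (fun W => ∑' i, f i W) (of w) =
      ∑' i, SiegelJacobi.partialW p (f i) (of w) := fun w => by
    rw [partialW_eq_fderiv p (hf.hasFDerivAt_tsum w).differentiableAt, hf.fderiv_tsum_apply]
    exact tsum_congr fun i => (partialW_eq_fderiv p (hf.differentiable i w)).symm
  exact funext h

lemma iterate_partialW (hf : MatNormallySummable f) (p : Fin m × Fin n) (r : ℕ) :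
    (MatNormallySummable fun i => (SiegelJacobi.partialW p)^[r] (f i)) ∧
      (SiegelJacobi.partialW p)^[r] (fun W => ∑' i, f i W) =
        fun W => ∑' i, (SiegelJacobi.partialW p)^[r] (f i) W := by
  induction r with
  | zero => exact ⟨hf, rfl⟩
  | succ r ih =>
    simp only [Function.iterate_succ_apply']
    exact ⟨partialW ih.1 p, by rw [ih.2, partialW_tsum ih.1 p]⟩

/-- Normally summable families can be differentiated termwise. -/
lemma monomialDiff (hf : MatNormallySummable f) (d : (Fin m × Fin n) →₀ ℕ) :
    (MatNormallySummable fun i => SiegelJacobi.monomialDiff d (f i)) ∧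
      SiegelJacobi.monomialDiff d (fun W => ∑' i, f i W) =
        fun W => ∑' i, SiegelJacobi.monomialDiff d (f i) W := by
  simp only [SiegelJacobi.monomialDiff]
  induction (List.finRange m).product (List.finRange n) with
  | nil => exact ⟨hf, rfl⟩
  | cons p t ih =>
    simp only [List.foldr_cons]
    rw [ih.2]
    exact iterate_partialW ih.1 p (d p)

lemma hasSum_diffOp (hf : MatNormallySummable f) (P : MvPolynomial (Fin m × Fin n) ℂ)
    (W : Matrix (Fin m) (Fin n) ℂ) :
    HasSum (fun i => diffOp P (f i) W) (diffOp P (fun W => ∑' i, f i W) W) := by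
  simp only [diffOp]
  refine hasSum_sum fun d _ => HasSum.mul_left _ ?_
  rw [(monomialDiff hf d).2]
  exact ((monomialDiff hf d).1.summable W).hasSum

end MatNormallySummable

/-! ### Harmonic differential operators and exponentials of quadratic polynomials -/

section Gaussian

open MvPolynomial

variable {σ : Type*}

/-- The operator `D_a` with `∂_a (R e^φ) = (D_a R) e^φ`. -/
def twistedDeriv (φ : MvPolynomial σ ℂ) (a : σ) (R : MvPolynomial σ ℂ) : MvPolynomial σ ℂ :=
  pderiv a R + R * pderiv a φ

lemma pderiv_pderiv_comm (a b : σ) (R : MvPolynomial σ ℂ) :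
    pderiv a (pderiv b R) = pderiv b (pderiv a R) := by
  classical
  induction R using MvPolynomial.induction_on with
  | C r => simp
  | add p q hp hq => simp only [map_add, hp, hq]
  | mul_X p c hp =>
    have h : ∀ x y : σ, pderiv x (pderiv y (X c : MvPolynomial σ ℂ)) = 0 := fun x y => by
      rw [pderiv_X, Pi.single_apply]; split_ifs <;> simp
    simp only [pderiv_mul, map_add, hp, h]
    ring

lemma twistedDeriv_comm (φ : MvPolynomial σ ℂ) (a b : σ) (R : MvPolynomial σ ℂ) :
    twistedDeriv φ a (twistedDeriv φ b R) = twistedDeriv φ b (twistedDeriv φ a R) := by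
  simp only [twistedDeriv, map_add, pderiv_mul, pderiv_pderiv_comm a b]
  ring

lemma twistedDeriv_add (φ : MvPolynomial σ ℂ) (a : σ) (R R' : MvPolynomial σ ℂ) :
    twistedDeriv φ a (R + R') = twistedDeriv φ a R + twistedDeriv φ a R' := by
  simp only [twistedDeriv, map_add, add_mul]; ring

lemma twistedDeriv_smul (φ : MvPolynomial σ ℂ) (a : σ) (c : ℂ) (R : MvPolynomial σ ℂ) :
    twistedDeriv φ a (c • R) = c • twistedDeriv φ a R := by
  simp only [twistedDeriv, Derivation.map_smul, smul_add, smul_mul_assoc]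

/-- The polynomial `T_d` with `∂^d e^φ = T_d e^φ`, the derivatives being taken along the list
`s` of variables. -/
def twistedMonomial (φ : MvPolynomial σ ℂ) (s : List σ) (d : σ →₀ ℕ) : MvPolynomial σ ℂ :=
  s.foldr (fun p g => (twistedDeriv φ p)^[d p] g) 1

lemma twistedDeriv_iterate_comm (φ : MvPolynomial σ ℂ) (a b : σ) (r : ℕ) (R : MvPolynomial σ ℂ) :
    (twistedDeriv φ b)^[r] (twistedDeriv φ a R) = twistedDeriv φ a ((twistedDeriv φ b)^[r] R) :=
  (Function.Commute.iterate_left (fun x => twistedDeriv_comm φ b a x) r) R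

lemma twistedMonomial_add_of_notMem (φ : MvPolynomial σ ℂ) {s : List σ} {a : σ} (ha : a ∉ s)
    (d : σ →₀ ℕ) :
    twistedMonomial φ s (Finsupp.single a 1 + d) = twistedMonomial φ s d := by
  classical
  induction s with
  | nil => rfl
  | cons p t ih =>
    rw [List.mem_cons, not_or] at ha
    have := ih ha.2
    simp only [twistedMonomial, List.foldr_cons] at this ⊢
    rw [this, Finsupp.add_apply, Finsupp.single_eq_of_ne' ha.1, zero_add]

lemma twistedMonomial_add (φ : MvPolynomial σ ℂ) {s : List σ} (hs : s.Nodup) {a : σ} (ha : a ∈ s)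
    (d : σ →₀ ℕ) :
    twistedMonomial φ s (Finsupp.single a 1 + d) = twistedDeriv φ a (twistedMonomial φ s d) := by
  classical
  induction s with
  | nil => simp at ha
  | cons p t ih =>
    rw [List.nodup_cons] at hs
    by_cases h : a = p
    · subst h
      have := twistedMonomial_add_of_notMem φ hs.1 d
      simp only [twistedMonomial, List.foldr_cons] at this ⊢
      rw [this, Finsupp.add_apply, Finsupp.single_eq_same, add_comm,
        Function.iterate_succ_apply']
    · have := ih hs.2 ((List.mem_cons.1 ha).resolve_left h)
      simp only [twistedMonomial, List.foldr_cons] at this ⊢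
      rw [this, Finsupp.add_apply, Finsupp.single_eq_of_ne' h, zero_add,
        twistedDeriv_iterate_comm]

/-- The linear map `P ↦ e^{-φ} P(∂) e^φ`. -/
def twist (φ : MvPolynomial σ ℂ) (s : List σ) : MvPolynomial σ ℂ →ₗ[ℂ] MvPolynomial σ ℂ :=
  (basisMonomials σ ℂ).constr ℂ (twistedMonomial φ s)

lemma twist_monomial (φ : MvPolynomial σ ℂ) (s : List σ) (d : σ →₀ ℕ) (c : ℂ) :
    twist φ s (monomial d c) = c • twistedMonomial φ s d := by
  have h := (basisMonomials σ ℂ).constr_basis ℂ (twistedMonomial φ s) d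
  rw [coe_basisMonomials] at h
  have e : monomial d c = c • (monomial d (1 : ℂ)) := by
    rw [smul_monomial, smul_eq_mul, mul_one]
  rw [e, map_smul]
  exact congrArg (c • ·) h

lemma twist_eq_sum (φ : MvPolynomial σ ℂ) (s : List σ) (P : MvPolynomial σ ℂ) :
    twist φ s P = ∑ d ∈ P.support, P.coeff d • twistedMonomial φ s d := by
  conv_lhs => rw [← support_sum_monomial_coeff P, map_sum]
  exact Finset.sum_congr rfl fun d _ => twist_monomial φ s d _

lemma twist_C (φ : MvPolynomial σ ℂ) (s : List σ) (c : ℂ) : twist φ s (C c) = C c := by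
  have h : twistedMonomial φ s 0 = 1 := by
    rw [twistedMonomial]
    induction s with
    | nil => rfl
    | cons p t ih => rw [List.foldr_cons, ih]; rfl
  rw [C_apply, twist_monomial, h, ← C_apply, smul_eq_C_mul, mul_one]

lemma twist_X_mul (φ : MvPolynomial σ ℂ) {s : List σ} (hs : s.Nodup) {a : σ} (ha : a ∈ s)
    (P : MvPolynomial σ ℂ) : twist φ s (X a * P) = twistedDeriv φ a (twist φ s P) := by
  induction P using MvPolynomial.induction_on' with
  | monomial d c =>
    rw [X, monomial_mul, one_mul, twist_monomial, twist_monomial, twistedMonomial_add φ hs ha,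
      twistedDeriv_smul]
  | add p q hp hq => rw [mul_add, map_add, map_add, twistedDeriv_add, hp, hq]

variable [Fintype σ]

/-- For a quadratic polynomial `φ` with constant Hessian `h`, the commutator of `∂_b` and
`e^{-φ} P(∂) e^φ` is the sum of the operators `h_{ab} e^{-φ} (∂_a P)(∂) e^φ`. -/
lemma pderiv_twist (φ : MvPolynomial σ ℂ) {s : List σ} (hs : s.Nodup) (hmem : ∀ a, a ∈ s)
    {h : σ → σ → ℂ} (hφ : ∀ a b, pderiv b (pderiv a φ) = C (h a b)) (b : σ)
    (P : MvPolynomial σ ℂ) :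
    pderiv b (twist φ s P) = ∑ a, C (h a b) * twist φ s (pderiv a P) := by
  classical
  induction P using MvPolynomial.induction_on with
  | C r => simp [twist_C]
  | add p q hp hq => simp only [map_add, hp, hq, mul_add, Finset.sum_add_distrib]
  | mul_X p c ih =>
    have e : ∀ a, twist φ s (pderiv a (p * X c)) =
        twistedDeriv φ c (twist φ s (pderiv a p)) + (if a = c then twist φ s p else 0) := by
      intro a
      rw [pderiv_mul, map_add, mul_comm (pderiv a p), twist_X_mul φ hs (hmem c), pderiv_X,
        Pi.single_apply]
      by_cases hac : a = c
      · simp [hac]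
      · simp [hac, Ne.symm hac]
    simp only [e, mul_add, Finset.sum_add_distrib, mul_ite, mul_zero, Finset.sum_ite_eq',
      Finset.mem_univ, if_true]
    rw [mul_comm p, twist_X_mul φ hs (hmem c), twistedDeriv, map_add, pderiv_mul, hφ,
      pderiv_pderiv_comm b c, ih]
    simp only [map_sum, pderiv_C_mul, twistedDeriv, mul_add, Finset.sum_add_distrib,
      Finset.sum_mul, mul_assoc]
    ring

/-- A homogeneous polynomial `P` which is harmonic for the Hessian of the quadratic polynomial
`φ` satisfies `(P(∂) e^φ)(0) = P(grad φ(0)) e^{φ(0)}`: by Euler's identity and induction on the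
degree, the contributions of the Hessian add up to a multiple of the Laplacian of `P`. -/
lemma eval_zero_twist (φ : MvPolynomial σ ℂ) {s : List σ} (hs : s.Nodup) (hmem : ∀ a, a ∈ s)
    {h : σ → σ → ℂ} (hφ : ∀ a b, pderiv b (pderiv a φ) = C (h a b)) {d : ℕ}
    {P : MvPolynomial σ ℂ} (hd : P.IsHomogeneous d)
    (hP : ∑ a, ∑ b, C (h a b) * pderiv a (pderiv b P) = 0) :
    eval 0 (twist φ s P) = eval (fun a => eval 0 (pderiv a φ)) P := by
  induction d generalizing P with
  | zero =>
    rw [← totalDegree_zero_iff_isHomogeneous, totalDegree_eq_zero_iff_eq_C] at hd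
    rw [hd, twist_C, eval_C, eval_C]
  | succ d ih =>
    have hE := hd.sum_X_mul_pderiv
    rw [← Nat.cast_smul_eq_nsmul ℂ] at hE
    have hder : ∀ c, eval 0 (twist φ s (pderiv c P)) =
        eval (fun a => eval 0 (pderiv a φ)) (pderiv c P) := fun c => by
      refine ih hd.pderiv ?_
      have := congrArg (pderiv c) hP
      simp only [map_sum, pderiv_C_mul, map_zero] at this
      rw [← this]
      refine Finset.sum_congr rfl fun a _ => Finset.sum_congr rfl fun b _ => ?_
      rw [pderiv_pderiv_comm c a, pderiv_pderiv_comm c b]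
    have hH : ∑ b, pderiv b (twist φ s (pderiv b P)) = 0 := by
      have : ∀ b, pderiv b (twist φ s (pderiv b P)) =
          twist φ s (∑ a, C (h a b) * pderiv a (pderiv b P)) := fun b => by
        rw [pderiv_twist φ hs hmem hφ, map_sum]
        simp only [← smul_eq_C_mul, map_smul]
      simp only [this]
      rw [← map_sum, Finset.sum_comm, hP, map_zero]
    have h1 : ((d + 1 : ℕ) : ℂ) * eval 0 (twist φ s P) =
        ((d + 1 : ℕ) : ℂ) * eval (fun a => eval 0 (pderiv a φ)) P := by
      have l1 := congrArg (fun Q => eval (0 : σ → ℂ) (twist φ s Q)) hE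
      have l2 := congrArg (eval (fun a => eval 0 (pderiv a φ))) hE
      simp only [map_sum, map_smul, twist_X_mul φ hs (hmem _), twistedDeriv, map_add, map_mul,
        eval_X, smul_eval, Finset.sum_add_distrib] at l1 l2
      rw [← l1, ← l2, ← map_sum, hH, map_zero, zero_add]
      exact Finset.sum_congr rfl fun a _ => by rw [hder, mul_comm]
    exact mul_left_cancel₀ (Nat.cast_ne_zero.2 d.succ_ne_zero) h1

/-- The polynomial `∑ h_{ab} X_a X_b + ∑ ℓ_a X_a`. -/
def quadraticPoly (h : σ → σ → ℂ) (ℓ : σ → ℂ) : MvPolynomial σ ℂ :=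
  ∑ a, ∑ b, C (h a b) * (X a * X b) + ∑ a, C (ℓ a) * X a

lemma pderiv_quadraticPoly (h : σ → σ → ℂ) (ℓ : σ → ℂ) (c : σ) :
    pderiv c (quadraticPoly h ℓ) = ∑ b, C (h c b + h b c) * X b + C (ℓ c) := by
  classical
  simp only [quadraticPoly, map_add, map_sum, pderiv_C, pderiv_mul, pderiv_X, Pi.single_apply,
    mul_add, ite_mul, mul_ite, one_mul, mul_one, zero_mul, mul_zero, zero_add, Finset.sum_const_zero, Finset.sum_add_distrib,
    Finset.sum_ite_eq', Finset.mem_univ, if_true, Finset.sum_ite_irrel,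
    add_mul]

lemma pderiv_pderiv_quadraticPoly (h : σ → σ → ℂ) (ℓ : σ → ℂ) (a b : σ) :
    pderiv b (pderiv a (quadraticPoly h ℓ)) = C (h a b + h b a) := by
  classical
  rw [pderiv_quadraticPoly]
  simp only [map_add, map_sum, pderiv_C, add_zero, pderiv_mul, pderiv_X, Pi.single_apply,
    zero_mul, zero_add, mul_ite, mul_one, mul_zero, Finset.sum_ite_eq',
    Finset.mem_univ, if_true]

lemma eval_zero_pderiv_quadraticPoly (h : σ → σ → ℂ) (ℓ : σ → ℂ) (a : σ) :
    eval 0 (pderiv a (quadraticPoly h ℓ)) = ℓ a := by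
  simp [pderiv_quadraticPoly]

end Gaussian

lemma hasDerivAt_evalAt (R : MvPolynomial (Fin m × Fin n) ℂ) (a : Fin m × Fin n)
    (W : Matrix (Fin m) (Fin n) ℂ) :
    HasDerivAt (fun t : ℂ => evalAt R (W + Matrix.single a.1 a.2 t))
      (evalAt (MvPolynomial.pderiv a R) W) 0 := by
  induction R using MvPolynomial.induction_on with
  | C r => simpa [evalAt] using hasDerivAt_const (0 : ℂ) r
  | add p q hp hq =>
    simp only [evalAt, map_add] at hp hq ⊢
    exact hp.add hq
  | mul_X p c hp =>
    have hX : HasDerivAt (fun t : ℂ => (W + Matrix.single a.1 a.2 t) c.1 c.2)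
        (evalAt (MvPolynomial.pderiv a (MvPolynomial.X c)) W) 0 := by
      by_cases h : a = c
      · subst h
        simp only [evalAt, MvPolynomial.pderiv_X_self, map_one, Matrix.add_apply,
          Matrix.single_apply_same]
        exact (hasDerivAt_id (0 : ℂ)).const_add _
      · have h' : ¬ (a.1 = c.1 ∧ a.2 = c.2) := fun h' => h (Prod.ext h'.1 h'.2)
        simp only [evalAt, MvPolynomial.pderiv_X_of_ne (Ne.symm h), map_zero, Matrix.add_apply,
          Matrix.single_apply, if_neg h', add_zero]
        exact hasDerivAt_const _ _
    have := hp.mul hX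
    simp only [evalAt, map_mul, MvPolynomial.pderiv_mul, map_add, MvPolynomial.eval_X,
      Matrix.single_zero, add_zero] at this ⊢
    exact this

lemma partialW_evalAt_mul_exp (φ R : MvPolynomial (Fin m × Fin n) ℂ) (c : ℂ)
    (a : Fin m × Fin n) :
    partialW a (fun W => evalAt R W * (c * Complex.exp (evalAt φ W))) =
      fun W => evalAt (twistedDeriv φ a R) W * (c * Complex.exp (evalAt φ W)) := by
  funext W
  have h := (hasDerivAt_evalAt R a W).mul (((hasDerivAt_evalAt φ a W).cexp).const_mul c)
  rw [partialW]
  refine h.deriv.trans ?_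
  simp only [Matrix.single_zero, add_zero, evalAt, twistedDeriv, map_add, map_mul]
  ring

lemma monomialDiff_exp (φ : MvPolynomial (Fin m × Fin n) ℂ) (c : ℂ)
    (d : (Fin m × Fin n) →₀ ℕ) :
    monomialDiff d (fun W => c * Complex.exp (evalAt φ W)) = fun W =>
      evalAt (twistedMonomial φ ((List.finRange m).product (List.finRange n)) d) W *
        (c * Complex.exp (evalAt φ W)) := by
  rw [monomialDiff]
  simp only [twistedMonomial]
  induction (List.finRange m).product (List.finRange n) with
  | nil => simp [evalAt]
  | cons p t ih =>
    rw [List.foldr_cons, List.foldr_cons, ih]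
    induction d p with
    | zero => rfl
    | succ r ihr => rw [Function.iterate_succ_apply', ihr, partialW_evalAt_mul_exp,
        Function.iterate_succ_apply']

lemma diffOp_exp (φ : MvPolynomial (Fin m × Fin n) ℂ) (c : ℂ)
    (P : MvPolynomial (Fin m × Fin n) ℂ) (W : Matrix (Fin m) (Fin n) ℂ) :
    diffOp P (fun W => c * Complex.exp (evalAt φ W)) W =
      evalAt (twist φ ((List.finRange m).product (List.finRange n)) P) W *
        (c * Complex.exp (evalAt φ W)) := by
  have h : evalAt (twist φ ((List.finRange m).product (List.finRange n)) P) W =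
      ∑ d ∈ P.support, P.coeff d *
        evalAt (twistedMonomial φ ((List.finRange m).product (List.finRange n)) d) W := by
    rw [twist_eq_sum, evalAt, map_sum]
    exact Finset.sum_congr rfl fun d _ => MvPolynomial.smul_eval _ _ _
  rw [diffOp, h, Finset.sum_mul]
  refine Finset.sum_congr rfl fun d _ => ?_
  rw [monomialDiff_exp, mul_assoc]

/-! ### The Jacobi–Eisenstein series under harmonic differential operators -/

lemma contDiff_evalAt (R : MvPolynomial (Fin m × Fin n) ℂ) :
    ContDiff ℂ (⊤ : ℕ∞) fun w : Fin m → Fin n → ℂ => evalAt R (of w) := by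
  induction R using MvPolynomial.induction_on with
  | C r => simpa [evalAt] using contDiff_const
  | add p q hp hq =>
    simp only [evalAt, map_add] at hp hq ⊢
    exact hp.add hq
  | mul_X p c hp =>
    simp only [evalAt, map_mul, MvPolynomial.eval_X] at hp ⊢
    exact hp.mul (contDiff_apply_apply ℂ ℂ c.1 c.2)

/-- The coefficients of the quadratic part `-2πi tr(S W j(γ,Z)⁻¹ C ᵗW)` of the exponent of the
terms of the Jacobi–Eisenstein series at `γ`. -/
def exponentQuad (S : Matrix (Fin m) (Fin m) ℝ) (γ : Gam n) (Z : Matrix (Fin n) (Fin n) ℂ)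
    (a b : Fin m × Fin n) : ℂ :=
  -(2 * Real.pi * Complex.I) * (ofReal S b.1 a.1 * ((j γ Z)⁻¹ * blockC γ) a.2 b.2)

/-- The exponent of the term of the Jacobi–Eisenstein series at `(γ, l)`, as a polynomial in `W`
without constant term. -/
def exponentPoly (S : Matrix (Fin m) (Fin m) ℝ) (γ : Gam n) (l : Matrix (Fin m) (Fin n) ℤ)
    (Z : Matrix (Fin n) (Fin n) ℂ) : MvPolynomial (Fin m × Fin n) ℂ :=
  quadraticPoly (exponentQuad S γ Z) fun a =>
    ((4 * Real.pi * Complex.I : ℂ) • (ofReal S * ofInt l * (j γ Z)⁻¹.transpose)) a.1 a.2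

lemma trace_mul_mul_mul_transpose (A : Matrix (Fin m) (Fin m) ℂ) (V : Matrix (Fin n) (Fin n) ℂ)
    (W : Matrix (Fin m) (Fin n) ℂ) :
    (A * W * V * Wᵀ).trace = ∑ a : Fin m × Fin n, ∑ b : Fin m × Fin n,
      A b.1 a.1 * V a.2 b.2 * (W a.1 a.2 * W b.1 b.2) := by
  have h : (A * W * V * Wᵀ).trace = ∑ b : Fin m × Fin n, ∑ a : Fin m × Fin n,
      A b.1 a.1 * V a.2 b.2 * (W a.1 a.2 * W b.1 b.2) := by
    simp only [Matrix.trace, Matrix.diag_apply, Matrix.mul_apply, Matrix.transpose_apply,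
      Fintype.sum_prod_type, Finset.sum_mul]
    refine Finset.sum_congr rfl fun p _ => Finset.sum_congr rfl fun r _ => ?_
    rw [Finset.sum_comm]
    exact Finset.sum_congr rfl fun q _ => Finset.sum_congr rfl fun i _ => by ring
  rw [h, Finset.sum_comm]

lemma eisensteinTerm_eq (k : ℕ) (S : Matrix (Fin m) (Fin m) ℝ) (γ : Gam n)
    (l : Matrix (Fin m) (Fin n) ℤ) (Z : Matrix (Fin n) (Fin n) ℂ)
    (W : Matrix (Fin m) (Fin n) ℂ) :
    eisensteinTerm k S γ l Z W =
      ((j γ Z).det ^ (-(k : ℤ)) * Complex.exp (2 * Real.pi * Complex.I *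
        (ofReal S * ofInt l * act γ Z * (ofInt l).transpose).trace)) *
      Complex.exp (evalAt (exponentPoly S γ l Z) W) := by
  have h1 : evalAt (exponentPoly S γ l Z) W =
      -(2 * Real.pi * Complex.I * (ofReal S * W * (j γ Z)⁻¹ * blockC γ * W.transpose).trace) +
      2 * Real.pi * Complex.I *
        (2 * (ofReal S * ofInt l * (j γ Z)⁻¹.transpose * W.transpose).trace) := by
    have e : ofReal S * W * (j γ Z)⁻¹ * blockC γ * Wᵀ =
        ofReal S * W * ((j γ Z)⁻¹ * blockC γ) * Wᵀ := by simp only [Matrix.mul_assoc]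
    have e2 : (ofReal S * ofInt l * (j γ Z)⁻¹.transpose * W.transpose).trace =
        ∑ a : Fin m × Fin n, (ofReal S * ofInt l * (j γ Z)⁻¹.transpose) a.1 a.2 * W a.1 a.2 := by
      rw [Matrix.trace, Fintype.sum_prod_type]
      exact Finset.sum_congr rfl fun p _ => by rw [Matrix.diag_apply, Matrix.mul_apply]; rfl
    rw [e, trace_mul_mul_mul_transpose, e2]
    simp only [evalAt, exponentPoly, quadraticPoly, exponentQuad, map_add, map_sum, map_mul,
      MvPolynomial.eval_C, MvPolynomial.eval_X, Matrix.smul_apply, smul_eq_mul, Finset.mul_sum,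
      ← Finset.sum_neg_distrib]
    congr 1
    · exact Finset.sum_congr rfl fun a _ => Finset.sum_congr rfl fun b _ => by ring
    · exact Finset.sum_congr rfl fun a _ => by ring
  have h2 : (ofReal S * (ofInt l * act γ Z * (ofInt l).transpose +
        (2 : ℂ) • (ofInt l * (j γ Z)⁻¹.transpose * W.transpose))).trace =
      (ofReal S * ofInt l * act γ Z * (ofInt l).transpose).trace +
        2 * (ofReal S * ofInt l * (j γ Z)⁻¹.transpose * W.transpose).trace := by
    rw [Matrix.mul_add, Matrix.mul_smul, Matrix.trace_add, Matrix.trace_smul, smul_eq_mul]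
    simp only [Matrix.mul_assoc]
  rw [eisensteinTerm, h1, h2, Complex.exp_add, mul_add, Complex.exp_add]
  ring

lemma sum_exponentQuad_mul_pderiv {S : Matrix (Fin m) (Fin m) ℝ} (hS : S.PosDef)
    {P : MvPolynomial (Fin m × Fin n) ℂ} (hP : IsPluriharmonic ((2 : ℝ) • S)⁻¹ P) (γ : Gam n)
    (Z : Matrix (Fin n) (Fin n) ℂ) :
    ∑ a, ∑ b, MvPolynomial.C (exponentQuad S γ Z a b) *
      MvPolynomial.pderiv a (MvPolynomial.pderiv b P) = 0 := by
  have hdet : IsUnit ((2 : ℝ) • S).det := by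
    rw [Matrix.det_smul]
    exact (IsUnit.mk0 _ (by positivity)).mul (IsUnit.mk0 _ hS.det_pos.ne')
  have hP' : ∀ i r : Fin n, ∑ p : Fin m, ∑ q : Fin m,
      MvPolynomial.C ((S p q : ℝ) : ℂ) *
        MvPolynomial.pderiv (p, i) (MvPolynomial.pderiv (q, r) P) = 0 := fun i r => by
    have h := hP i r
    rw [Matrix.nonsing_inv_nonsing_inv _ hdet] at h
    have h2 : (2 : MvPolynomial (Fin m × Fin n) ℂ) * ∑ p : Fin m, ∑ q : Fin m,
        MvPolynomial.C ((S p q : ℝ) : ℂ) *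
          MvPolynomial.pderiv (p, i) (MvPolynomial.pderiv (q, r) P) = 0 := by
      rw [← h]
      simp only [Finset.mul_sum, Matrix.smul_apply, smul_eq_mul, Complex.ofReal_mul, map_mul,
        Complex.ofReal_ofNat, map_ofNat, mul_assoc]
    exact (mul_eq_zero.1 h2).resolve_left two_ne_zero
  have hsymm : ∀ p q, S q p = S p q := fun p q => by
    have := hS.isHermitian.apply p q
    simpa using this
  have h : ∀ i r : Fin n, ∑ q : Fin m, ∑ p : Fin m,
      MvPolynomial.C (exponentQuad S γ Z (q, i) (p, r)) *
        MvPolynomial.pderiv (q, i) (MvPolynomial.pderiv (p, r) P) = 0 := fun i r => by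
    have := congrArg (fun Q => MvPolynomial.C
      (-(2 * Real.pi * Complex.I) * ((j γ Z)⁻¹ * blockC γ) i r) * Q) (hP' i r)
    simp only [mul_zero] at this
    rw [← this]
    simp only [Finset.mul_sum, exponentQuad, ← mul_assoc, ← map_mul, ofReal, Matrix.map_apply]
    refine Finset.sum_congr rfl fun q _ => Finset.sum_congr rfl fun p _ => ?_
    rw [hsymm q p]
    congr 2
    ring_nf
  simp only [Fintype.sum_prod_type]
  calc _ = ∑ q : Fin m, ∑ i : Fin n, ∑ r : Fin n, ∑ p : Fin m,
        MvPolynomial.C (exponentQuad S γ Z (q, i) (p, r)) *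
          MvPolynomial.pderiv (q, i) (MvPolynomial.pderiv (p, r) P) :=
        Finset.sum_congr rfl fun q _ => Finset.sum_congr rfl fun i _ => Finset.sum_comm
    _ = ∑ i : Fin n, ∑ r : Fin n, ∑ q : Fin m, ∑ p : Fin m,
        MvPolynomial.C (exponentQuad S γ Z (q, i) (p, r)) *
          MvPolynomial.pderiv (q, i) (MvPolynomial.pderiv (p, r) P) := by
        rw [Finset.sum_comm]
        exact Finset.sum_congr rfl fun i _ => Finset.sum_comm
    _ = 0 := Finset.sum_eq_zero fun i _ => Finset.sum_eq_zero fun r _ => h i r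

/-- The effect of `P(∂_W)` on a single term of the Jacobi–Eisenstein series. -/
lemma diffOp_eisensteinTerm (k : ℕ) {S : Matrix (Fin m) (Fin m) ℝ} (hS : S.PosDef)
    {P : MvPolynomial (Fin m × Fin n) ℂ} {d : ℕ} (hd : P.IsHomogeneous d)
    (hP : IsPluriharmonic ((2 : ℝ) • S)⁻¹ P) (γ : Gam n) (l : Matrix (Fin m) (Fin n) ℤ)
    (Z : Matrix (Fin n) (Fin n) ℂ) :
    diffOp P (eisensteinTerm k S γ l Z) 0 = weightedTerm k S P γ Z γ Z l := by
  have hs : ((List.finRange m).product (List.finRange n)).Nodup :=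
    (List.nodup_finRange m).product (List.nodup_finRange n)
  have hmem : ∀ a, a ∈ (List.finRange m).product (List.finRange n) := fun a =>
    List.mem_product.2 ⟨List.mem_finRange _, List.mem_finRange _⟩
  have hharm : ∑ a, ∑ b, MvPolynomial.C (exponentQuad S γ Z a b + exponentQuad S γ Z b a) *
      MvPolynomial.pderiv a (MvPolynomial.pderiv b P) = 0 := by
    have h := sum_exponentQuad_mul_pderiv hS hP γ Z
    have h' := h
    rw [Finset.sum_comm] at h'
    simp only [map_add, add_mul, Finset.sum_add_distrib]
    rw [h, zero_add, ← h']
    exact Finset.sum_congr rfl fun a _ => Finset.sum_congr rfl fun b _ => by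
      rw [pderiv_pderiv_comm a b]
  rw [show eisensteinTerm k S γ l Z = _ from funext (eisensteinTerm_eq k S γ l Z), diffOp_exp]
  have key := eval_zero_twist (exponentPoly S γ l Z) hs hmem
    (fun a b => pderiv_pderiv_quadraticPoly _ _ a b) hd hharm
  simp only [exponentPoly, eval_zero_pderiv_quadraticPoly] at key
  have e0 : evalAt (exponentPoly S γ l Z) 0 = 0 := by
    simp [evalAt, exponentPoly, quadraticPoly]
  have e1 : evalAt (twist (exponentPoly S γ l Z)
      ((List.finRange m).product (List.finRange n)) P) 0 =
      evalAt P ((4 * Real.pi * Complex.I : ℂ) •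
        (ofReal S * ofInt l * (j γ Z)⁻¹.transpose)) := key
  rw [e0, e1, Complex.exp_zero, weightedTerm]
  ring

/-- The Jacobi–Eisenstein series converges normally for `W` in bounded sets. -/
theorem matNormallySummable_eisensteinTerm {k : ℕ} (hk : n + m + 1 < k)
    {S : Matrix (Fin m) (Fin m) ℝ} (hS : S.PosDef) {Z : Matrix (Fin n) (Fin n) ℂ}
    (hZ : Z ∈ upperHalf n) {R : Set (Gam n)} (hR : Separated R)
    (L : Set (Matrix (Fin m) (Fin n) ℤ)) :
    MatNormallySummable fun x : R × L => eisensteinTerm k S x.1.1 x.2.1 Z := by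
  constructor
  · intro x
    have e : (fun w : Fin m → Fin n → ℂ => eisensteinTerm k S x.1.1 x.2.1 Z (of w)) = _ :=
      funext fun w => eisensteinTerm_eq k S x.1.1 x.2.1 Z (of w)
    rw [e]
    exact contDiff_const.mul (contDiff_evalAt _).cexp
  · intro K
    obtain ⟨c, A, hc, h⟩ := exists_norm_eisensteinTerm_le k hS hZ
    refine ⟨_, (summable_majorant hk hZ hR L hc).mul_left (Real.exp (A * K ^ 2)), fun x w hw => ?_⟩
    exact h x.1.1 x.2.1 (of w) K ((norm_nonneg w).trans hw) fun i a =>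
      ((norm_le_pi_norm (w i) a).trans (norm_le_pi_norm w i)).trans hw

lemma eisenstein_eq_tsum_prod {k : ℕ} (hk : n + m + 1 < k)
    {S : Matrix (Fin m) (Fin m) ℝ} (hS : S.PosDef) {Z : Matrix (Fin n) (Fin n) ℂ}
    (hZ : Z ∈ upperHalf n) {R : Set (Gam n)} (hR : Separated R)
    (L : Set (Matrix (Fin m) (Fin n) ℤ)) :
    eisenstein k S R L Z = fun W => ∑' x : R × L, eisensteinTerm k S x.1.1 x.2.1 Z W := by
  have h : ∀ w : Fin m → Fin n → ℂ, eisenstein k S R L Z (of w) =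
      ∑' x : R × L, eisensteinTerm k S x.1.1 x.2.1 Z (of w) := fun w =>
    ((matNormallySummable_eisensteinTerm hk hS hZ hR L).summable w).tsum_prod.symm
  exact funext h

lemma differentiable_eisenstein {k : ℕ} (hk : n + m + 1 < k)
    {S : Matrix (Fin m) (Fin m) ℝ} (hS : S.PosDef) {Z : Matrix (Fin n) (Fin n) ℂ}
    (hZ : Z ∈ upperHalf n) {R : Set (Gam n)} (hR : Separated R)
    (L : Set (Matrix (Fin m) (Fin n) ℤ)) :
    Differentiable ℂ fun w : Fin m → Fin n → ℂ => eisenstein k S R L Z (of w) := by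
  rw [eisenstein_eq_tsum_prod hk hS hZ hR L]
  exact fun w =>
    ((matNormallySummable_eisensteinTerm hk hS hZ hR L).hasFDerivAt_tsum w).differentiableAt

/-- Applying `P(∂_W)` to the Jacobi–Eisenstein series at `W = 0` gives the weighted double
series. -/
theorem hasSum_weightedTerm {k : ℕ} (hk : n + m + 1 < k)
    {S : Matrix (Fin m) (Fin m) ℝ} (hS : S.PosDef) {Z : Matrix (Fin n) (Fin n) ℂ}
    (hZ : Z ∈ upperHalf n) {R : Set (Gam n)} (hR : Separated R)
    (L : Set (Matrix (Fin m) (Fin n) ℤ)) {P : MvPolynomial (Fin m × Fin n) ℂ} {d : ℕ}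
    (hd : P.IsHomogeneous d) (hP : IsPluriharmonic ((2 : ℝ) • S)⁻¹ P) :
    HasSum (fun x : R × L => weightedTerm k S P x.1.1 Z x.1.1 Z x.2.1)
      (diffOp P (eisenstein k S R L Z) 0) := by
  have h := (matNormallySummable_eisensteinTerm hk hS hZ hR L).hasSum_diffOp P 0
  rw [← eisenstein_eq_tsum_prod hk hS hZ hR L] at h
  simpa only [diffOp_eisensteinTerm k hS hd hP] using h

/-! ### Independence of the coset representatives -/

/-- For positive definite `S` the kernel is trivial, so the lattice sum runs over all of
`ℤ^(m,n)`. -/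
lemma eq_univ_of_isComplement_kerLattice {S : Matrix (Fin m) (Fin m) ℝ} (hS : S.PosDef)
    {L : Set (Matrix (Fin m) (Fin n) ℤ)}
    (hL : AddSubgroup.IsComplement (kerLattice n S : Set (Matrix (Fin m) (Fin n) ℤ)) L) :
    L = Set.univ := by
  refine Set.eq_univ_of_forall fun l => ?_
  obtain ⟨⟨⟨a, ha⟩, b⟩, hab⟩ := hL.2 l
  have ha' : S * a.map (Int.cast : ℤ → ℝ) = 0 := ha
  have h0 : a.map (Int.cast : ℤ → ℝ) = 0 := by
    have := congrArg (fun X => S⁻¹ * X) ha'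
    simpa only [← Matrix.mul_assoc, Matrix.nonsing_inv_mul S (IsUnit.mk0 _ hS.det_pos.ne'),
      Matrix.one_mul, Matrix.mul_zero] using this
  have h1 : a = 0 := by
    ext p i
    have := congrFun (congrFun h0 p) i
    simpa using this
  have : a + b.1 = l := hab
  rw [← this, h1, zero_add]
  exact b.2

/-- A half-integral matrix pairs integrally with integral symmetric matrices. -/
lemma exists_intCast_eq_trace {S : Matrix (Fin m) (Fin m) ℝ} (hS : S.IsSymm)
    (hSint : IsHalfIntegral S) {N : Matrix (Fin m) (Fin m) ℤ} (hN : N.IsSymm) :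
    ∃ a : ℤ, (S * N.map (Int.cast : ℤ → ℝ)).trace = a := by
  have hS' : ∀ p q, S q p = S p q := fun p q => hS.apply p q
  have hN' : ∀ p q, N q p = N p q := fun p q => hN.apply p q
  have h1 : (S * N.map (Int.cast : ℤ → ℝ)).trace = ∑ p, ∑ q, S p q * N p q := by
    simp only [Matrix.trace, Matrix.diag_apply, Matrix.mul_apply, Matrix.map_apply]
    exact Finset.sum_congr rfl fun p _ => Finset.sum_congr rfl fun q _ => by rw [hN']
  have h2 : ∑ p, ∑ q, S p q * N p q = ∑ p, ∑ q,
      ((if p = q then S p q * N p q else 0) + (if p < q then 2 * S p q * N p q else 0)) := by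
    have e : ∑ p, ∑ q, (if q < p then S p q * N p q else 0) =
        ∑ p, ∑ q, (if p < q then S p q * N p q else 0) := by
      rw [Finset.sum_comm]
      exact Finset.sum_congr rfl fun p _ => Finset.sum_congr rfl fun q _ => by rw [hS', hN']
    calc _ = ∑ p, ∑ q, ((if p = q then S p q * N p q else 0) +
          (if p < q then S p q * N p q else 0)) +
          ∑ p, ∑ q, (if q < p then S p q * N p q else 0) := by
          simp only [← Finset.sum_add_distrib]
          refine Finset.sum_congr rfl fun p _ => Finset.sum_congr rfl fun q _ => ?_
          rcases lt_trichotomy p q with h | h | h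
          · simp [h, h.ne, h.not_gt]
          · simp [h]
          · simp [h, h.ne', h.not_gt]
      _ = _ := by
          rw [e]
          simp only [← Finset.sum_add_distrib]
          refine Finset.sum_congr rfl fun p _ => Finset.sum_congr rfl fun q _ => ?_
          split_ifs <;> ring
  have h3 : ∑ p, ∑ q, S p q * N p q ∈ (Int.castAddHom ℝ).range := by
    rw [h2]
    refine sum_mem fun p _ => sum_mem fun q _ => add_mem ?_ ?_
    · split_ifs with h
      · subst h
        obtain ⟨a, ha⟩ := hSint.1 p
        exact ⟨a * N p p, by rw [ha]; simp⟩
      · exact zero_mem _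
    · split_ifs with h
      · obtain ⟨a, ha⟩ := hSint.2 p q
        exact ⟨a * N p q, by rw [ha]; simp⟩
      · exact zero_mem _
  obtain ⟨a, ha⟩ := h3
  exact ⟨a, by rw [h1, ← ha]; rfl⟩

lemma ofInt_mul {a b c : ℕ} (M : Matrix (Fin a) (Fin b) ℤ) (N : Matrix (Fin b) (Fin c) ℤ) :
    ofInt (M * N) = ofInt M * ofInt N := by
  ext i k
  simp [ofInt, Matrix.mul_apply]

/-- The substitution `l ↦ l A` of the lattice `ℤ^(m,n)` for an element `(A B; 0 D)`. -/
def latticeEquiv {δ : Gam n} (hδ : δ ∈ Gam0 n) :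
    Matrix (Fin m) (Fin n) ℤ ≃ Matrix (Fin m) (Fin n) ℤ where
  toFun l := l * δ.1.toBlocks₁₁
  invFun l := l * δ.1.toBlocks₂₂ᵀ
  left_inv l := by
    have h : δ.1.toBlocks₂₂ᵀ * δ.1.toBlocks₁₁ = 1 := by
      simpa using congrArg transpose (transpose_toBlocks₁₁_mul_toBlocks₂₂ hδ)
    simp only [Matrix.mul_assoc, mul_eq_one_comm.1 h, Matrix.mul_one]
  right_inv l := by
    have h : δ.1.toBlocks₂₂ᵀ * δ.1.toBlocks₁₁ = 1 := by
      simpa using congrArg transpose (transpose_toBlocks₁₁_mul_toBlocks₂₂ hδ)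
    simp only [Matrix.mul_assoc, h, Matrix.mul_one]

/-- Left translation by `(A B; 0 D) ∈ Γ_{n,0}` amounts to the substitution `l ↦ l A`: the weight
is even, and the exponents differ by `2πi` times the trace of `S (l B ᵗA ᵗl)`, an integer since
`S` is half-integral. -/
lemma weightedTerm_mul_of_mem_Gam0 {k : ℕ} (hk : Even k) {S : Matrix (Fin m) (Fin m) ℝ}
    (hS : S.IsSymm) (hSint : IsHalfIntegral S) (P : MvPolynomial (Fin m × Fin n) ℂ)
    {δ : Gam n} (hδ : δ ∈ Gam0 n) (γ : Gam n) {Z : Matrix (Fin n) (Fin n) ℂ}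
    (hZ : Z ∈ upperHalf n) (l : Matrix (Fin m) (Fin n) ℤ) :
    weightedTerm k S P (δ * γ) Z (δ * γ) Z l =
      weightedTerm k S P γ Z γ Z (latticeEquiv hδ l) := by
  have hC : blockC δ = 0 := by
    rw [blockC, show δ.1.toBlocks₂₁ = 0 from hδ]
    ext; simp
  have hAD : (blockA δ)ᵀ * blockD δ = 1 := by rw [transpose_blockA_mul_blockD, hC]; simp
  have hinv : (blockD δ)⁻¹ = (blockA δ)ᵀ := Matrix.inv_eq_left_inv hAD
  have hj : (j (δ * γ) Z)⁻¹ = (j γ Z)⁻¹ * (blockA δ)ᵀ := by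
    rw [j_mul δ γ hZ, j_of_mem_Gam0 hδ, Matrix.mul_inv_rev, hinv]
  have hdet : (j (δ * γ) Z).det ^ (-(k : ℤ)) = (j γ Z).det ^ (-(k : ℤ)) := by
    rw [j_mul δ γ hZ, Matrix.det_mul, mul_zpow]
    rcases det_j_eq_one_or_of_mem_Gam0 hδ (act γ Z) with h | h
    · rw [h, _root_.one_zpow, one_mul]
    · rw [h, Even.neg_one_zpow ((Int.even_coe_nat k).2 hk).neg, one_mul]
  have hl : ofInt (latticeEquiv hδ l) = ofInt l * blockA δ := ofInt_mul l _
  have hact : act (δ * γ) Z = blockA δ * act γ Z * (blockA δ)ᵀ + blockB δ * (blockA δ)ᵀ := by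
    rw [act_mul δ γ hZ, act, j_of_mem_Gam0 hδ, hinv, Matrix.add_mul]
  -- `B ᵗA` is symmetric, so `S` is paired with an integral symmetric matrix
  obtain ⟨a, ha⟩ : ∃ a : ℤ,
      (ofReal S * ofInt l * (blockB δ * (blockA δ)ᵀ) * (ofInt l)ᵀ).trace = a := by
    have hsym : (δ.1.toBlocks₁₂ * δ.1.toBlocks₁₁ᵀ).IsSymm := by
      have hAD' := transpose_toBlocks₁₁_mul_toBlocks₂₂ hδ
      have hDA' : δ.1.toBlocks₂₂ᵀ * δ.1.toBlocks₁₁ = 1 := by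
        simpa using congrArg transpose hAD'
      have h := δ.2
      rw [← fromBlocks_toBlocks δ.1, SymplecticGroup.fromBlocks_mem_iff] at h
      have hBD : δ.1.toBlocks₁₂ᵀ * δ.1.toBlocks₂₂ = δ.1.toBlocks₂₂ᵀ * δ.1.toBlocks₁₂ := h.2.1
      rw [Matrix.IsSymm, transpose_mul, transpose_transpose]
      calc δ.1.toBlocks₁₁ * δ.1.toBlocks₁₂ᵀ
          = δ.1.toBlocks₁₁ * (δ.1.toBlocks₁₂ᵀ * δ.1.toBlocks₂₂) * δ.1.toBlocks₁₁ᵀ := by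
            simp only [Matrix.mul_assoc, mul_eq_one_comm.1 hAD', Matrix.mul_one]
        _ = δ.1.toBlocks₁₂ * δ.1.toBlocks₁₁ᵀ := by
            rw [hBD, ← Matrix.mul_assoc, mul_eq_one_comm.1 hDA', Matrix.one_mul]
    have hN : (l * (δ.1.toBlocks₁₂ * δ.1.toBlocks₁₁ᵀ) * lᵀ).IsSymm := by
      rw [Matrix.IsSymm, transpose_mul, transpose_mul, transpose_transpose, hsym.eq,
        ← Matrix.mul_assoc]
    obtain ⟨a, ha⟩ := exists_intCast_eq_trace hS hSint hN
    refine ⟨a, ?_⟩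
    have e : ofReal S * ofInt l * (blockB δ * (blockA δ)ᵀ) * (ofInt l)ᵀ =
        ofReal (S * (l * (δ.1.toBlocks₁₂ * δ.1.toBlocks₁₁ᵀ) * lᵀ).map (Int.cast : ℤ → ℝ)) := by
      rw [ofReal_mul, ← ofReal_intCast, ofInt_mul, ofInt_mul, ofInt_mul]
      simp only [Matrix.mul_assoc]
      rfl
    have e' : ∀ X : Matrix (Fin m) (Fin m) ℝ, (ofReal X).trace = ((X.trace : ℝ) : ℂ) := fun X => by
      simp [Matrix.trace, ofReal]
    rw [e, e', ha]
    simp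
  have htr : (ofReal S * ofInt l * act (δ * γ) Z * (ofInt l)ᵀ).trace =
      (ofReal S * (ofInt l * blockA δ) * act γ Z * (ofInt l * blockA δ)ᵀ).trace + a := by
    rw [← ha, ← Matrix.trace_add, hact, transpose_mul]
    simp only [Matrix.mul_add, Matrix.add_mul, Matrix.mul_assoc]
  have hexp : Complex.exp (2 * Real.pi * Complex.I *
      (ofReal S * ofInt l * act (δ * γ) Z * (ofInt l)ᵀ).trace) = Complex.exp (2 * Real.pi *
        Complex.I * (ofReal S * (ofInt l * blockA δ) * act γ Z * (ofInt l * blockA δ)ᵀ).trace) := by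
    rw [htr, mul_add, Complex.exp_add, mul_comm (2 * Real.pi * Complex.I : ℂ) (a : ℂ),
      Complex.exp_int_mul_two_pi_mul_I, mul_one]
  have hlin : ofReal S * ofInt l * (j (δ * γ) Z)⁻¹ᵀ =
      ofReal S * (ofInt l * blockA δ) * (j γ Z)⁻¹ᵀ := by
    rw [hj, transpose_mul, transpose_transpose]
    simp only [Matrix.mul_assoc]
  rw [weightedTerm, weightedTerm, hdet, hexp, hlin, hl]

/-- The series over `γ g` at `Z` and the series over `γ` at `g⟨Z⟩` are compared termwise, by the
cocycle property of `j`. -/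
lemma weightedTerm_act {k : ℕ} (S : Matrix (Fin m) (Fin m) ℝ)
    (P : MvPolynomial (Fin m × Fin n) ℂ) (γ g : Gam n) {Z : Matrix (Fin n) (Fin n) ℂ}
    (hZ : Z ∈ upperHalf n) (l : Matrix (Fin m) (Fin n) ℤ) :
    weightedTerm k S P γ (act g Z) (γ * g) Z l =
      (j g Z).det ^ k * weightedTerm k S P (γ * g) Z (γ * g) Z l := by
  have h0 : (j g Z).det ≠ 0 := det_j_ne_zero g hZ
  have h : (j γ (act g Z)).det ^ (-(k : ℤ)) =
      (j g Z).det ^ k * (j (γ * g) Z).det ^ (-(k : ℤ)) := by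
    rw [j_mul γ g hZ, Matrix.det_mul, mul_zpow, mul_left_comm, ← zpow_natCast (j g Z).det,
      ← zpow_add₀ h0, add_neg_cancel, zpow_zero, mul_one]
  rw [weightedTerm, weightedTerm, h]
  ring

lemma Separated.image_mul {R : Set (Gam n)} (hR : Separated R) (g : Gam n) :
    Separated ((· * g) '' R) := by
  rintro _ ⟨γ, hγ, rfl⟩ _ ⟨γ', hγ', rfl⟩ h
  have e : γ * g * (γ' * g)⁻¹ = γ * γ'⁻¹ := by group
  rw [e] at h
  rw [hR γ hγ γ' hγ' h]

/-- Right translation by `g` permutes the cosets represented by `R`. -/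
lemma exists_equiv_mul_inv_mem_Gam0 {R : Set (Gam n)} (hc : Covers R) (hs : Separated R)
    (g : Gam n) : ∃ e : R ≃ R, ∀ γ : R, (γ : Gam n) * g * (e γ : Gam n)⁻¹ ∈ Gam0 n := by
  choose e heR he using fun γ : R => hc ((γ : Gam n) * g)
  refine ⟨Equiv.ofBijective (fun γ => ⟨e γ, heR γ⟩) ⟨fun γ γ' h => ?_, fun ρ => ?_⟩, he⟩
  · have h' : e γ = e γ' := congrArg Subtype.val h
    have hm := mul_mem (he γ) (inv_mem (he γ'))
    rw [h'] at hm
    have e1 : (γ : Gam n) * g * (e γ')⁻¹ * ((γ' : Gam n) * g * (e γ')⁻¹)⁻¹ =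
        (γ : Gam n) * (γ' : Gam n)⁻¹ := by group
    rw [e1] at hm
    exact Subtype.ext (hs _ γ.2 _ γ'.2 hm)
  · obtain ⟨γ, hγ, h⟩ := hc ((ρ : Gam n) * g⁻¹)
    refine ⟨⟨γ, hγ⟩, Subtype.ext (hs _ ρ.2 _ (heR ⟨γ, hγ⟩) ?_).symm⟩
    have hm := mul_mem h (he ⟨γ, hγ⟩)
    have e1 : (ρ : Gam n) * g⁻¹ * γ⁻¹ * (γ * g * (e ⟨γ, hγ⟩)⁻¹) =
        (ρ : Gam n) * (e ⟨γ, hγ⟩)⁻¹ := by group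
    rwa [e1] at hm

/-- The sum over the lattice depends only on the coset `Γ_{n,0} γ`. -/
lemma tsum_weightedTerm_eq_of_mul_inv_mem {k : ℕ} (hk : Even k) {S : Matrix (Fin m) (Fin m) ℝ}
    (hS : S.IsSymm) (hSint : IsHalfIntegral S) (P : MvPolynomial (Fin m × Fin n) ℂ)
    {γ γ' : Gam n} (h : γ * γ'⁻¹ ∈ Gam0 n) {Z : Matrix (Fin n) (Fin n) ℂ}
    (hZ : Z ∈ upperHalf n) :
    ∑' l, weightedTerm k S P γ Z γ Z l = ∑' l, weightedTerm k S P γ' Z γ' Z l := by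
  have e : γ = γ * γ'⁻¹ * γ' := by group
  rw [← (latticeEquiv h).tsum_eq fun l => weightedTerm k S P γ' Z γ' Z l]
  refine tsum_congr fun l => ?_
  rw [← weightedTerm_mul_of_mem_Gam0 hk hS hSint P h γ' hZ l, ← e]

end

end SiegelJacobi

theorem mainTheorem4 (n m k : ℕ) (hn : 0 < n) (hm : 0 < m) (hk : Even k) (hkmn : n + m + 1 < k)
    (S : Matrix (Fin m) (Fin m) ℝ) (hS : S.PosDef) (hSint : SiegelJacobi.IsHalfIntegral S)
    (R : Set (SiegelJacobi.Gam n))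
    (hR : Subgroup.IsComplement (SiegelJacobi.Gam0 n : Set (SiegelJacobi.Gam n)) R)
    (L : Set (Matrix (Fin m) (Fin n) ℤ))
    (hL : AddSubgroup.IsComplement
      (SiegelJacobi.kerLattice n S : Set (Matrix (Fin m) (Fin n) ℤ)) L)
    (P : MvPolynomial (Fin m × Fin n) ℂ) (d : ℕ) (hPhom : P.IsHomogeneous d)
    (hP : SiegelJacobi.IsPluriharmonic ((2 : ℝ) • S)⁻¹ P) :
    -- the Eisenstein series converges absolutely and is holomorphic in `W`, and applying
    -- `P(∂_W)` to it at `W = 0` gives the `P`-weighted double sum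
    (∀ Z ∈ SiegelJacobi.upperHalf n,
      (∀ W : Matrix (Fin m) (Fin n) ℂ,
        Summable fun x : R × L => SiegelJacobi.eisensteinTerm k S x.1.1 x.2.1 Z W) ∧
      Differentiable ℂ (fun w : Fin m → Fin n → ℂ =>
        SiegelJacobi.eisenstein k S R L Z (Matrix.of w)) ∧
      SiegelJacobi.diffOp P (fun W => SiegelJacobi.eisenstein k S R L Z W) 0 =
        ∑' γ : R, ∑' l : L, SiegelJacobi.weightedTerm k S P γ.1 Z γ.1 Z l.1) ∧
    -- the double sums on both sides converge absolutely, and the identity holds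
    (∀ g : SiegelJacobi.Gam n, ∀ Z ∈ SiegelJacobi.upperHalf n,
      (Summable fun x : R × L => SiegelJacobi.weightedTerm k S P x.1.1 Z x.1.1 Z x.2.1) ∧
      (Summable fun x : R × L =>
        SiegelJacobi.weightedTerm k S P x.1.1 (SiegelJacobi.act g Z) (x.1.1 * g) Z x.2.1) ∧
      (SiegelJacobi.j g Z).det ^ k *
          ∑' γ : R, ∑' l : L, SiegelJacobi.weightedTerm k S P γ.1 Z γ.1 Z l.1 =
        ∑' γ : R, ∑' l : L, SiegelJacobi.weightedTerm k S P γ.1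
          (SiegelJacobi.act g Z) (γ.1 * g) Z l.1) := by
  obtain ⟨hc, hs⟩ := SiegelJacobi.isComplement_Gam0_iff.1 hR
  have hsum : ∀ Z ∈ SiegelJacobi.upperHalf n, ∀ T : Set (SiegelJacobi.Gam n),
      SiegelJacobi.Separated T → HasSum (fun x : T × L =>
        SiegelJacobi.weightedTerm k S P x.1.1 Z x.1.1 Z x.2.1)
        (SiegelJacobi.diffOp P (SiegelJacobi.eisenstein k S T L Z) 0) := fun Z hZ T hT =>
    SiegelJacobi.hasSum_weightedTerm hkmn hS hZ hT L hPhom hP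
  refine ⟨fun Z hZ => ⟨fun W =>
    (SiegelJacobi.matNormallySummable_eisensteinTerm hkmn hS hZ hs L).summable W,
    SiegelJacobi.differentiable_eisenstein hkmn hS hZ hs L, ?_⟩, fun g Z hZ => ?_⟩
  · rw [← (hsum Z hZ R hs).summable.tsum_prod]
    exact (hsum Z hZ R hs).tsum_eq.symm
  have hact : ∀ (γ : R) (l : L), SiegelJacobi.weightedTerm k S P γ.1
      (SiegelJacobi.act g Z) (γ.1 * g) Z l.1 = (SiegelJacobi.j g Z).det ^ k *
        SiegelJacobi.weightedTerm k S P (γ.1 * g) Z (γ.1 * g) Z l.1 := fun γ l =>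
    SiegelJacobi.weightedTerm_act S P γ.1 g hZ l.1
  refine ⟨(hsum Z hZ R hs).summable, ?_, ?_⟩
  · -- the translated system `R g` is again separated, so its weighted series converges
    have hT := (hsum Z hZ _ (hs.image_mul g)).summable
    have hinj : Function.Injective fun x : R × L =>
        ((⟨x.1.1 * g, x.1.1, x.1.2, rfl⟩, x.2) : ((· * g) '' R : Set (SiegelJacobi.Gam n)) × L) := by
      intro x y h
      have h1 := congrArg (fun z => z.1.1) h
      exact Prod.ext (Subtype.ext (mul_right_cancel h1)) (congrArg (fun z => z.2) h)
    simp only [hact]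
    exact (hT.comp_injective hinj).mul_left _
  · have hLuniv := SiegelJacobi.eq_univ_of_isComplement_kerLattice hS hL
    subst hLuniv
    obtain ⟨e, he⟩ := SiegelJacobi.exists_equiv_mul_inv_mem_Gam0 hc hs g
    have hSs : S.IsSymm := by
      simpa [Matrix.IsHermitian, Matrix.IsSymm] using hS.isHermitian
    simp only [hact, tsum_mul_left]
    congr 1
    rw [← e.tsum_eq]
    refine tsum_congr fun γ => ?_
    have hu : ∀ f : Matrix (Fin m) (Fin n) ℤ → ℂ,
        ∑' l : (Set.univ : Set (Matrix (Fin m) (Fin n) ℤ)), f l.1 = ∑' l, f l := fun f => by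
      rw [tsum_subtype, Set.indicator_univ]
    rw [hu (SiegelJacobi.weightedTerm k S P (e γ).1 Z (e γ).1 Z),
      hu (SiegelJacobi.weightedTerm k S P (γ.1 * g) Z (γ.1 * g) Z)]
    exact (SiegelJacobi.tsum_weightedTerm_eq_of_mul_inv_mem hk hSs hSint P (he γ) hZ).symm
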